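/- Let $P$ be a family of $n$ points in $\mathbb{R}^d$ and $\gamma\in(0,1)$. A feasible solution of the one-class SVM with outliers instance $(P,\gamma)$ is a subfamily $P'\subseteq P$ with $|P'|\ge(1-\gamma)n$ together with a hyperplane $\mathcal H=\{x:\langle w,x\rangle=b\}$, $w\neq 0$, $b>0$, separating the origin $o$ from $P'$ (that is, $\langle w,p\rangle\ge b$ for all $p\in P'$); its margin is the distance $b/\|w\|$ of $o$ and $\mathcal H$, and an optimal solution is a feasible one of maximum margin. For $\epsilon\in(0,1)$ and $\delta'>0$, a $(1-\epsilon,1+\delta')$-approximation is a hyperplane that separates $o$ from at least $(1-(1+\delta')\gamma)n$ points of $P$ and whose distance to $o$ is at least $(1-\epsilon)$ times the optimal margin. There are a single randomized real-RAM program (unit-cost exact real arithmetic, comparisons and square roots, unit-cost reading of one coordinate of one input point, unit-cost drawing of a uniformly random integer in a given range) and absolute constants $C_0,C_1,C_2,C_3,c>0$, $k\in\mathbb N$ with the following property. The program gets $n,d,\gamma,\epsilon,\delta,\eta_1,\eta_2$, an integer $z\ge1$, and access to $P$; it outputs a pair $(w,b)$. Let $\epsilon,\delta,\eta_1,\eta_2\in(0,1)$,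 let $(P,\gamma)$ have an optimal solution, with optimal subfamily $P_{\rm opt}$, let $D=\max_{p,q\in P_{\rm opt}}\|p-q\|$, let $\rho$ be the distance between $o$ and the convex hull of $P_{\rm opt}$, and let $z\ge\max\{1,C_0\frac{D^2}{\epsilon\rho^2}\}$. Put $L=1+\log\frac{1}{\eta_1\eta_2\delta(1-\gamma)}$. Then: 1. Whatever its random choices are, the program halts within $C_2\, z\,\frac{d}{\delta^2\gamma\epsilon}\,L^k$ steps. If moreover $z\le C_0\frac{D^2}{\epsilon\rho^2}+1$ (so $z=O(\frac{D^2}{\epsilon\rho^2})$ up to rounding), this number of steps is also at most $C_2\big(\frac{D^2}{\epsilon\rho^2}+1\big)\frac{d}{\delta^2\gamma\epsilon}\,L^k$, that is, $\tilde O\big(\frac{D^2}{\delta^2\gamma\epsilon^2\rho^2}\,d\big)$ up to the rounding of $z$; it does not depend on $n$. 2. With probability at least $(1-\gamma)\Big((1-\eta_1)(1-\eta_2)\frac{\delta}{3(1+\delta)}\Big)^{z}$ the output is a $(1-\epsilon,1+C_1\delta)$-approximation of $(P,\gamma)$. 3. Suppose that the program is run $N$ times independently, where $N\ge C_3\,\frac{1}{1-\gamma}\Big(\frac{1}{1-\eta_1}\big(3+\frac3\delta\big)\Big)^{z}$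 and $\eta_2\le\frac{c}{zN}$. Then, with probability at least $2/3$, an output of largest margin $b/\|w\|$ among the $N$ outputs (every one, if there are ties; the margin counts as $0$ if $w=0$) is a $(1-\epsilon,1+C_1\delta)$-approximation of $(P,\gamma)$. -/

import Mathlib

noncomputable section

/-! ## A randomized real RAM

Programs are finite texts of a small structured language.  The memory has integer cells and real
cells, both indexed by the natural numbers.  Each assignment performs one operation; the cost of a
run is the number of its elementary steps.  The input points are in a read-only input; one
coordinate is read per step.  A random integer in a given range is drawn in one step. -/

namespace RealRAM

/-- The memory: integer cells and real cells. -/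
structure Mem where
  nat : ℕ → ℕ
  real : ℕ → ℝ

/-- An operand: the cell with a fixed address, or the cell whose address is the current content of
a fixed integer cell. -/
inductive Loc where
  | dir (a : ℕ)
  | ind (a : ℕ)

/-- The address an operand refers to. -/
def Loc.addr (m : Mem) : Loc → ℕ
  | .dir a => a
  | .ind a => m.nat a

/-- Content of an integer operand. -/
def Mem.getNat (m : Mem) (x : Loc) : ℕ := m.nat (x.addr m)

/-- Content of a real operand. -/
def Mem.getReal (m : Mem) (x : Loc) : ℝ := m.real (x.addr m)

/-- Overwrite an integer cell. -/
def Mem.setNat (m : Mem) (x : Loc) (v : ℕ) : Mem :=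
  { m with nat := Function.update m.nat (x.addr m) v }

/-- Overwrite a real cell. -/
def Mem.setReal (m : Mem) (x : Loc) (v : ℝ) : Mem :=
  { m with real := Function.update m.real (x.addr m) v }

/-- Integer operations (truncated subtraction, rounded-down division). -/
inductive NatOp where
  | add | sub | mul | div

def NatOp.eval : NatOp → ℕ → ℕ → ℕ
  | .add, a, b => a + b
  | .sub, a, b => a - b
  | .mul, a, b => a * b
  | .div, a, b => a / b

/-- Real operations (exact arithmetic). -/
inductive RealOp where
  | add | sub | mul | div

def RealOp.eval : RealOp → ℝ → ℝ → ℝ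
  | .add, a, b => a + b
  | .sub, a, b => a - b
  | .mul, a, b => a * b
  | .div, a, b => a / b

/-- Comparisons of two integer cells or of two real cells. -/
inductive Test where
  | natLt (x y : Loc)
  | realLt (x y : Loc)

def Test.Holds (m : Mem) : Test → Prop
  | .natLt x y => m.getNat x < m.getNat y
  | .realLt x y => m.getReal x < m.getReal y

/-- Programs. -/
inductive Cmd where
  /-- integer cell `x` becomes the constant `c` -/
  | natConst (x : Loc) (c : ℕ)
  /-- integer cell `x` becomes `y op w` -/
  | natOp (op : NatOp) (x y w : Loc)
  /-- real cell `x` becomes the integer in the integer cell `y` -/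
  | cast (x y : Loc)
  /-- real cell `x` becomes `y op w` -/
  | realOp (op : RealOp) (x y w : Loc)
  /-- real cell `x` becomes the square root of `y` -/
  | sqrt (x y : Loc)
  /-- real cell `x` becomes the coordinate of the input point with index in the integer cell `i`
  at the position in the integer cell `j` -/
  | load (x i j : Loc)
  /-- integer cell `x` becomes a fresh uniformly random integer below the content of `y` -/
  | random (x y : Loc)
  /-- one program after the other -/
  | seq (p q : Cmd)
  /-- conditional -/
  | cond (t : Test) (p q : Cmd)
  /-- repeat `p` as long as the test holds -/
  | loop (t : Test) (p : Cmd)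

/-- A configuration: the list of programs still to be executed, and the memory. -/
structure Config where
  code : List Cmd
  mem : Mem

/-- The uniform distribution on `{0, …, k - 1}` (for `k = 0`: the point mass at `0`). -/
def uniformBelow (k : ℕ) : PMF ℕ :=
  PMF.uniformOfFinset (Finset.range (max 1 k)) ⟨0, Finset.mem_range.2 (by simp)⟩

/-- Coordinate `j` of the input point number `i` (counted from `0`), and `0` out of range. -/
def coord {n d : ℕ} (P : Fin n → EuclideanSpace ℝ (Fin d)) (i j : ℕ) : ℝ :=
  if h : i < n ∧ j < d then P ⟨i, h.1⟩ ⟨j, h.2⟩ else 0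

open Classical in
/-- One elementary step on the input `P`.  A configuration with no code left has halted. -/
def step {n d : ℕ} (P : Fin n → EuclideanSpace ℝ (Fin d)) : Config → PMF Config
  | ⟨[], m⟩ => PMF.pure ⟨[], m⟩
  | ⟨.natConst x c :: K, m⟩ => PMF.pure ⟨K, m.setNat x c⟩
  | ⟨.natOp op x y w :: K, m⟩ => PMF.pure ⟨K, m.setNat x (op.eval (m.getNat y) (m.getNat w))⟩
  | ⟨.cast x y :: K, m⟩ => PMF.pure ⟨K, m.setReal x (m.getNat y)⟩
  | ⟨.realOp op x y w :: K, m⟩ =>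
      PMF.pure ⟨K, m.setReal x (op.eval (m.getReal y) (m.getReal w))⟩
  | ⟨.sqrt x y :: K, m⟩ => PMF.pure ⟨K, m.setReal x (Real.sqrt (m.getReal y))⟩
  | ⟨.load x i j :: K, m⟩ => PMF.pure ⟨K, m.setReal x (coord P (m.getNat i) (m.getNat j))⟩
  | ⟨.random x y :: K, m⟩ => (uniformBelow (m.getNat y)).map fun v => ⟨K, m.setNat x v⟩
  | ⟨.seq p q :: K, m⟩ => PMF.pure ⟨p :: q :: K, m⟩
  | ⟨.cond t p q :: K, m⟩ => PMF.pure (if t.Holds m then ⟨p :: K, m⟩ else ⟨q :: K, m⟩)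
  | ⟨.loop t p :: K, m⟩ => PMF.pure (if t.Holds m then ⟨p :: .loop t p :: K, m⟩ else ⟨K, m⟩)

/-- The distribution of the configuration after `T` elementary steps. -/
def run {n d : ℕ} (P : Fin n → EuclideanSpace ℝ (Fin d)) : ℕ → Config → PMF Config
  | 0, c => PMF.pure c
  | T + 1, c => (step P c).bind (run P T)

/-- Whatever the random choices are, the run from `c` has halted after at most `T` steps. -/
def HaltsWithin {n d : ℕ} (P : Fin n → EuclideanSpace ℝ (Fin d)) (T : ℕ) (c : Config) : Prop :=
  ∀ c' ∈ (run P T c).support, c'.code = []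

/-- The distribution of `N` independent draws from `p`. -/
def iid {α : Type*} (p : PMF α) : ℕ → PMF (List α)
  | 0 => PMF.pure []
  | N + 1 => p.bind fun a => (iid p N).map fun l => a :: l

end RealRAM

/-! ## One-class SVM with outliers -/

namespace OneClassSVM

/-- The hyperplane `⟪normal, x⟫ = offset` with the closed half-space `offset ≤ ⟪normal, x⟫`. -/
structure Halfspace (d : ℕ) where
  normal : EuclideanSpace ℝ (Fin d)
  offset : ℝ

/-- This is an actual half-space and it does not contain the origin. -/
def Halfspace.Proper {d : ℕ} (H : Halfspace d) : Prop := H.normal ≠ 0 ∧ 0 < H.offset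

/-- The point `p` is in the half-space. -/
def Halfspace.Covers {d : ℕ} (H : Halfspace d) (p : EuclideanSpace ℝ (Fin d)) : Prop :=
  H.offset ≤ inner ℝ H.normal p

/-- The distance between the origin and the hyperplane (for a proper half-space). -/
def Halfspace.margin {d : ℕ} (H : Halfspace d) : ℝ := H.offset / ‖H.normal‖

/-- The hyperplane `H` separates the origin from the at least `(1 - γ) n` points of `P` with index
in `S`. -/
def IsFeasible {n d : ℕ} (P : Fin n → EuclideanSpace ℝ (Fin d)) (γ : ℝ) (S : Finset (Fin n))
    (H : Halfspace d) : Prop :=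
  (1 - γ) * n ≤ S.card ∧ H.Proper ∧ ∀ i ∈ S, H.Covers (P i)

/-- An optimal solution of the instance `(P, γ)`. -/
def IsOptimal {n d : ℕ} (P : Fin n → EuclideanSpace ℝ (Fin d)) (γ : ℝ) (S : Finset (Fin n))
    (H : Halfspace d) : Prop :=
  IsFeasible P γ S H ∧ ∀ S' H', IsFeasible P γ S' H' → H'.margin ≤ H.margin

/-- `H` is a `(1 - ε, 1 + δ)`-approximation: it separates the origin from at least
`(1 - (1 + δ) γ) n` points, at a distance at least `1 - ε` times that of every feasible (hence of
an optimal) solution. -/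
def IsApprox {n d : ℕ} (P : Fin n → EuclideanSpace ℝ (Fin d)) (γ ε δ : ℝ)
    (H : Halfspace d) : Prop :=
  (∃ S, IsFeasible P ((1 + δ) * γ) S H) ∧
    ∀ S' H', IsFeasible P γ S' H' → (1 - ε) * H'.margin ≤ H.margin

/-- The polytope distance between the origin and the points with index in `S`. -/
def polytopeDist {n d : ℕ} (P : Fin n → EuclideanSpace ℝ (Fin d)) (S : Finset (Fin n)) : ℝ :=
  Metric.infDist 0 (convexHull ℝ (P '' S))

/-- The largest distance between two points with index in `S`. -/
def diameter {n d : ℕ} (P : Fin n → EuclideanSpace ℝ (Fin d)) (S : Finset (Fin n)) : ℝ :=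
  Metric.diam (P '' S)

/-- The start: the integer cells `0, 1, 2` hold `n, d, z`, the real cells `0, …, 4` hold
`γ, ε, δ, η₁, η₂`, and all others are `0`. -/
def start (prog : RealRAM.Cmd) (n d z : ℕ) (γ ε δ η₁ η₂ : ℝ) : RealRAM.Config where
  code := [prog]
  mem :=
    { nat := fun a => [n, d, z].getD a 0
      real := fun a => [γ, ε, δ, η₁, η₂].getD a 0 }

/-- The output: real cell `0` is the offset, the real cells `1, …, d` are the normal vector. -/
def output (d : ℕ) (c : RealRAM.Config) : Halfspace d where
  normal := WithLp.toLp 2 fun j : Fin d => c.mem.real (j + 1)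
  offset := c.mem.real 0

/-- The distribution of the output after `T` steps. -/
def outputDist {n d : ℕ} (P : Fin n → EuclideanSpace ℝ (Fin d)) (T : ℕ) (c : RealRAM.Config) :
    PMF (Halfspace d) :=
  (RealRAM.run P T c).map (output d)

/-- Every element of the list `l` with the largest margin among the elements of `l` is a
`(1 - ε, 1 + δ)`-approximation. -/
def BestIsApprox {n d : ℕ} (P : Fin n → EuclideanSpace ℝ (Fin d)) (γ ε δ : ℝ)
    (l : List (Halfspace d)) : Prop :=
  ∀ H ∈ l, (∀ H' ∈ l, H'.margin ≤ H.margin) → IsApprox P γ ε δ H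

end OneClassSVM

end

/-!
The program follows Gilbert's method for the point of a polytope nearest to the origin.  It keeps a
vector `x`, which starts as a random point of `P`.  In each of `z` iterations it draws about
`1 / (2 γ)` random points, takes the one, `p`, with the least inner product with `x` as the candidate,
and replaces `x` by the point nearest to the origin on the segment from `x` to `p`.  The halfspace
`{q | ⟪x, p⟫ ≤ ⟪x, q⟫}` is tested by sampling, and the output is the tested halfspace with the
largest margin.

*Search* (`runs_search`, `search_success_bound`).  At most `γ n` points are outside of the optimal
subfamily `S`.  If no sample point is outside of `S`, and one is among the lowest `8 δ γ n` points of
`S`, then `p ∈ S`, and at most `(1 + 8 δ) γ n` points are below `p`.  With `m` samples this has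
probability `σ ^ m - (σ - β) ^ m`, with `σ = |S| / n` and `β ≥ 8 δ γ`, which is at least
`δ / (3 (1 + δ))` for `m ≈ 1 / (2 γ)`.

*Test* (`runs_test`).  A weight is multiplied by `1 + δ` at each sample point that the halfspace
misses, and divided by `1 + (1 + 8 δ) γ δ` in each round.  It is a supermartingale if at most
`(1 + 8 δ) γ n` points are missed; if more than `(1 + 19 δ) γ n` points are missed, its inverse
shrinks by the factor `1 - γ δ ^ 2` in expectation.  So `O(log (1 / η₂) / (γ δ ^ 2))` rounds make both
error probabilities at most `η₂`, by Markov's inequality.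

*Convergence* (`excess_step`, `Progress.margin_ge`).  Let `x` be in the convex hull of the optimal
subfamily and `p` in the optimal subfamily.  If the candidate has a margin `⟪x, p⟫ / ‖x‖` of at least
`(1 - ε) ρ`, then it is good enough, as `ρ` bounds the margin of every feasible solution.
Otherwise the step decreases the excess `u = ‖x‖ - (1 - ε) ρ` such that `1 / u` grows by
`ρ / (2 D ^ 2)`.  As `u ≥ ε ρ`, this cannot happen in more than `2 D ^ 2 / (ε ρ ^ 2)` iterations.

If `(1 + 19 δ) γ ≥ 1`, then an approximation need not cover any point, and the halfspace
`{q | ‖x‖ ^ 2 ≤ ⟪x, q⟫}` with the starting point `x ∈ S` is good enough.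

For independent runs, an output of positive margin that covers too few points has a
probability of at most `1 - (1 - η₂) ^ z` in each run.  If no run has such an output and one of them
is successful, then the output of largest margin is an approximation.

The semantics of the program is treated through the relation `RealRAM.Runs`, which bounds the
number of steps of a piece of code and gives the distribution of the memory after it.  Two rules
for loops (`Runs.uniform_loop`, `Runs.counted_loop`) turn estimates for one round into
estimates for the probability of events after the loop.
-/

namespace RealRAM

/-! ### Running times and output distributions of programs -/

section Semantics

variable {n d : ℕ} {P : Fin n → EuclideanSpace ℝ (Fin d)}

theorem bind_congr_on_support {α β : Type*} (μ : PMF α) {f g : α → PMF β}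
    (h : ∀ a ∈ μ.support, f a = g a) : μ.bind f = μ.bind g := by
  ext b
  rw [PMF.bind_apply, PMF.bind_apply]
  refine tsum_congr fun a => ?_
  by_cases ha : μ a = 0
  · simp [ha]
  · rw [h a ((PMF.mem_support_iff _ _).2 ha)]

theorem run_add (S T : ℕ) (c : Config) : run P (S + T) c = (run P S c).bind (run P T) := by
  induction S generalizing c with
  | zero => simp [run]
  | succ S ih =>
    rw [Nat.succ_add, run, run, PMF.bind_bind]
    exact congrArg _ (funext ih)

theorem run_halted (T : ℕ) (m : Mem) : run P T ⟨[], m⟩ = PMF.pure ⟨[], m⟩ := by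
  induction T with
  | zero => rfl
  | succ T ih => rw [run, step, PMF.pure_bind, ih]

variable (P) in
/-- From the configuration `c` the computation halts within `T` steps, and `ν` is the distribution
of the final memory. -/
def FinishesAs (T : ℕ) (c : Config) (ν : PMF Mem) : Prop :=
  run P T c = ν.map (Config.mk [])

theorem FinishesAs.mono {S T : ℕ} {c : Config} {ν : PMF Mem} (h : FinishesAs P S c ν)
    (hST : S ≤ T) : FinishesAs P T c ν := by
  obtain ⟨r, rfl⟩ := Nat.exists_eq_add_of_le hST
  unfold FinishesAs at *
  rw [run_add, h, PMF.bind_map]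
  have : (run P r ∘ Config.mk []) = fun m => PMF.pure (Config.mk [] m) :=
    funext fun m => run_halted r m
  rw [this]
  rfl

variable (P) in
/-- Started in the memory `m`, the program `p` terminates within `t` steps, and `μ` is the
distribution of the memory at that moment.  This is expressed in continuation-passing style: any
code `K` may follow, and it need not start at the same time on all random branches. -/
def Runs (p : Cmd) (m : Mem) (t : ℕ) (μ : PMF Mem) : Prop :=
  ∀ (K : List Cmd) (s : ℕ) (ν : Mem → PMF Mem),
    (∀ m' ∈ μ.support, FinishesAs P s ⟨K, m'⟩ (ν m')) →
      FinishesAs P (t + s) ⟨p :: K, m⟩ (μ.bind ν)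

theorem Runs.finishesAs {p : Cmd} {m : Mem} {t : ℕ} {μ : PMF Mem} (h : Runs P p m t μ) :
    FinishesAs P t ⟨[p], m⟩ μ := by
  have := h [] 0 PMF.pure fun m' _ => by
    unfold FinishesAs
    rw [PMF.pure_map]; rfl
  simpa using this

theorem Runs.mono {p : Cmd} {m : Mem} {s t : ℕ} {μ : PMF Mem} (h : Runs P p m s μ)
    (hst : s ≤ t) : Runs P p m t μ :=
  fun K r ν hν => (h K r ν hν).mono (by omega)

theorem finishesAs_of_step {c : Config} {T : ℕ} {α : Type*} {μ : PMF α} {g : α → Config}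
    {ν : α → PMF Mem} (hc : step P c = μ.map g)
    (h : ∀ a ∈ μ.support, FinishesAs P T (g a) (ν a)) :
    FinishesAs P (T + 1) c (μ.bind ν) := by
  unfold FinishesAs at *
  rw [run, hc, PMF.bind_map, PMF.map_bind]
  exact bind_congr_on_support μ h

theorem finishesAs_of_step_pure {c c' : Config} {T : ℕ} {ν : PMF Mem}
    (hc : step P c = PMF.pure c') (h : FinishesAs P T c' ν) :
    FinishesAs P (T + 1) c ν := by
  unfold FinishesAs at *
  rw [run, hc, PMF.pure_bind, h]

theorem Runs.of_step {p : Cmd} {m : Mem} {μ : PMF Mem}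
    (hp : ∀ K, step P ⟨p :: K, m⟩ = μ.map fun m' => ⟨K, m'⟩) : Runs P p m 1 μ := by
  intro K s ν hν
  rw [add_comm]
  exact finishesAs_of_step (hp K) hν

theorem Runs.seq {p q : Cmd} {m : Mem} {s t : ℕ} {μ : PMF Mem} {ν : Mem → PMF Mem}
    (hp : Runs P p m s μ) (hq : ∀ m' ∈ μ.support, Runs P q m' t (ν m')) :
    Runs P (.seq p q) m (s + t + 1) (μ.bind ν) := by
  intro K r ξ hξ
  have h1 : FinishesAs P (s + (t + r)) ⟨p :: q :: K, m⟩ (μ.bind fun m' => (ν m').bind ξ) := by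
    refine hp _ _ _ fun m' hm' => hq m' hm' K r ξ fun m'' hm'' => hξ m'' ?_
    exact (PMF.mem_support_bind_iff _ _ _).2 ⟨m', hm', hm''⟩
  rw [PMF.bind_bind]
  have h2 := finishesAs_of_step_pure (c := ⟨.seq p q :: K, m⟩) (by rw [step]) h1
  exact h2.mono (by omega)

theorem Runs.seq_pure {p q : Cmd} {m m' : Mem} {s t : ℕ} {ν : PMF Mem}
    (hp : Runs P p m s (PMF.pure m')) (hq : Runs P q m' t ν) :
    Runs P (.seq p q) m (s + t + 1) ν := by
  have := hp.seq (q := q) (t := t) (ν := fun _ => ν) (by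
    intro m'' hm''
    rw [PMF.support_pure, Set.mem_singleton_iff] at hm''
    exact hm'' ▸ hq)
  simpa using this

/-- The semantics of a sequence whose second part is only known through a property `Φ` of its
output distributions. -/
theorem Runs.seq_exists {p q : Cmd} {m : Mem} {s t : ℕ} {μ : PMF Mem}
    {Φ : Mem → PMF Mem → Prop} (hp : Runs P p m s μ)
    (hq : ∀ m' ∈ μ.support, ∃ ν, Runs P q m' t ν ∧ Φ m' ν) :
    ∃ ν : Mem → PMF Mem, Runs P (.seq p q) m (s + t + 1) (μ.bind ν) ∧
      ∀ m' ∈ μ.support, Φ m' (ν m') := by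
  choose! ν hν using hq
  exact ⟨ν, hp.seq fun m' hm' => (hν m' hm').1, fun m' hm' => (hν m' hm').2⟩

theorem Runs.cond_true {b : Test} {p q : Cmd} {m : Mem} {t : ℕ} {μ : PMF Mem} (hb : b.Holds m)
    (hp : Runs P p m t μ) : Runs P (.cond b p q) m (t + 1) μ := by
  intro K s ν hν
  have := finishesAs_of_step_pure (c := ⟨.cond b p q :: K, m⟩) (by rw [step, if_pos hb])
    (hp K s ν hν)
  exact this.mono (by omega)

theorem Runs.cond_false {b : Test} {p q : Cmd} {m : Mem} {t : ℕ} {μ : PMF Mem} (hb : ¬ b.Holds m)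
    (hq : Runs P q m t μ) : Runs P (.cond b p q) m (t + 1) μ := by
  intro K s ν hν
  have := finishesAs_of_step_pure (c := ⟨.cond b p q :: K, m⟩) (by rw [step, if_neg hb])
    (hq K s ν hν)
  exact this.mono (by omega)

theorem Runs.loop_false {b : Test} {p : Cmd} {m : Mem} (hb : ¬ b.Holds m) :
    Runs P (.loop b p) m 1 (PMF.pure m) := by
  intro K s ν hν
  rw [PMF.pure_bind, add_comm]
  exact finishesAs_of_step_pure (by rw [step, if_neg hb]) (hν m (by simp))

theorem Runs.loop_true {b : Test} {p : Cmd} {m : Mem} {s t : ℕ} {μ : PMF Mem}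
    {ν : Mem → PMF Mem} (hb : b.Holds m) (hp : Runs P p m s μ)
    (hl : ∀ m' ∈ μ.support, Runs P (.loop b p) m' t (ν m')) :
    Runs P (.loop b p) m (s + t + 1) (μ.bind ν) := by
  intro K r ξ hξ
  have h1 : FinishesAs P (s + (t + r)) ⟨p :: .loop b p :: K, m⟩
      (μ.bind fun m' => (ν m').bind ξ) := by
    refine hp _ _ _ fun m' hm' => hl m' hm' K r ξ fun m'' hm'' => hξ m'' ?_
    exact (PMF.mem_support_bind_iff _ _ _).2 ⟨m', hm', hm''⟩
  rw [PMF.bind_bind]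
  have h2 := finishesAs_of_step_pure (c := ⟨.loop b p :: K, m⟩) (by rw [step, if_pos hb]) h1
  exact h2.mono (by omega)

theorem Runs.random {x y : Loc} {m : Mem} :
    Runs P (.random x y) m 1 ((uniformBelow (m.getNat y)).map fun v => m.setNat x v) :=
  .of_step fun K => by rw [step, PMF.map_comp]; rfl

/-- A counted loop with a deterministic body and the invariant `I`. -/
theorem Runs.for_loop {b : Test} {p : Cmd} {T : ℕ} {Q : Mem → Prop} (k t : ℕ)
    (I : ℕ → Mem → Prop)
    (hbody : ∀ j < k, ∀ m, I j m →
      b.Holds m ∧ ∃ m', Runs P p m t (PMF.pure m') ∧ I (j + 1) m')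
    (hexit : ∀ m, I k m → ¬ b.Holds m ∧ Q m) {m : Mem} (h0 : I 0 m)
    (hT : k * (t + 1) + 1 ≤ T) :
    ∃ m', Runs P (.loop b p) m T (PMF.pure m') ∧ Q m' := by
  have key : ∀ r j, j + r = k → ∀ m, I j m →
      ∃ m', Runs P (.loop b p) m (r * (t + 1) + 1) (PMF.pure m') ∧ I k m' := by
    intro r
    induction r with
    | zero =>
      rintro j rfl m hm
      exact ⟨m, (Runs.loop_false (hexit m hm).1).mono (by omega), hm⟩
    | succ r ih =>
      intro j hj m hm
      obtain ⟨hb, m₁, hr, h1⟩ := hbody j (by omega) m hm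
      obtain ⟨m₂, hr', h2⟩ := ih (j + 1) (by omega) m₁ h1
      refine ⟨m₂, ?_, h2⟩
      have := Runs.loop_true (ν := fun _ => PMF.pure m₂) hb hr (by
        intro m' hm'
        rw [PMF.support_pure, Set.mem_singleton_iff] at hm'
        exact hm' ▸ hr')
      rw [PMF.pure_bind] at this
      exact this.mono (by ring_nf; omega)
  obtain ⟨m', hr, hI⟩ := key k 0 (by omega) m h0
  exact ⟨m', hr.mono hT, (hexit m' hI).2⟩

/-- The effect of a deterministic instruction on the memory. -/
noncomputable def Cmd.exec (P : Fin n → EuclideanSpace ℝ (Fin d)) : Cmd → Mem → Mem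
  | .natConst x c, m => m.setNat x c
  | .natOp op x y w, m => m.setNat x (op.eval (m.getNat y) (m.getNat w))
  | .cast x y, m => m.setReal x (m.getNat y)
  | .realOp op x y w, m => m.setReal x (op.eval (m.getReal y) (m.getReal w))
  | .sqrt x y, m => m.setReal x (Real.sqrt (m.getReal y))
  | .load x i j, m => m.setReal x (coord P (m.getNat i) (m.getNat j))
  | _, m => m

/-- The program is a single deterministic instruction. -/
def Cmd.isBasic : Cmd → Bool
  | .natConst _ _ | .natOp _ _ _ _ | .cast _ _ | .realOp _ _ _ _ | .sqrt _ _ | .load _ _ _ => true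
  | _ => false

/-- A program without effect: a loop that is never entered. -/
def nop : Cmd := .loop (.natLt (.dir 0) (.dir 0)) (.natConst (.dir 0) 0)

/-- One program after the other. -/
def block : List Cmd → Cmd
  | [] => nop
  | c :: cs => .seq c (block cs)

theorem Runs.nop {m : Mem} : Runs P nop m 1 (PMF.pure m) :=
  .loop_false (by simp [Test.Holds])

theorem Runs.basic {c : Cmd} {m : Mem} (hc : c.isBasic = true) :
    Runs P c m 1 (PMF.pure (c.exec P m)) := by
  refine .of_step fun K => ?_
  rw [PMF.pure_map]
  cases c <;> first | rfl | simp [Cmd.isBasic] at hc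

theorem Runs.block {cs : List Cmd} {m : Mem} (hc : (cs.all Cmd.isBasic) = true) :
    Runs P (block cs) m (2 * cs.length + 1)
      (PMF.pure (cs.foldl (fun m c => c.exec P m) m)) := by
  induction cs generalizing m with
  | nil => exact Runs.nop
  | cons c cs ih =>
    rw [List.all_cons, Bool.and_eq_true] at hc
    exact ((Runs.basic hc.1).seq_pure (ih hc.2)).mono (by simp; omega)

/-- A block of deterministic instructions, with any property `Q` of the resulting memory. -/
theorem Runs.exists_block {cs : List Cmd} {m : Mem} {t : ℕ} {Q : Mem → Prop}
    (hc : (cs.all Cmd.isBasic) = true) (ht : 2 * cs.length + 1 ≤ t)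
    (hQ : Q (cs.foldl (fun m c => c.exec P m) m)) :
    ∃ m', Runs P (RealRAM.block cs) m t (PMF.pure m') ∧ Q m' :=
  ⟨_, (Runs.block hc).mono ht, hQ⟩

theorem Runs.exists_seq {p q : Cmd} {m : Mem} {r s t : ℕ} {Q R : Mem → Prop}
    (hp : ∃ m', Runs P p m r (PMF.pure m') ∧ Q m')
    (hq : ∀ m', Q m' → ∃ m'', Runs P q m' s (PMF.pure m'') ∧ R m'') (ht : r + s + 1 ≤ t) :
    ∃ m', Runs P (.seq p q) m t (PMF.pure m') ∧ R m' := by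
  obtain ⟨m₁, h1, hQ⟩ := hp
  obtain ⟨m₂, h2, hR⟩ := hq m₁ hQ
  exact ⟨m₂, (h1.seq_pure h2).mono ht, hR⟩

theorem Runs.exists_cond {b : Test} {p q : Cmd} {m : Mem} {t : ℕ} {Q : Mem → Prop}
    (hp : b.Holds m → ∃ m', Runs P p m t (PMF.pure m') ∧ Q m')
    (hq : ¬ b.Holds m → ∃ m', Runs P q m t (PMF.pure m') ∧ Q m') :
    ∃ m', Runs P (.cond b p q) m (t + 1) (PMF.pure m') ∧ Q m' := by
  by_cases hb : b.Holds m
  · obtain ⟨m', h, hQ⟩ := hp hb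
    exact ⟨m', .cond_true hb h, hQ⟩
  · obtain ⟨m', h, hQ⟩ := hq hb
    exact ⟨m', .cond_false hb h, hQ⟩

end Semantics

/-! ### Simplification of memory accesses -/

section Memory

attribute [simp] Cmd.exec NatOp.eval RealOp.eval

variable (m : Mem) (x : Loc) (a v : ℕ) (r : ℝ)

@[simp] theorem Loc.addr_dir : (Loc.dir a).addr m = a := rfl

@[simp] theorem Loc.addr_ind : (Loc.ind a).addr m = m.nat a := rfl

@[simp] theorem Mem.getNat_eq : m.getNat x = m.nat (x.addr m) := rfl

@[simp] theorem Mem.getReal_eq : m.getReal x = m.real (x.addr m) := rfl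

@[simp] theorem Mem.setNat_nat :
    (m.setNat x v).nat a = if a = x.addr m then v else m.nat a := by
  simp [Mem.setNat, Function.update_apply]

@[simp] theorem Mem.setNat_real : (m.setNat x v).real = m.real := rfl

@[simp] theorem Mem.setReal_nat : (m.setReal x r).nat = m.nat := rfl

@[simp] theorem Mem.setReal_real :
    (m.setReal x r).real a = if a = x.addr m then r else m.real a := by
  simp [Mem.setReal, Function.update_apply]

@[simp] theorem Test.holds_natLt {y : Loc} :
    (Test.natLt x y).Holds m ↔ m.nat (x.addr m) < m.nat (y.addr m) := Iff.rfl

@[simp] theorem Test.holds_realLt {y : Loc} :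
    (Test.realLt x y).Holds m ↔ m.real (x.addr m) < m.real (y.addr m) := Iff.rfl

end Memory

/-! ### Probabilities of events -/

section Probability

/-- The probability of the event `A`. -/
noncomputable def prob {α : Type*} (μ : PMF α) (A : Set α) : ℝ := (μ.toOuterMeasure A).toReal

variable {α β : Type*} {μ : PMF α}

theorem toOuterMeasure_le_one (μ : PMF α) (A : Set α) : μ.toOuterMeasure A ≤ 1 := by
  calc μ.toOuterMeasure A ≤ μ.toOuterMeasure Set.univ := μ.toOuterMeasure.mono (Set.subset_univ _)
    _ = 1 := (PMF.toOuterMeasure_apply_eq_one_iff _ _).2 (Set.subset_univ _)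

theorem toOuterMeasure_ne_top (μ : PMF α) (A : Set α) : μ.toOuterMeasure A ≠ ⊤ :=
  ne_top_of_le_ne_top ENNReal.one_ne_top (toOuterMeasure_le_one μ A)

theorem ofReal_prob (μ : PMF α) (A : Set α) : ENNReal.ofReal (prob μ A) = μ.toOuterMeasure A :=
  ENNReal.ofReal_toReal (toOuterMeasure_ne_top μ A)

theorem prob_nonneg (μ : PMF α) (A : Set α) : 0 ≤ prob μ A := ENNReal.toReal_nonneg

theorem prob_le_one (μ : PMF α) (A : Set α) : prob μ A ≤ 1 :=
  ENNReal.toReal_le_of_le_ofReal zero_le_one (by simpa using toOuterMeasure_le_one μ A)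

theorem prob_mono_on_support {A B : Set α} (h : ∀ a ∈ μ.support, a ∈ A → a ∈ B) :
    prob μ A ≤ prob μ B := by
  refine ENNReal.toReal_mono (toOuterMeasure_ne_top _ _) (PMF.toOuterMeasure_mono _ ?_)
  rintro a ⟨ha, hs⟩
  exact h a hs ha

theorem prob_mono {A B : Set α} (h : A ⊆ B) : prob μ A ≤ prob μ B :=
  prob_mono_on_support fun _ _ ha => h ha

theorem prob_eq_one {A : Set α} (h : ∀ a ∈ μ.support, a ∈ A) : prob μ A = 1 := by
  rw [prob, (PMF.toOuterMeasure_apply_eq_one_iff _ _).2 h, ENNReal.toReal_one]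

theorem prob_pure {a : α} {A : Set α} (h : a ∈ A) : prob (PMF.pure a) A = 1 :=
  prob_eq_one fun b hb => by
    rw [PMF.support_pure, Set.mem_singleton_iff] at hb
    exact hb ▸ h

theorem prob_compl (μ : PMF α) (A : Set α) : prob μ Aᶜ = 1 - prob μ A := by
  have h : μ.toOuterMeasure A + μ.toOuterMeasure Aᶜ = 1 := by
    rw [PMF.toOuterMeasure_apply, PMF.toOuterMeasure_apply, ← ENNReal.tsum_add, ← μ.tsum_coe]
    refine tsum_congr fun a => ?_
    by_cases ha : a ∈ A <;> simp [ha]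
  have h' := congrArg ENNReal.toReal h
  rw [ENNReal.toReal_add (toOuterMeasure_ne_top _ _) (toOuterMeasure_ne_top _ _),
    ENNReal.toReal_one] at h'
  unfold prob
  linarith

theorem prob_inter_ge (μ : PMF α) (A B : Set α) : prob μ A + prob μ B - 1 ≤ prob μ (A ∩ B) := by
  have h1 : prob μ (Aᶜ ∪ Bᶜ) ≤ prob μ Aᶜ + prob μ Bᶜ := by
    unfold prob
    rw [← ENNReal.toReal_add (toOuterMeasure_ne_top _ _) (toOuterMeasure_ne_top _ _)]
    exact ENNReal.toReal_mono (ENNReal.add_ne_top.2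
      ⟨toOuterMeasure_ne_top _ _, toOuterMeasure_ne_top _ _⟩) (MeasureTheory.measure_union_le _ _)
  rw [← Set.compl_inter, prob_compl, prob_compl, prob_compl] at h1
  linarith

theorem prob_map (μ : PMF α) (f : α → β) (A : Set β) : prob (μ.map f) A = prob μ (f ⁻¹' A) := by
  rw [prob, PMF.toOuterMeasure_map_apply, prob]

/-- The two-stage estimate: if the first stage ends in `E` with probability at least `a`, and from
there the second stage ends in `A` with probability at least `b`. -/
theorem le_prob_bind {ν : α → PMF β} {A : Set β} {E : Set α} {a b : ℝ} (hb : 0 ≤ b)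
    (hE : a ≤ prob μ E) (h : ∀ x ∈ μ.support, x ∈ E → b ≤ prob (ν x) A) :
    a * b ≤ prob (μ.bind ν) A := by
  refine (mul_le_mul_of_nonneg_right hE hb).trans ?_
  rw [prob, ← ENNReal.toReal_ofReal hb, ← ENNReal.toReal_mul]
  refine ENNReal.toReal_mono (toOuterMeasure_ne_top _ _) ?_
  rw [PMF.toOuterMeasure_bind_apply, PMF.toOuterMeasure_apply, ← ENNReal.tsum_mul_right]
  refine ENNReal.tsum_le_tsum fun x => ?_
  by_cases hx : x ∈ E
  · rw [Set.indicator_of_mem hx]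
    by_cases h0 : μ x = 0
    · simp [h0]
    · gcongr
      rw [← ofReal_prob]
      exact ENNReal.ofReal_le_ofReal (h x ((PMF.mem_support_iff _ _).2 h0) hx)
  · rw [Set.indicator_of_notMem hx, zero_mul]
    exact zero_le

theorem uniformBelow_apply {n : ℕ} (hn : 0 < n) (i : ℕ) :
    uniformBelow n i = if i < n then (n : ENNReal)⁻¹ else 0 := by
  have h1 : max 1 n = n := max_eq_right hn
  refine (PMF.uniformOfFinset_apply _ i).trans ?_
  simp only [Finset.mem_range, Finset.card_range, h1]

/-- Drawing a uniformly random index and going on with `ν` averages the probabilities. -/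
theorem prob_uniformBelow_bind {n : ℕ} (hn : 0 < n) (ν : ℕ → PMF β) (A : Set β) :
    prob ((uniformBelow n).bind ν) A = (∑ i : Fin n, prob (ν i) A) / n := by
  have h2 : ((uniformBelow n).bind ν).toOuterMeasure A
      = ∑ i ∈ Finset.range n, (n : ENNReal)⁻¹ * (ν i).toOuterMeasure A := by
    rw [PMF.toOuterMeasure_bind_apply, tsum_eq_sum (s := Finset.range n)]
    · refine Finset.sum_congr rfl fun i hi => ?_
      rw [uniformBelow_apply hn, if_pos (Finset.mem_range.1 hi)]
    · intro i hi
      rw [uniformBelow_apply hn, if_neg (by simpa using hi), zero_mul]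
  rw [prob, h2, ENNReal.toReal_sum, ← Fin.sum_univ_eq_sum_range
    (fun i => ((n : ENNReal)⁻¹ * (ν i).toOuterMeasure A).toReal) n, Finset.sum_div]
  · refine Finset.sum_congr rfl fun i _ => ?_
    rw [ENNReal.toReal_mul, ENNReal.toReal_inv, ENNReal.toReal_natCast, prob, div_eq_inv_mul]
  · intro i _
    exact ENNReal.mul_ne_top (by simp; omega) (toOuterMeasure_ne_top _ _)

theorem mem_support_uniformBelow {n i : ℕ} (hn : 0 < n) :
    i ∈ (uniformBelow n).support ↔ i < n := by
  rw [PMF.mem_support_iff, uniformBelow_apply hn]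
  simp

theorem le_prob_uniformBelow {n : ℕ} (hn : 0 < n) (A : Set ℕ) (S : Finset (Fin n))
    (h : ∀ i ∈ S, (i : ℕ) ∈ A) : (S.card : ℝ) / n ≤ prob (uniformBelow n) A := by
  classical
  have h1 := prob_uniformBelow_bind hn PMF.pure A
  rw [PMF.bind_pure] at h1
  rw [h1]
  gcongr
  calc (S.card : ℝ) = ∑ i ∈ S, (1 : ℝ) := by simp
    _ ≤ ∑ i ∈ S, prob (PMF.pure (i : ℕ)) A :=
        Finset.sum_le_sum fun i hi => (prob_pure (h i hi)).ge
    _ ≤ _ := Finset.sum_le_sum_of_subset_of_nonneg (Finset.subset_univ _)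
        fun i _ _ => prob_nonneg _ _

end Probability

/-! ### Loops with random bodies -/

section RandomLoops

variable {n d : ℕ} {P : Fin n → EuclideanSpace ℝ (Fin d)}

theorem Runs.uniform_seq {x y : Loc} {q : Cmd} {m : Mem} {t : ℕ} {Q : Fin n → Mem → Prop}
    (hn : 0 < n) (hy : m.getNat y = n)
    (hq : ∀ i : Fin n, ∃ m', Runs P q (m.setNat x i) t (PMF.pure m') ∧ Q i m') :
    ∃ f : ℕ → Mem, Runs P (.seq (.random x y) q) m (t + 2) ((uniformBelow n).map f) ∧
      ∀ i : Fin n, Q i (f i) := by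
  have hq' : ∀ i : ℕ, i < n → ∃ m', Runs P q (m.setNat x i) t (PMF.pure m') ∧
      ∀ h : i < n, Q ⟨i, h⟩ m' := fun i hi =>
    (hq ⟨i, hi⟩).imp fun m' h => ⟨h.1, fun _ => h.2⟩
  have : Nonempty Mem := ⟨m⟩
  choose! f hf using hq'
  refine ⟨f, ?_, fun i => (hf i i.2).2 i.2⟩
  intro K s ν hν
  rw [PMF.bind_map]
  have h1 : FinishesAs P (t + s + 1) ⟨.random x y :: q :: K, m⟩
      ((uniformBelow n).bind (ν ∘ f)) := by
    refine finishesAs_of_step (by rw [step, hy]) fun i hi => ?_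
    have hi' := (mem_support_uniformBelow hn).1 hi
    have := (hf i hi').1 K s ν fun m' hm' => by
      rw [PMF.support_pure, Set.mem_singleton_iff] at hm'
      refine hν m' ?_
      rw [PMF.support_map, hm']
      exact ⟨i, hi, rfl⟩
    rwa [PMF.pure_bind] at this
  exact (finishesAs_of_step_pure (c := ⟨.seq (.random x y) q :: K, m⟩) (by rw [step]) h1).mono
    (by omega)

/-- A loop each round of which draws one random index.  The functions `v a` are submartingale-like
lower bounds, at each time, for the probability of ending in `A a`. -/
theorem Runs.uniform_loop {ι : Type*} {b : Test} {p : Cmd} {k t : ℕ} (hn : 0 < n)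
    (I : ℕ → Mem → Prop) (v : ι → ℕ → Mem → ℝ) (A : ι → Set Mem)
    (hbody : ∀ j < k, ∀ m, I j m → b.Holds m ∧ ∃ f : ℕ → Mem,
      Runs P p m t ((uniformBelow n).map f) ∧ (∀ i : Fin n, I (j + 1) (f i)) ∧
      ∀ a, v a j m * n ≤ ∑ i : Fin n, v a (j + 1) (f i))
    (hexit : ∀ m, I k m → ¬ b.Holds m ∧ ∀ a, v a k m ≤ 1 ∧ (m ∉ A a → v a k m ≤ 0))
    {m : Mem} (h0 : I 0 m) :
    ∃ μ, Runs P (.loop b p) m (k * (t + 1) + 1) μ ∧ (∀ m' ∈ μ.support, I k m') ∧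
      ∀ a, v a 0 m ≤ prob μ (A a) := by
  have key : ∀ r j, j + r = k → ∀ m, I j m →
      ∃ μ, Runs P (.loop b p) m (r * (t + 1) + 1) μ ∧ (∀ m' ∈ μ.support, I k m') ∧
        ∀ a, v a j m ≤ prob μ (A a) := by
    intro r
    induction r with
    | zero =>
      rintro j rfl m hm
      obtain ⟨h1, h2⟩ := hexit m hm
      refine ⟨PMF.pure m, (Runs.loop_false h1).mono (by omega), ?_, fun a => ?_⟩
      · intro m' hm'
        rw [PMF.support_pure, Set.mem_singleton_iff] at hm'
        exact hm' ▸ hm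
      · by_cases hA : m ∈ A a
        · rw [prob_pure hA]; exact (h2 a).1
        · exact ((h2 a).2 hA).trans (prob_nonneg _ _)
    | succ r ih =>
      intro j hj m hm
      obtain ⟨hb, f, hr, hI, hv⟩ := hbody j (by omega) m hm
      have h1 := fun i : Fin n => ih (j + 1) (by omega) (f i) (hI i)
      have h2 : ∀ m' ∈ ((uniformBelow n).map f).support, ∃ μ,
          Runs P (.loop b p) m' (r * (t + 1) + 1) μ ∧ (∀ m'' ∈ μ.support, I k m'') ∧
            ∀ a, v a (j + 1) m' ≤ prob μ (A a) := by
        intro m' hm'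
        rw [PMF.support_map] at hm'
        obtain ⟨i, hi, rfl⟩ := hm'
        exact h1 ⟨i, (mem_support_uniformBelow hn).1 hi⟩
      choose! ν hν using h2
      refine ⟨_, (Runs.loop_true hb hr fun m' hm' => (hν m' hm').1).mono (by ring_nf; omega),
        ?_, fun a => ?_⟩
      · intro m' hm'
        obtain ⟨m'', h, h'⟩ := (PMF.mem_support_bind_iff _ _ _).1 hm'
        exact (hν m'' h).2.1 m' h'
      · rw [PMF.bind_map, prob_uniformBelow_bind hn,
          le_div_iff₀ (by exact_mod_cast hn)]
        refine (hv a).trans (Finset.sum_le_sum fun i _ => ?_)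
        refine (hν (f i) ?_).2.2 a
        rw [PMF.support_map]
        exact ⟨i, (mem_support_uniformBelow hn).2 i.2, rfl⟩
  exact key k 0 (by omega) m h0

/-- A counted loop: if each round keeps the property `J a` with probability at least `q a`, then
`k` rounds keep it with probability at least `q a ^ k`. -/
theorem Runs.counted_loop {ι : Type*} {b : Test} {p : Cmd} {k t : ℕ}
    (I : ℕ → Mem → Prop) (J : ι → ℕ → Mem → Prop) (q : ι → ℝ) (hq : ∀ a, 0 ≤ q a)
    (hbody : ∀ j < k, ∀ m, I j m → b.Holds m ∧ ∃ μ, Runs P p m t μ ∧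
      (∀ m' ∈ μ.support, I (j + 1) m') ∧
      ∀ a, J a j m → q a ≤ prob μ {m' | J a (j + 1) m'})
    (hexit : ∀ m, I k m → ¬ b.Holds m) {m : Mem} (h0 : I 0 m) :
    ∃ μ, Runs P (.loop b p) m (k * (t + 1) + 1) μ ∧ (∀ m' ∈ μ.support, I k m') ∧
      ∀ a, J a 0 m → q a ^ k ≤ prob μ {m' | J a k m'} := by
  have key : ∀ r j, j + r = k → ∀ m, I j m →
      ∃ μ, Runs P (.loop b p) m (r * (t + 1) + 1) μ ∧ (∀ m' ∈ μ.support, I k m') ∧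
        ∀ a, J a j m → q a ^ r ≤ prob μ {m' | J a k m'} := by
    intro r
    induction r with
    | zero =>
      rintro j rfl m hm
      refine ⟨PMF.pure m, (Runs.loop_false (hexit m hm)).mono (by omega), ?_, fun a ha => ?_⟩
      · intro m' hm'
        rw [PMF.support_pure, Set.mem_singleton_iff] at hm'
        exact hm' ▸ hm
      · rw [prob_pure (by exact ha), pow_zero]
    | succ r ih =>
      intro j hj m hm
      obtain ⟨hb, μ, hr, hI, hv⟩ := hbody j (by omega) m hm
      have h2 := fun m' hm' => ih (j + 1) (by omega) m' (hI m' hm')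
      choose! ν hν using h2
      refine ⟨_, (Runs.loop_true hb hr fun m' hm' => (hν m' hm').1).mono (by ring_nf; omega),
        ?_, fun a ha => ?_⟩
      · intro m' hm'
        obtain ⟨m'', h, h'⟩ := (PMF.mem_support_bind_iff _ _ _).1 hm'
        exact (hν m'' h).2.1 m' h'
      · rw [pow_succ']
        exact le_prob_bind (pow_nonneg (hq a) _) (hv a ha)
          fun m' hm' hJ => (hν m' hm').2.2 a hJ
  exact key k 0 (by omega) m h0

end RandomLoops

end RealRAM

namespace OneClassSVM

open RealRAM

/-! ### The program

Memory layout.  The integer cells `0, 1, 2` hold `n, d, z` throughout, and cell `3` the constant `1`;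
`4, 5, 9` are a coordinate index and pointers, `6` is the index of the current sample point, `7` that
of the candidate point, and `8` counts the iterations.  The real cells `0, …, 10` hold parameters
and constants (see `program`); `11` and `15` are scratch; `12, 13, 14` receive inner products;
`16` and `17` are the counter of a random loop and the weight of the test; `18` is the candidate
offset; `19` and `20` are the parameters of `moveVectors`; `21` and `22` are the offset and the
margin of the best halfspace so far.  The vectors `x` and `y` occupy `d` cells each from `30` and
from `30 + d` on.  A cell is copied by multiplication with the constant `1`. -/

/-- With the sample point `p` whose index is in integer cell `6` and the vector `x`, put `⟪x, p⟫`,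
`‖x‖ ^ 2` and `‖p‖ ^ 2` into the real cells `12`, `13`, `14`. -/
def innerProducts : Cmd :=
  .seq
    (block [
      .natConst (.dir 4) 0,
      .natConst (.dir 5) 30,
      .realOp .sub (.dir 12) (.dir 12) (.dir 12),
      .realOp .sub (.dir 13) (.dir 13) (.dir 13),
      .realOp .sub (.dir 14) (.dir 14) (.dir 14)])
    (.loop (.natLt (.dir 4) (.dir 1))
      (block [
        .load (.dir 11) (.dir 6) (.dir 4),
        .realOp .mul (.dir 15) (.dir 11) (.ind 5),
        .realOp .add (.dir 12) (.dir 12) (.dir 15),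
        .realOp .mul (.dir 15) (.ind 5) (.ind 5),
        .realOp .add (.dir 13) (.dir 13) (.dir 15),
        .realOp .mul (.dir 15) (.dir 11) (.dir 11),
        .realOp .add (.dir 14) (.dir 14) (.dir 15),
        .natOp .add (.dir 4) (.dir 4) (.dir 3),
        .natOp .add (.dir 5) (.dir 5) (.dir 3)]))

/-- With the point `p` whose index is in integer cell `7`, replace the vectors `y` by
`y + s • (x - y)` and `x` by `x + t • (p - x)`, where `t`, `s` are in the real cells `19`, `20`. -/
def moveVectors : Cmd :=
  .seq
    (block [
      .natConst (.dir 4) 0,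
      .natConst (.dir 5) 30,
      .natOp .add (.dir 9) (.dir 5) (.dir 1)])
    (.loop (.natLt (.dir 4) (.dir 1))
      (block [
        .load (.dir 11) (.dir 7) (.dir 4),
        .realOp .sub (.dir 11) (.dir 11) (.ind 5),
        .realOp .mul (.dir 11) (.dir 11) (.dir 19),
        .realOp .sub (.dir 15) (.ind 5) (.ind 9),
        .realOp .mul (.dir 15) (.dir 15) (.dir 20),
        .realOp .add (.ind 9) (.ind 9) (.dir 15),
        .realOp .add (.ind 5) (.ind 5) (.dir 11),
        .natOp .add (.dir 4) (.dir 4) (.dir 3),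
        .natOp .add (.dir 5) (.dir 5) (.dir 3),
        .natOp .add (.dir 9) (.dir 9) (.dir 3)]))

/-- Move the offset from real cell `21`, and the vector `y`, to the output cells.  The target cells
`1, …, d` may hold scalars and part of `x` that are no longer needed, but no part of `y`.  The
constant `1` may get lost on the way, so a coordinate is copied by two additions. -/
def writeOutput : Cmd :=
  .seq
    (block [
      .natConst (.dir 4) 0,
      .natConst (.dir 5) 1,
      .natConst (.dir 9) 30,
      .natOp .add (.dir 9) (.dir 9) (.dir 1),
      .realOp .mul (.dir 0) (.dir 21) (.dir 5)])
    (.loop (.natLt (.dir 4) (.dir 1))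
      (block [
        .realOp .sub (.ind 5) (.ind 9) (.ind 9),
        .realOp .add (.ind 5) (.ind 5) (.ind 9),
        .natOp .add (.dir 4) (.dir 4) (.dir 3),
        .natOp .add (.dir 5) (.dir 5) (.dir 3),
        .natOp .add (.dir 9) (.dir 9) (.dir 3)]))

/-- Fill the cells `3, 5, …, 10` with the constants listed at `program`; `(1 + 19 δ) γ` is left in cell
`18`, and `t = 1`, `s = 0` for the first use of `moveVectors` in the cells `19`, `20`. -/
def setConstants : Cmd :=
  block [
    .natConst (.dir 3) 1,
    .cast (.dir 5) (.dir 3),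
    .realOp .add (.dir 3) (.dir 0) (.dir 0),
    .realOp .add (.dir 6) (.dir 5) (.dir 2),
    .natConst (.dir 4) 8,
    .cast (.dir 7) (.dir 4),
    .realOp .mul (.dir 7) (.dir 7) (.dir 2),
    .realOp .add (.dir 7) (.dir 7) (.dir 5),
    .realOp .mul (.dir 7) (.dir 7) (.dir 0),
    .realOp .mul (.dir 7) (.dir 7) (.dir 2),
    .realOp .add (.dir 7) (.dir 7) (.dir 5),
    .realOp .mul (.dir 8) (.dir 0) (.dir 2),
    .realOp .mul (.dir 8) (.dir 8) (.dir 2),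
    .realOp .sub (.dir 8) (.dir 5) (.dir 8),
    .realOp .mul (.dir 9) (.dir 4) (.dir 4),
    .realOp .div (.dir 10) (.dir 5) (.dir 4),
    .natConst (.dir 4) 19,
    .cast (.dir 18) (.dir 4),
    .realOp .mul (.dir 18) (.dir 18) (.dir 2),
    .realOp .add (.dir 18) (.dir 18) (.dir 5),
    .realOp .mul (.dir 18) (.dir 18) (.dir 0),
    .realOp .sub (.dir 20) (.dir 20) (.dir 20),
    .realOp .mul (.dir 19) (.dir 5) (.dir 5)]

/-- Draw a point, compute its inner products, and go on with `q`. -/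
def sampleAnd (q : Cmd) : Cmd := .seq (.random (.dir 6) (.dir 0)) (.seq innerProducts q)

/-- Make the current sample point the candidate: its index goes to integer cell `7`, its inner
product with `x` to real cell `18`. -/
def keepSample : Cmd :=
  block [
    .natOp .mul (.dir 7) (.dir 6) (.dir 3),
    .realOp .mul (.dir 18) (.dir 12) (.dir 5)]

/-- One round of the search for a point with a small inner product with `x`. -/
def searchRound : Cmd :=
  sampleAnd (.seq (.cond (.realLt (.dir 12) (.dir 18)) keepSample nop)
    (block [.realOp .add (.dir 16) (.dir 16) (.dir 3)]))

/-- Among about `1 / (2 γ)` random points find the one with the least inner product with `x`. -/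
def search : Cmd :=
  .seq (sampleAnd (.seq keepSample (block [.realOp .add (.dir 16) (.dir 3) (.dir 3)])))
    (.loop (.realLt (.dir 16) (.dir 5)) searchRound)

/-- One round of the test of the halfspace `{p | b ≤ ⟪x, p⟫}` with the candidate offset `b` in real
cell `18`. -/
def testRound : Cmd :=
  sampleAnd (.seq
    (.cond (.realLt (.dir 12) (.dir 18)) (block [.realOp .mul (.dir 17) (.dir 17) (.dir 6)]) nop)
    (block [
      .realOp .div (.dir 17) (.dir 17) (.dir 7),
      .realOp .mul (.dir 16) (.dir 16) (.dir 8)]))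

/-- Test whether the halfspace `{p | b ≤ ⟪x, p⟫}` misses only few points.  A weight (real cell `17`)
is multiplied by `1 + δ` at each random point outside and divided by `1 + q δ` in each round, where
`q = (1 + 8 δ) γ`; the test is passed if it ends below `1 / η₂`.  The number of rounds is governed
by the power of `1 - γ δ ^ 2` in real cell `16`, which has to fall to `η₂ ^ 2`. -/
def test : Cmd :=
  .seq
    (block [
      .realOp .mul (.dir 16) (.dir 5) (.dir 5),
      .realOp .mul (.dir 17) (.dir 5) (.dir 5)])
    (.loop (.realLt (.dir 9) (.dir 16)) testRound)

/-- If the test was passed and the margin of the candidate halfspace is a record, then store the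
offset and the margin in the real cells `21`, `22`, and set the flag `s` in cell `20`. -/
def recordHalfspace : Cmd :=
  .cond (.realLt (.dir 17) (.dir 10))
    (.cond (.realLt (.dir 22) (.dir 11))
      (block [
        .realOp .mul (.dir 20) (.dir 5) (.dir 5),
        .realOp .mul (.dir 21) (.dir 12) (.dir 5),
        .realOp .mul (.dir 22) (.dir 11) (.dir 5)])
      nop)
    nop

/-- Record the candidate halfspace if suitable, and move `x` to the point nearest to the origin on
the segment from `x` to the candidate point.  Should the candidate point have a larger inner product
with `x` than `x` itself, then the step is meaningless, but the candidate halfspace is then better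
than required. -/
def advance : Cmd :=
  .seq (block [.natOp .mul (.dir 6) (.dir 7) (.dir 3)])
  (.seq innerProducts
  (.seq
    (block [
      .realOp .sub (.dir 20) (.dir 20) (.dir 20),
      .sqrt (.dir 11) (.dir 13),
      .realOp .div (.dir 11) (.dir 12) (.dir 11)])
  (.seq recordHalfspace
  (.seq
    (block [
      .realOp .sub (.dir 11) (.dir 13) (.dir 12),
      .realOp .sub (.dir 15) (.dir 11) (.dir 12),
      .realOp .add (.dir 15) (.dir 15) (.dir 14)])
  (.seq
    (.cond (.realLt (.dir 11) (.dir 15))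
      (block [.realOp .div (.dir 19) (.dir 11) (.dir 15)])
      (block [.realOp .mul (.dir 19) (.dir 5) (.dir 5)]))
  (.seq moveVectors
    (block [.natOp .add (.dir 8) (.dir 8) (.dir 3)])))))))

/-- One iteration of the method. -/
def iteration : Cmd := .seq search (.seq test advance)

/-- Make `x` a random point. -/
def chooseStart : Cmd :=
  .seq (.random (.dir 7) (.dir 0)) moveVectors

/-- If `(1 + 19 δ) γ ≥ 1`, then no point has to be covered, and the halfspace touching `x` is used. -/
def touchStart : Cmd :=
  .seq (block [.natOp .mul (.dir 6) (.dir 7) (.dir 3)])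
  (.seq innerProducts
  (.seq
    (block [
      .realOp .mul (.dir 21) (.dir 13) (.dir 5),
      .sqrt (.dir 22) (.dir 13),
      .realOp .mul (.dir 20) (.dir 5) (.dir 5)])
    moveVectors))

/-- The program.  The integer cells `0, …, 3` hold `n, d, z, 1`.  The real cells `0, 2, 4` hold
`γ, δ, η₂`, and the cells `3, 5, …, 10` hold the constants
`2 γ, 1, 1 + δ, 1 + (1 + 8 δ) γ δ, 1 - γ δ ^ 2, η₂ ^ 2, 1 / η₂`.
The current vector `x` starts at cell `30` and the normal vector `y` of the best halfspace found so
far at cell `30 + d`; the offset and the margin of the latter are in the cells `21` and `22`. -/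
def program : Cmd :=
  .seq setConstants (.seq chooseStart
    (.seq (.cond (.realLt (.dir 18) (.dir 5)) (.loop (.natLt (.dir 8) (.dir 2)) iteration) touchStart)
      writeOutput))

/-! ### The deterministic parts of the program -/

section Deterministic

variable {n d : ℕ} {P : Fin n → EuclideanSpace ℝ (Fin d)}

/-- The vector in the `d` real cells from `a` on. -/
noncomputable def vec (d : ℕ) (m : Mem) (a : ℕ) : EuclideanSpace ℝ (Fin d) :=
  WithLp.toLp 2 fun j : Fin d => m.real (a + j)

theorem vec_congr {m m' : Mem} {a : ℕ} (h : ∀ k < d, m'.real (a + k) = m.real (a + k)) :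
    vec d m' a = vec d m a := by
  ext j
  exact h j j.2

theorem coord_of_lt (i : Fin n) (j : Fin d) : coord P i j = P i j := by
  simp [coord]

theorem inner_eq_sum_range (m : Mem) (a : ℕ) (i : Fin n) :
    ∑ k ∈ Finset.range d, coord P i k * m.real (a + k) = inner ℝ (vec d m a) (P i) := by
  rw [← Fin.sum_univ_eq_sum_range (fun k => coord P i k * m.real (a + k)), PiLp.inner_apply]
  refine Finset.sum_congr rfl fun j _ => ?_
  rw [coord_of_lt]
  simp [vec]

theorem normSq_eq_sum_range (m : Mem) (a : ℕ) :
    ∑ k ∈ Finset.range d, m.real (a + k) * m.real (a + k) = ‖vec d m a‖ ^ 2 := by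
  rw [← Fin.sum_univ_eq_sum_range (fun k => m.real (a + k) * m.real (a + k)),
    EuclideanSpace.norm_sq_eq]
  refine Finset.sum_congr rfl fun j _ => ?_
  simp [vec, sq]

theorem point_normSq_eq_sum_range (i : Fin n) :
    ∑ k ∈ Finset.range d, coord P i k * coord P i k = ‖P i‖ ^ 2 := by
  rw [← Fin.sum_univ_eq_sum_range (fun k => coord P i k * coord P i k),
    EuclideanSpace.norm_sq_eq]
  refine Finset.sum_congr rfl fun j _ => ?_
  rw [coord_of_lt]
  simp [sq]

variable (P) in
/-- The effect of `innerProducts` for the point number `i`. -/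
structure InnerProductsPost (i : Fin n) (m m' : Mem) : Prop where
  nat : ∀ a, a ≠ 4 → a ≠ 5 → m'.nat a = m.nat a
  real : ∀ a, a < 11 ∨ 15 < a → m'.real a = m.real a
  xp : m'.real 12 = inner ℝ (vec d m 30) (P i)
  xx : m'.real 13 = ‖vec d m 30‖ ^ 2
  pp : m'.real 14 = ‖P i‖ ^ 2

theorem runs_innerProducts {m : Mem} (h1 : m.nat 1 = d) (h3 : m.nat 3 = 1) (i : Fin n)
    (h6 : m.nat 6 = i) :
    ∃ m', Runs P innerProducts m (20 * d + 13) (PMF.pure m') ∧ InnerProductsPost P i m m' := by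
  let I : ℕ → Mem → Prop := fun j m' =>
    m'.nat 4 = j ∧ m'.nat 5 = 30 + j ∧ (∀ a, a ≠ 4 → a ≠ 5 → m'.nat a = m.nat a) ∧
    (∀ a, a < 11 ∨ 15 < a → m'.real a = m.real a) ∧
    m'.real 12 = ∑ k ∈ Finset.range j, coord P i k * m.real (30 + k) ∧
    m'.real 13 = ∑ k ∈ Finset.range j, m.real (30 + k) * m.real (30 + k) ∧
    m'.real 14 = ∑ k ∈ Finset.range j, coord P i k * coord P i k
  refine Runs.exists_seq (Q := I 0) (r := 11) (s := 20 * d + 1) ?_ ?_ (by omega)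
  · refine Runs.exists_block rfl (by simp) ?_
    simp +contextual [I]
    grind
  intro m₀ hm₀
  refine Runs.for_loop d 19 I ?_ ?_ hm₀ (by omega)
  · rintro j hj m₁ ⟨e4, e5, en, er, e12, e13, e14⟩
    refine ⟨by simpa [e4, en 1, h1] using hj, Runs.exists_block rfl (by simp) ?_⟩
    have hx : m₁.real (30 + j) = m.real (30 + j) := er _ (by omega)
    have hx' : ∀ a, a < 30 → 30 + j ≠ a := by omega
    simp [I, hx, hx', e4, e5, en 3, en 6, h3, h6, e12, e13, e14, Finset.sum_range_succ]
    grind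
  · rintro m₁ ⟨e4, e5, en, er, e12, e13, e14⟩
    exact ⟨by simp [e4, en 1, h1], en, er, by rw [e12, inner_eq_sum_range],
      by rw [e13, normSq_eq_sum_range], by rw [e14, point_normSq_eq_sum_range]⟩

/-- The effect of `moveVectors` for the point number `p` and the parameters `t`, `s`. -/
structure MoveVectorsPost (p : EuclideanSpace ℝ (Fin d)) (t s : ℝ) (m m' : Mem) : Prop where
  nat : ∀ a, a ≠ 4 → a ≠ 5 → a ≠ 9 → m'.nat a = m.nat a
  real : ∀ a, a < 30 → a ≠ 11 → a ≠ 15 → m'.real a = m.real a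
  x : vec d m' 30 = vec d m 30 + t • (p - vec d m 30)
  y : vec d m' (30 + d) = vec d m (30 + d) + s • (vec d m 30 - vec d m (30 + d))

theorem runs_moveVectors {m : Mem} (h1 : m.nat 1 = d) (h3 : m.nat 3 = 1) (i : Fin n)
    (h7 : m.nat 7 = i) :
    ∃ m', Runs P moveVectors m (22 * d + 9) (PMF.pure m') ∧
      MoveVectorsPost (P i) (m.real 19) (m.real 20) m m' := by
  let I : ℕ → Mem → Prop := fun j m' =>
    m'.nat 4 = j ∧ m'.nat 5 = 30 + j ∧ m'.nat 9 = 30 + d + j ∧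
    (∀ a, a ≠ 4 → a ≠ 5 → a ≠ 9 → m'.nat a = m.nat a) ∧
    (∀ a, a < 30 → a ≠ 11 → a ≠ 15 → m'.real a = m.real a) ∧
    (∀ k < d, m'.real (30 + k) = if k < j then
      m.real (30 + k) + (coord P i k - m.real (30 + k)) * m.real 19 else m.real (30 + k)) ∧
    (∀ k < d, m'.real (30 + d + k) = if k < j then m.real (30 + d + k) +
      (m.real (30 + k) - m.real (30 + d + k)) * m.real 20 else m.real (30 + d + k))
  refine Runs.exists_seq (Q := I 0) (r := 7) (s := 22 * d + 1) ?_ ?_ (by omega)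
  · refine Runs.exists_block rfl (by simp) ?_
    simp +contextual [I, h1]
  intro m₀ hm₀
  refine Runs.for_loop d 21 I ?_ ?_ hm₀ (by omega)
  · rintro j hj m₁ ⟨e4, e5, e9, en, er, ex, ey⟩
    refine ⟨by simpa [e4, en 1, h1] using hj, Runs.exists_block rfl (by simp) ?_⟩
    have hx := ex j hj
    have hy := ey j hj
    rw [if_neg (lt_irrefl j)] at hx hy
    have hx' : ∀ a, a < 30 → 30 + j ≠ a := by omega
    have hy' : ∀ a, a < 30 → 30 + d + j ≠ a := by omega
    have hy'' : ∀ a, a < 30 → a ≠ 30 + d + j := by omega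
    have hd : d ≠ 0 := by omega
    simp [I, hx, hy, hx', hy', hy'', hd, e4, e5, e9, en 3, en 7, h3, h7, er 19, er 20]
    refine ⟨by omega, by omega, by grind, by grind, fun k hk => ?_, fun k hk => ?_⟩
    · have := ex k hk
      grind
    · have := ey k hk
      grind
  · rintro m₁ ⟨e4, e5, e9, en, er, ex, ey⟩
    refine ⟨by simp [e4, en 1, h1], en, er, ?_, ?_⟩
    · ext k
      have := ex k k.2
      rw [if_pos k.2, coord_of_lt] at this
      simp [vec, this, mul_comm]
    · ext k
      have := ey k k.2
      rw [if_pos k.2] at this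
      simp [vec, this, mul_comm]

theorem runs_writeOutput {m : Mem} (h1 : m.nat 1 = d) (h3 : m.nat 3 = 1) (h5 : m.real 5 = 1) :
    ∃ m', Runs P writeOutput m (12 * d + 13) (PMF.pure m') ∧
      output d ⟨[], m'⟩ = ⟨vec d m (30 + d), m.real 21⟩ := by
  let I : ℕ → Mem → Prop := fun j m' =>
    m'.nat 4 = j ∧ m'.nat 5 = 1 + j ∧ m'.nat 9 = 30 + d + j ∧ m'.nat 3 = 1 ∧ m'.nat 1 = d ∧
    m'.real 0 = m.real 21 ∧ (∀ k < j, m'.real (k + 1) = m.real (30 + d + k)) ∧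
    (∀ k, m'.real (30 + d + k) = m.real (30 + d + k))
  refine Runs.exists_seq (Q := I 0) (r := 11) (s := 12 * d + 1) ?_ ?_ (by omega)
  · refine Runs.exists_block rfl (by simp) ?_
    simp +contextual [I, h1, h3, h5]
  intro m₀ hm₀
  refine Runs.for_loop d 11 I ?_ ?_ hm₀ (by omega)
  · rintro j hj m₁ ⟨e4, e5, e9, e3, e1, e0, ex, ey⟩
    refine ⟨by simpa [e4, e1] using hj, Runs.exists_block rfl (by simp) ?_⟩
    have hy := ey j
    simp [I, hy, e4, e5, e9, e3, e1, e0]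
    grind
  · rintro m₁ ⟨e4, e5, e9, e3, e1, e0, ex, ey⟩
    refine ⟨by simp [e4, e1], ?_⟩
    rw [output, e0]
    congr 1
    ext k
    exact ex k k.2

/-- The constants in the memory. -/
structure Constants (n d z : ℕ) (γ δ η : ℝ) (m : Mem) : Prop where
  nat0 : m.nat 0 = n
  nat1 : m.nat 1 = d
  nat2 : m.nat 2 = z
  nat3 : m.nat 3 = 1
  real3 : m.real 3 = 2 * γ
  real5 : m.real 5 = 1
  real6 : m.real 6 = 1 + δ
  real7 : m.real 7 = 1 + (1 + 8 * δ) * γ * δ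
  real8 : m.real 8 = 1 - γ * δ ^ 2
  real9 : m.real 9 = η ^ 2
  real10 : m.real 10 = 1 / η

theorem Constants.congr {z : ℕ} {γ δ η : ℝ} {m m' : Mem} (h : Constants n d z γ δ η m)
    (hn : ∀ a < 4, m'.nat a = m.nat a) (hr : ∀ a < 11, m'.real a = m.real a) :
    Constants n d z γ δ η m' := by
  constructor <;> simp [hn, hr, h.nat0, h.nat1, h.nat2, h.nat3, h.real3, h.real5, h.real6,
    h.real7, h.real8, h.real9, h.real10]

/-- The memory after `setConstants`. -/
structure Initialized (n d z : ℕ) (γ δ η : ℝ) (m : Mem) : Prop extends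
    Constants n d z γ δ η m where
  nat8 : m.nat 8 = 0
  real18 : m.real 18 = (1 + 19 * δ) * γ
  real19 : m.real 19 = 1
  real20 : m.real 20 = 0
  real21 : m.real 21 = 0
  real22 : m.real 22 = 0

theorem runs_setConstants (prog : Cmd) (n' z : ℕ) (γ ε δ η₁ η₂ : ℝ) :
    ∃ m', Runs P setConstants (start prog n' d z γ ε δ η₁ η₂).mem 47 (PMF.pure m') ∧
      Initialized n' d z γ δ η₂ m' := by
  refine Runs.exists_block rfl (by simp) ?_
  refine ⟨⟨?_, ?_, ?_, ?_, ?_, ?_, ?_, ?_, ?_, ?_, ?_⟩, ?_, ?_, ?_, ?_, ?_, ?_⟩ <;>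
    simp [start, -mul_eq_mul_right_iff] <;> ring

variable (P) in
/-- The memory when the point number `i` has been drawn and its inner products are known. -/
structure SamplePost (i : Fin n) (m m' : Mem) : Prop where
  nat : ∀ a, a ≠ 4 → a ≠ 5 → a ≠ 6 → m'.nat a = m.nat a
  nat6 : m'.nat 6 = i
  real : ∀ a, a < 11 ∨ 15 < a → m'.real a = m.real a
  xp : m'.real 12 = inner ℝ (vec d m 30) (P i)

theorem runs_sampleAnd {z t : ℕ} {γ δ η : ℝ} {m : Mem} (hm : Constants n d z γ δ η m) (hn : 0 < n)
    {q : Cmd} {Q : Fin n → Mem → Prop}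
    (hq : ∀ i m', SamplePost P i m m' → ∃ m'', Runs P q m' t (PMF.pure m'') ∧ Q i m'') :
    ∃ f : ℕ → Mem, Runs P (sampleAnd q) m (20 * d + t + 16) ((uniformBelow n).map f) ∧
      ∀ i : Fin n, Q i (f i) := by
  have := Runs.uniform_seq (P := P) (x := .dir 6) (y := .dir 0) (q := .seq innerProducts q)
    (m := m) (t := 20 * d + 13 + t + 1) (Q := Q) hn (by simpa using hm.nat0) (fun i => by
      refine Runs.exists_seq (runs_innerProducts (by simp [hm.nat1]) (by simp [hm.nat3]) i
        (by simp)) (fun m₁ h₁ => hq i m₁ ⟨?_, ?_, ?_, ?_⟩) le_rfl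
      · intro a h4 h5 h6
        rw [h₁.nat a h4 h5]
        simp [h6]
      · rw [h₁.nat 6 (by simp) (by simp)]
        simp
      · exact h₁.real
      · exact h₁.xp)
  obtain ⟨f, hf, hQ⟩ := this
  exact ⟨f, hf.mono (by omega), hQ⟩

variable (P) in
/-- The effect of a search round that draws the point number `i`. -/
structure SearchRoundPost (γ : ℝ) (i : Fin n) (m m' : Mem) : Prop where
  nat : ∀ a, a < 4 ∨ 7 < a → m'.nat a = m.nat a
  real : ∀ a, a < 11 ∨ 18 < a → m'.real a = m.real a
  counter : m'.real 16 = m.real 16 + 2 * γ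
  best : (inner ℝ (vec d m 30) (P i) < m.real 18 ∧ m'.nat 7 = i ∧
      m'.real 18 = inner ℝ (vec d m 30) (P i)) ∨
    (m.real 18 ≤ inner ℝ (vec d m 30) (P i) ∧ m'.nat 7 = m.nat 7 ∧ m'.real 18 = m.real 18)

theorem runs_searchRound {z : ℕ} {γ δ η : ℝ} {m : Mem} (hm : Constants n d z γ δ η m)
    (hn : 0 < n) :
    ∃ f : ℕ → Mem, Runs P searchRound m (20 * d + 26) ((uniformBelow n).map f) ∧
      ∀ i : Fin n, SearchRoundPost P γ i m (f i) := by
  refine runs_sampleAnd (t := 10) hm hn fun i m₁ h₁ => ?_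
  refine Runs.exists_seq (r := 6) (s := 3) (Q := fun m₂ => (∀ a, a ≠ 7 → m₂.nat a = m₁.nat a) ∧
    (∀ a, a ≠ 18 → m₂.real a = m₁.real a) ∧
    ((inner ℝ (vec d m 30) (P i) < m.real 18 ∧ m₂.nat 7 = i ∧
        m₂.real 18 = inner ℝ (vec d m 30) (P i)) ∨
      (m.real 18 ≤ inner ℝ (vec d m 30) (P i) ∧ m₂.nat 7 = m.nat 7 ∧
        m₂.real 18 = m.real 18))) ?_ ?_ le_rfl
  · have e18 : m₁.real 18 = m.real 18 := h₁.real 18 (by simp)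
    have e5 : m₁.real 5 = 1 := (h₁.real 5 (by simp)).trans hm.real5
    have e3 : m₁.nat 3 = 1 := (h₁.nat 3 (by simp) (by simp) (by simp)).trans hm.nat3
    refine Runs.exists_cond (t := 5) (fun hb => ?_) (fun hb => ?_)
    · refine Runs.exists_block rfl (by simp) ?_
      simp only [Test.holds_realLt, Loc.addr_dir, e18, h₁.xp] at hb
      simp +contextual [e3, e5, h₁.nat6, h₁.xp, hb]
    · refine ⟨m₁, Runs.nop.mono (by simp), fun _ _ => rfl, fun _ _ => rfl, Or.inr ⟨?_, ?_, e18⟩⟩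
      · simpa [e18, h₁.xp] using hb
      · exact h₁.nat 7 (by simp) (by simp) (by simp)
  · rintro m₂ ⟨hnat, hreal, hbest⟩
    refine Runs.exists_block rfl (by simp) ⟨?_, ?_, ?_, ?_⟩
    · intro a ha
      simp [hnat a (by omega), h₁.nat a (by omega) (by omega) (by omega)]
    · intro a ha
      simp [hreal a (by omega), h₁.real a (by omega), show a ≠ 16 by omega]
    · simp [hreal, h₁.real, hm.real3]
    · simpa using hbest

variable (P) in
/-- The effect of a test round that draws the point number `i`. -/
structure TestRoundPost (γ δ : ℝ) (i : Fin n) (m m' : Mem) : Prop where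
  nat : ∀ a, a < 4 ∨ 6 < a → m'.nat a = m.nat a
  real : ∀ a, a < 11 ∨ 17 < a → m'.real a = m.real a
  counter : m'.real 16 = m.real 16 * (1 - γ * δ ^ 2)
  hit : inner ℝ (vec d m 30) (P i) < m.real 18 →
    m'.real 17 = m.real 17 * (1 + δ) / (1 + (1 + 8 * δ) * γ * δ)
  miss : m.real 18 ≤ inner ℝ (vec d m 30) (P i) →
    m'.real 17 = m.real 17 / (1 + (1 + 8 * δ) * γ * δ)

theorem runs_testRound {z : ℕ} {γ δ η : ℝ} {m : Mem} (hm : Constants n d z γ δ η m)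
    (hn : 0 < n) :
    ∃ f : ℕ → Mem, Runs P testRound m (20 * d + 26) ((uniformBelow n).map f) ∧
      ∀ i : Fin n, TestRoundPost P γ δ i m (f i) := by
  refine runs_sampleAnd (t := 10) hm hn fun i m₁ h₁ => ?_
  refine Runs.exists_seq (r := 4) (s := 5) (Q := fun m₂ => m₂.nat = m₁.nat ∧
    (∀ a, a ≠ 17 → m₂.real a = m₁.real a) ∧
    (inner ℝ (vec d m 30) (P i) < m.real 18 → m₂.real 17 = m.real 17 * (1 + δ)) ∧
    (m.real 18 ≤ inner ℝ (vec d m 30) (P i) → m₂.real 17 = m.real 17)) ?_ ?_ le_rfl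
  · have e18 : m₁.real 18 = m.real 18 := h₁.real 18 (by simp)
    have e17 : m₁.real 17 = m.real 17 := h₁.real 17 (by simp)
    have e6 : m₁.real 6 = 1 + δ := (h₁.real 6 (by simp)).trans hm.real6
    refine Runs.exists_cond (t := 3) (fun hb => ?_) (fun hb => ?_)
    · refine Runs.exists_block rfl (by simp) ?_
      simp only [Test.holds_realLt, Loc.addr_dir, e18, h₁.xp] at hb
      simp +contextual [e6, e17, hb]
    · refine ⟨m₁, Runs.nop.mono (by simp), rfl, fun _ _ => rfl, ?_, fun _ => e17⟩
      intro h
      simp [e18, h₁.xp] at hb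
      exact absurd h hb.not_gt
  · rintro m₂ ⟨hnat, hreal, hhit, hmiss⟩
    refine Runs.exists_block rfl (by simp) ⟨?_, ?_, ?_, ?_, ?_⟩
    · intro a ha
      simp [hnat, h₁.nat a (by omega) (by omega) (by omega)]
    · intro a ha
      simp [hreal a (by omega), h₁.real a (by omega), show a ≠ 16 by omega,
        show a ≠ 17 by omega]
    · simp [hreal, h₁.real, hm.real8]
    · intro h
      simp [hreal, h₁.real, hm.real7, hhit h]
    · intro h
      simp [hreal, h₁.real, hm.real7, hmiss h]

/-- The position, relative to the segment from `x` to `p`, of its point nearest to the origin (if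
the inner product of `x` and `p` is less than `‖x‖ ^ 2`). -/
noncomputable def stepSize (x p : EuclideanSpace ℝ (Fin d)) : ℝ :=
  if ‖x‖ ^ 2 - inner ℝ x p < ‖x - p‖ ^ 2 then (‖x‖ ^ 2 - inner ℝ x p) / ‖x - p‖ ^ 2 else 1

variable (P) in
/-- The effect of `advance` if the candidate is the point number `i`. -/
structure AdvancePost (η : ℝ) (i : Fin n) (m m' : Mem) : Prop where
  nat : ∀ a, a < 4 ∨ a = 7 → m'.nat a = m.nat a
  real : ∀ a, a < 11 ∨ a = 17 → m'.real a = m.real a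
  counter : m'.nat 8 = m.nat 8 + 1
  x : vec d m' 30 = vec d m 30 + stepSize (vec d m 30) (P i) • (P i - vec d m 30)
  record : m.real 17 < 1 / η → m.real 22 < inner ℝ (vec d m 30) (P i) / ‖vec d m 30‖ →
    vec d m' (30 + d) = vec d m 30 ∧ m'.real 21 = inner ℝ (vec d m 30) (P i) ∧
      m'.real 22 = inner ℝ (vec d m 30) (P i) / ‖vec d m 30‖
  keep : ¬ (m.real 17 < 1 / η ∧ m.real 22 < inner ℝ (vec d m 30) (P i) / ‖vec d m 30‖) →
    vec d m' (30 + d) = vec d m (30 + d) ∧ m'.real 21 = m.real 21 ∧ m'.real 22 = m.real 22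

theorem runs_advance {z : ℕ} {γ δ η : ℝ} {m : Mem} (hm : Constants n d z γ δ η m) (i : Fin n)
    (h7 : m.nat 7 = i) :
    ∃ m', Runs P advance m (42 * d + 62) (PMF.pure m') ∧ AdvancePost P η i m m' := by
  refine Runs.exists_seq (r := 3) (s := 42 * d + 58) (Q := fun m₁ =>
    (∀ a, a ≠ 6 → m₁.nat a = m.nat a) ∧ m₁.nat 6 = i ∧ m₁.real = m.real)
    (Runs.exists_block rfl (by simp) (by simp +contextual [hm.nat3, h7])) ?_ (by omega)
  rintro m₁ ⟨n₁, n6, r₁⟩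
  refine Runs.exists_seq (s := 22 * d + 44) (runs_innerProducts ((n₁ 1 (by simp)).trans hm.nat1)
    ((n₁ 3 (by simp)).trans hm.nat3) i n6) (fun m₂ h₂ => ?_) (by omega)
  have hvec : vec d m₁ 30 = vec d m 30 := vec_congr fun k _ => by rw [r₁]
  obtain ⟨n₂, r₂, xp, xx, pp⟩ := h₂
  rw [hvec] at xp xx
  rw [r₁] at r₂
  replace n₂ : ∀ a, a ≠ 4 → a ≠ 5 → a ≠ 6 → m₂.nat a = m.nat a :=
    fun a h h' h'' => (n₂ a h h').trans (n₁ a h'')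
  clear n₁ n6 r₁ hvec m₁
  set x := vec d m 30
  refine Runs.exists_seq (r := 7) (s := 22 * d + 36) (Q := fun m₃ => m₃.nat = m₂.nat ∧
    (∀ a, a ≠ 11 → a ≠ 20 → m₃.real a = m₂.real a) ∧ m₃.real 20 = 0 ∧
    m₃.real 11 = inner ℝ x (P i) / ‖x‖) (Runs.exists_block rfl (by simp) (by
      simp +contextual [xx, xp])) ?_ (by omega)
  rintro m₃ ⟨n₃, r₃, s₃, q₃⟩
  have e5 : m₃.real 5 = 1 := by simp [r₃, r₂, hm.real5]
  have e10 : m₃.real 10 = 1 / η := by simp [r₃, r₂, hm.real10]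
  have e12 : m₃.real 12 = inner ℝ x (P i) := by simp [r₃, xp]
  have e17 : m₃.real 17 = m.real 17 := by simp [r₃, r₂]
  have e21 : m₃.real 21 = m.real 21 := by simp [r₃, r₂]
  have e22 : m₃.real 22 = m.real 22 := by simp [r₃, r₂]
  refine Runs.exists_seq (r := 9) (s := 22 * d + 26) (Q := fun m₄ => m₄.nat = m₃.nat ∧
    (∀ a, a ≠ 20 → a ≠ 21 → a ≠ 22 → m₄.real a = m₃.real a) ∧
    ((m.real 17 < 1 / η ∧ m.real 22 < inner ℝ x (P i) / ‖x‖) → m₄.real 20 = 1 ∧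
      m₄.real 21 = inner ℝ x (P i) ∧ m₄.real 22 = inner ℝ x (P i) / ‖x‖) ∧
    (¬ (m.real 17 < 1 / η ∧ m.real 22 < inner ℝ x (P i) / ‖x‖) → m₄.real 20 = 0 ∧
      m₄.real 21 = m.real 21 ∧ m₄.real 22 = m.real 22)) ?_ ?_ (by omega)
  · have hskip : ∀ t, ¬ (m.real 17 < 1 / η ∧ m.real 22 < inner ℝ x (P i) / ‖x‖) →
        ∃ m', Runs P nop m₃ (t + 1) (PMF.pure m') ∧ m'.nat = m₃.nat ∧
          (∀ a, a ≠ 20 → a ≠ 21 → a ≠ 22 → m'.real a = m₃.real a) ∧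
          ((m.real 17 < 1 / η ∧ m.real 22 < inner ℝ x (P i) / ‖x‖) → m'.real 20 = 1 ∧
            m'.real 21 = inner ℝ x (P i) ∧ m'.real 22 = inner ℝ x (P i) / ‖x‖) ∧
          (¬ (m.real 17 < 1 / η ∧ m.real 22 < inner ℝ x (P i) / ‖x‖) → m'.real 20 = 0 ∧
            m'.real 21 = m.real 21 ∧ m'.real 22 = m.real 22) := fun t h =>
      ⟨m₃, Runs.nop.mono (by omega), rfl, fun _ _ _ _ => rfl, fun h' => absurd h' h,
        fun _ => ⟨s₃, e21, e22⟩⟩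
    refine Runs.exists_cond (t := 8) (fun hb => Runs.exists_cond (t := 7) (fun hb' => ?_)
      fun hb' => hskip _ fun h => hb' ?_) fun hb => hskip _ fun h => hb ?_
    · simp only [Test.holds_realLt, Loc.addr_dir, e10, e17, e22, q₃] at hb hb'
      refine Runs.exists_block rfl (by simp) ?_
      simp +contextual [e5, e12, q₃]
      exact ⟨by simpa using hb, hb'⟩
    · simpa [e22, q₃] using h.2
    · simpa [e17, e10] using h.1
  rintro m₄ ⟨n₄, r₄, record, keep⟩
  have hdist : ‖x‖ ^ 2 - inner ℝ x (P i) - inner ℝ x (P i) + ‖P i‖ ^ 2 = ‖x - P i‖ ^ 2 := by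
    rw [norm_sub_sq_real]
    ring
  refine Runs.exists_seq (r := 7) (s := 22 * d + 18) (Q := fun m₅ => m₅.nat = m₄.nat ∧
    (∀ a, a ≠ 11 → a ≠ 15 → m₅.real a = m₄.real a) ∧
    m₅.real 11 = ‖x‖ ^ 2 - inner ℝ x (P i) ∧ m₅.real 15 = ‖x - P i‖ ^ 2)
    (Runs.exists_block rfl (by simp) (by
      rw [← hdist]
      simp +contextual [r₄, r₃, xx, xp, pp])) ?_ (by omega)
  rintro m₅ ⟨n₅, r₅, e11, e15⟩
  have e5' : m₅.real 5 = 1 := by simp [r₅, r₄, e5]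
  refine Runs.exists_seq (r := 4) (s := 22 * d + 13) (Q := fun m₆ => m₆.nat = m₅.nat ∧
    (∀ a, a ≠ 19 → m₆.real a = m₅.real a) ∧ m₆.real 19 = stepSize x (P i)) ?_ ?_ (by omega)
  · refine Runs.exists_cond (t := 3) (fun hb => ?_) (fun hb => ?_) <;>
    · simp only [Test.holds_realLt, Loc.addr_dir, e11, e15] at hb
      refine Runs.exists_block rfl (by simp) ?_
      simp +contextual [e11, e15, e5', stepSize, hb]
  rintro m₆ ⟨n₆, r₆, e19⟩
  have hn6 : ∀ a, a ≠ 4 → a ≠ 5 → a ≠ 6 → m₆.nat a = m.nat a := fun a h h' h'' => by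
    rw [n₆, n₅, n₄, n₃, n₂ a h h' h'']
  have hr6 : ∀ a, a < 11 ∨ 22 < a ∨ a = 17 → m₆.real a = m.real a := fun a h => by
    rw [r₆ a (by omega), r₅ a (by omega) (by omega), r₄ a (by omega) (by omega) (by omega),
      r₃ a (by omega) (by omega), r₂ a (by omega)]
  have hx : vec d m₆ 30 = x := vec_congr fun k _ => hr6 _ (by omega)
  have hy : vec d m₆ (30 + d) = vec d m (30 + d) := vec_congr fun k _ => hr6 _ (by omega)
  have e6 : ∀ a, a = 20 ∨ a = 21 ∨ a = 22 → m₆.real a = m₄.real a := fun a h => by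
    rw [r₆ a (by omega), r₅ a (by omega) (by omega)]
  refine Runs.exists_seq (s := 3) (runs_moveVectors ((hn6 1 (by simp) (by simp) (by simp)).trans
    hm.nat1) ((hn6 3 (by simp) (by simp) (by simp)).trans hm.nat3) i
    ((hn6 7 (by simp) (by simp) (by simp)).trans h7)) (fun m₇ h₇ => ?_) (by omega)
  obtain ⟨n₇, r₇, x₇, y₇⟩ := h₇
  rw [hx, e19] at x₇
  rw [hx, hy, e6 20 (by simp)] at y₇
  refine Runs.exists_block rfl (by simp) ⟨?_, ?_, ?_, ?_, ?_, ?_⟩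
  · intro a ha
    have h8 : a ≠ 8 := by omega
    simp [h8, n₇ a (by omega) (by omega) (by omega), hn6 a (by omega) (by omega) (by omega)]
  · intro a ha
    simp [r₇ a (by omega) (by omega) (by omega), hr6 a (by omega)]
  · simp [n₇, hn6, hm.nat3]
  · exact x₇
  · intro h h'
    obtain ⟨f20, f21, f22⟩ := record ⟨h, h'⟩
    refine ⟨?_, ?_, ?_⟩
    · rw [f20, one_smul, add_sub_cancel] at y₇
      exact y₇
    · simp [r₇, e6, f21, x]
    · simp [r₇, e6, f22, x]
  · intro h
    obtain ⟨f20, f21, f22⟩ := keep h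
    refine ⟨?_, ?_, ?_⟩
    · rw [f20, zero_smul, add_zero] at y₇
      exact y₇
    · simp [r₇, e6, f21]
    · simp [r₇, e6, f22]

/-- The effect of `chooseStart` if it draws the point number `i`. -/
structure ChooseStartPost (p : EuclideanSpace ℝ (Fin d)) (i : ℕ) (m m' : Mem) : Prop where
  nat : ∀ a, a < 4 ∨ a = 8 → m'.nat a = m.nat a
  nat7 : m'.nat 7 = i
  real : ∀ a, a < 30 → a ≠ 11 → a ≠ 15 → m'.real a = m.real a
  x : vec d m' 30 = p

theorem runs_chooseStart {z : ℕ} {γ δ η : ℝ} {m : Mem} (hm : Initialized n d z γ δ η m)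
    (hn : 0 < n) :
    ∃ f : ℕ → Mem, Runs P chooseStart m (22 * d + 11) ((uniformBelow n).map f) ∧
      ∀ i : Fin n, ChooseStartPost (P i) i m (f i) := by
  refine Runs.uniform_seq hn (by simpa using hm.nat0) fun i => ?_
  obtain ⟨m', hr, nat, real, x, -⟩ := runs_moveVectors (P := P) (m := m.setNat (.dir 7) i)
    (by simp [hm.nat1]) (by simp [hm.nat3]) i (by simp)
  refine ⟨m', hr, ?_, ?_, real, ?_⟩
  · intro a ha
    rw [nat a (by omega) (by omega) (by omega), Mem.setNat_nat, if_neg]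
    simp only [Loc.addr_dir]
    omega
  · simp [nat]
  · rw [x, Mem.setNat_real, hm.real19, one_smul, add_sub_cancel]

/-- The effect of `touchStart`. -/
structure TouchStartPost (m m' : Mem) : Prop where
  nat : ∀ a < 4, m'.nat a = m.nat a
  real : ∀ a < 11, m'.real a = m.real a
  y : vec d m' (30 + d) = vec d m 30
  offset : m'.real 21 = ‖vec d m 30‖ ^ 2
  margin : m'.real 22 = ‖vec d m 30‖

theorem runs_touchStart {z : ℕ} {γ δ η : ℝ} {m : Mem} (hm : Constants n d z γ δ η m) (i : Fin n)
    (h7 : m.nat 7 = i) :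
    ∃ m', Runs P touchStart m (42 * d + 35) (PMF.pure m') ∧ TouchStartPost (d := d) m m' := by
  refine Runs.exists_seq (r := 3) (s := 42 * d + 31) (Q := fun m₁ =>
    (∀ a, a ≠ 6 → m₁.nat a = m.nat a) ∧ m₁.nat 6 = i ∧ m₁.real = m.real)
    (Runs.exists_block rfl (by simp) (by simp +contextual [hm.nat3, h7])) ?_ (by omega)
  rintro m₁ ⟨n₁, n6, r₁⟩
  refine Runs.exists_seq (s := 22 * d + 17) (runs_innerProducts ((n₁ 1 (by simp)).trans hm.nat1)
    ((n₁ 3 (by simp)).trans hm.nat3) i n6) (fun m₂ h₂ => ?_) (by omega)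
  have hvec : vec d m₁ 30 = vec d m 30 := vec_congr fun k _ => by rw [r₁]
  obtain ⟨n₂, r₂, xp, xx, pp⟩ := h₂
  rw [hvec] at xp xx
  rw [r₁] at r₂
  replace n₂ : ∀ a, a ≠ 4 → a ≠ 5 → a ≠ 6 → m₂.nat a = m.nat a :=
    fun a h h' h'' => (n₂ a h h').trans (n₁ a h'')
  refine Runs.exists_seq (r := 7) (s := 22 * d + 9) (Q := fun m₃ => m₃.nat = m₂.nat ∧
    (∀ a, a ≠ 20 → a ≠ 21 → a ≠ 22 → m₃.real a = m₂.real a) ∧ m₃.real 20 = 1 ∧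
    m₃.real 21 = ‖vec d m 30‖ ^ 2 ∧ m₃.real 22 = ‖vec d m 30‖)
    (Runs.exists_block rfl (by simp) (by
      simp +contextual [xx, r₂, hm.real5])) ?_ (by omega)
  rintro m₃ ⟨n₃, r₃, e20, e21, e22⟩
  have hx : vec d m₃ 30 = vec d m 30 := vec_congr fun k _ => by
    rw [r₃ _ (by omega) (by omega) (by omega), r₂ _ (by omega)]
  obtain ⟨m', hr, nat, real, -, y⟩ := runs_moveVectors (P := P) (m := m₃)
    (by simp [n₃, n₂, hm.nat1]) (by simp [n₃, n₂, hm.nat3]) i (by simp [n₃, n₂, h7])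
  refine ⟨m', hr, ?_, ?_, ?_, ?_, ?_⟩
  · intro a ha
    rw [nat a (by omega) (by omega) (by omega), n₃, n₂ a (by omega) (by omega) (by omega)]
  · intro a ha
    rw [real a (by omega) (by omega) (by omega), r₃ a (by omega) (by omega) (by omega),
      r₂ a (by omega)]
  · rw [y, e20, one_smul, add_sub_cancel, hx]
  · rw [real 21 (by simp) (by simp) (by simp), e21]
  · rw [real 22 (by simp) (by simp) (by simp), e22]

end Deterministic
/-! ### The search phase -/

section Search

variable {n d : ℕ} {P : Fin n → EuclideanSpace ℝ (Fin d)}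

theorem card_mul_add_le_sum {S A : Finset (Fin n)} (hAS : A ⊆ S) {g : Fin n → ℝ} {u w : ℝ}
    (hA : ∀ i ∈ A, u ≤ g i) (hS : ∀ i ∈ S, i ∉ A → w ≤ g i) (h0 : ∀ i, 0 ≤ g i) :
    A.card * u + (S.card - A.card) * w ≤ ∑ i, g i := by
  have h1 : A.card • u ≤ ∑ i ∈ A, g i := Finset.card_nsmul_le_sum _ _ _ hA
  have h2 : (S \ A).card • w ≤ ∑ i ∈ S \ A, g i :=
    Finset.card_nsmul_le_sum _ _ _ fun i hi => hS i (Finset.mem_sdiff.1 hi).1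
      (Finset.mem_sdiff.1 hi).2
  have h3 : ∑ i ∈ S, g i ≤ ∑ i, g i :=
    Finset.sum_le_sum_of_subset_of_nonneg (Finset.subset_univ _) fun i _ _ => h0 i
  rw [← Finset.sum_sdiff hAS] at h3
  rw [nsmul_eq_mul] at h1 h2
  rw [Finset.cast_card_sdiff hAS] at h2
  linarith

open Classical in
/-- A lower bound for the probability that, after `e` more rounds of the search, the candidate is in
`S` and its inner product with `x` is at most `τ`, obtained by counting only the runs which never
draw a point outside `S`.  Here `σ` is the fraction of the points in `S`, and `σ - β` is the
fraction of the points in `S` with an inner product greater than `τ`. -/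
noncomputable def searchValue (S : Finset (Fin n)) (τ σ β : ℝ) (e : ℕ) (m : Mem) : ℝ :=
  if ∃ p ∈ S, m.nat 7 = (p : Fin n) then
    if m.real 18 ≤ τ then σ ^ e else σ ^ e - (σ - β) ^ e
  else 0

theorem searchValue_nonneg (S : Finset (Fin n)) (τ : ℝ) {σ β : ℝ} (hβ : 0 ≤ β) (hσ : β ≤ σ)
    (e : ℕ) (m : Mem) : 0 ≤ searchValue S τ σ β e m := by
  unfold searchValue
  have := pow_nonneg (hβ.trans hσ) e
  have := pow_le_pow_left₀ (sub_nonneg.2 hσ) (sub_le_self σ hβ) e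
  split_ifs <;> linarith

variable (P) in
/-- What holds after the search: the cells in use by other phases are unchanged, and integer cell
`7` holds the index of a point, real cell `18` its inner product with `x`. -/
structure SearchPost (m m' : Mem) : Prop where
  nat : ∀ a, a < 4 ∨ 7 < a → m'.nat a = m.nat a
  real : ∀ a, a < 11 ∨ 18 < a → m'.real a = m.real a
  best : ∃ p : Fin n, m'.nat 7 = p ∧ m'.real 18 = inner ℝ (vec d m 30) (P p)

/-- The search draws `r + 1` points. -/
theorem runs_search {z : ℕ} {γ δ η : ℝ} {m : Mem} (hm : Constants n d z γ δ η m) (hn : 0 < n)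
    {r : ℕ} (hr1 : 1 ≤ 2 * γ * (r + 2)) (hr2 : r = 0 ∨ 2 * γ * (r + 1) < 1) :
    ∃ μ, Runs P search m ((r + 1) * (20 * d + 27) + 1) μ ∧
      (∀ m' ∈ μ.support, SearchPost P m m') ∧
      ∀ (S : Finset (Fin n)) (τ : ℝ),
        ((S.card : ℝ) / n) ^ (r + 1) - ((S.card : ℝ) / n -
          ((S.filter fun i => inner ℝ (vec d m 30) (P i) ≤ τ).card : ℝ) / n) ^ (r + 1) ≤
        prob μ {m' | ∃ p ∈ S, m'.nat 7 = (p : Fin n) ∧ inner ℝ (vec d m 30) (P p) ≤ τ} := by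
  have hn' : (n : ℝ) ≠ 0 := by positivity
  let A : Finset (Fin n) → ℝ → Finset (Fin n) := fun S τ =>
    S.filter fun i => inner ℝ (vec d m 30) (P i) ≤ τ
  let V : Finset (Fin n) × ℝ → ℕ → Mem → ℝ := fun a e =>
    searchValue a.1 a.2 ((a.1.card : ℝ) / n) (((A a.1 a.2).card : ℝ) / n) e
  have hA : ∀ S τ, A S τ ⊆ S := fun S τ => Finset.filter_subset _ _
  have hcard : ∀ S τ, ((A S τ).card : ℝ) / n ≤ (S.card : ℝ) / n := fun S τ => by
    gcongr
    exact hA S τ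
  have hV0 : ∀ a e m', 0 ≤ V a e m' := fun a e m' =>
    searchValue_nonneg _ _ (by positivity) (hcard _ _) _ _
  -- One draw, if the points of `A` become good candidates, and the others of `S` remain in `S`.
  have average : ∀ (a : Finset (Fin n) × ℝ) (e : ℕ) (f : ℕ → Mem),
      (∀ i ∈ A a.1 a.2, (∃ p ∈ a.1, (f i).nat 7 = (p : Fin n)) ∧ (f i).real 18 ≤ a.2) →
      (∀ i ∈ a.1, i ∉ A a.1 a.2 → (∃ p ∈ a.1, (f i).nat 7 = (p : Fin n)) ∧ a.2 < (f i).real 18) →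
      (((a.1.card : ℝ) / n) ^ (e + 1) - ((a.1.card : ℝ) / n -
        ((A a.1 a.2).card : ℝ) / n) ^ (e + 1)) * n ≤ ∑ i : Fin n, V a e (f i) := by
    intro a e f h1 h2
    refine le_trans (le_of_eq ?_) (card_mul_add_le_sum (hA a.1 a.2)
      (u := ((a.1.card : ℝ) / n) ^ e)
      (w := ((a.1.card : ℝ) / n) ^ e - ((a.1.card : ℝ) / n - ((A a.1 a.2).card : ℝ) / n) ^ e)
      (fun i hi => ?_) (fun i hi hi' => ?_) fun i => hV0 _ _ _)
    · generalize hs : (a.1.card : ℝ) / n = s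
      generalize hb : ((A a.1 a.2).card : ℝ) / n = b
      have e1 : (a.1.card : ℝ) = s * n := by rw [← hs]; field_simp
      have e2 : ((A a.1 a.2).card : ℝ) = b * n := by rw [← hb]; field_simp
      rw [e1, e2, pow_succ, pow_succ]
      ring
    · obtain ⟨h, h'⟩ := h1 i hi
      simp only [V, searchValue, if_pos h, if_pos h', le_refl]
    · obtain ⟨h, h'⟩ := h2 i hi hi'
      simp only [V, searchValue, if_pos h, if_neg h'.not_ge, le_refl]
  obtain ⟨f, hf, hfQ⟩ := runs_sampleAnd (P := P) (t := 9) hm hn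
    (q := .seq keepSample (block [.realOp .add (.dir 16) (.dir 3) (.dir 3)]))
    (Q := fun i m' => (∀ a, a < 4 ∨ 7 < a → m'.nat a = m.nat a) ∧
      (∀ a, a < 11 ∨ 18 < a → m'.real a = m.real a) ∧ m'.real 16 = 2 * γ * 2 ∧
      m'.nat 7 = i ∧ m'.real 18 = inner ℝ (vec d m 30) (P i)) (by
    intro i m₁ h₁
    have e3 : m₁.nat 3 = 1 := (h₁.nat 3 (by simp) (by simp) (by simp)).trans hm.nat3
    have e5 : m₁.real 5 = 1 := (h₁.real 5 (by simp)).trans hm.real5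
    have f3 : m₁.real 3 = 2 * γ := (h₁.real 3 (by simp)).trans hm.real3
    refine Runs.exists_seq (r := 5) (s := 3) (Q := fun m₂ => (∀ a, a ≠ 7 → m₂.nat a = m₁.nat a) ∧
      (∀ a, a ≠ 18 → m₂.real a = m₁.real a) ∧ m₂.nat 7 = i ∧
      m₂.real 18 = inner ℝ (vec d m 30) (P i)) (Runs.exists_block rfl (by simp) ?_) ?_ le_rfl
    · simp +contextual [e3, e5, h₁.nat6, h₁.xp]
    rintro m₂ ⟨n₂, r₂, h7, h18⟩
    refine Runs.exists_block rfl (by simp) ⟨?_, ?_, ?_, ?_, ?_⟩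
    · intro a ha
      simp [n₂ a (by omega), h₁.nat a (by omega) (by omega) (by omega)]
    · intro a ha
      simp [r₂ a (by omega), h₁.real a (by omega), show a ≠ 16 by omega]
    · simp [r₂, f3]
      ring
    · simpa using h7
    · simpa using h18)
  let I : ℕ → Mem → Prop := fun k m' => (∀ a, a < 4 ∨ 7 < a → m'.nat a = m.nat a) ∧
    (∀ a, a < 11 ∨ 18 < a → m'.real a = m.real a) ∧ m'.real 16 = 2 * γ * (k + 2) ∧
    ∃ p : Fin n, m'.nat 7 = p ∧ m'.real 18 = inner ℝ (vec d m 30) (P p)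
  have hloop : ∀ m₁, I 0 m₁ → ∃ μ, Runs P (.loop (.realLt (.dir 16) (.dir 5)) searchRound) m₁
      (r * (20 * d + 26 + 1) + 1) μ ∧ (∀ m' ∈ μ.support, I r m') ∧
      ∀ a : Finset (Fin n) × ℝ, V a (r - 0) m₁ ≤
        prob μ {m' | ∃ p ∈ a.1, m'.nat 7 = (p : Fin n) ∧ inner ℝ (vec d m 30) (P p) ≤ a.2} := by
    intro m₁ h₁
    refine Runs.uniform_loop hn I (fun a k m' => V a (r - k) m') _ ?_ ?_ h₁
    · rintro k hk m₂ ⟨n₂, r₂, h16, p₀, h7, h18⟩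
      have hm₂ : Constants n d z γ δ η m₂ :=
        hm.congr (fun a ha => n₂ a (by omega)) fun a ha => r₂ a (by omega)
      have hx : vec d m₂ 30 = vec d m 30 := vec_congr fun k _ => r₂ _ (by omega)
      refine ⟨?_, ?_⟩
      · simp only [Test.holds_realLt, Loc.addr_dir, h16, hm₂.real5]
        have : (k : ℝ) + 2 ≤ r + 1 := by exact_mod_cast (by omega : k + 2 ≤ r + 1)
        have h1 := hr2.resolve_left (by omega)
        have hγ : 0 ≤ 2 * γ := by nlinarith
        linarith [mul_le_mul_of_nonneg_left this hγ]
      obtain ⟨g, hg, hgQ⟩ := runs_searchRound (P := P) hm₂ hn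
      refine ⟨g, hg, fun i => ⟨?_, ?_, ?_, ?_⟩, fun a => ?_⟩
      · exact fun a ha => ((hgQ i).nat a ha).trans (n₂ a ha)
      · exact fun a ha => ((hgQ i).real a ha).trans (r₂ a ha)
      · rw [(hgQ i).counter, h16]
        push_cast
        ring
      · rcases (hgQ i).best with ⟨-, h, h'⟩ | ⟨-, h, h'⟩
        · exact ⟨i, h, hx ▸ h'⟩
        · exact ⟨p₀, h.trans h7, h'.trans h18⟩
      · have he : r - k = r - (k + 1) + 1 := by omega
        have hkeep : ∀ i ∈ a.1, (∃ p ∈ a.1, m₂.nat 7 = (p : Fin n)) →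
            ∃ p ∈ a.1, (g i).nat 7 = (p : Fin n) := by
          intro i hi h
          rcases (hgQ i).best with ⟨-, h', -⟩ | ⟨-, h', -⟩
          · exact ⟨i, hi, h'⟩
          · rwa [h']
        by_cases h : ∃ p ∈ a.1, m₂.nat 7 = (p : Fin n)
        · by_cases h' : m₂.real 18 ≤ a.2
          · have : V a (r - k) m₂ * n = a.1.card * ((a.1.card : ℝ) / n) ^ (r - (k + 1)) +
                (a.1.card - a.1.card) * 0 := by
              simp only [V, searchValue, if_pos h, if_pos h']
              rw [he, pow_succ]
              field_simp
              simp
            rw [this]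
            refine card_mul_add_le_sum (Finset.Subset.refl _) (fun i hi => ?_)
              (fun i hi hi' => absurd hi hi') fun i => hV0 _ _ _
            have h1 : (g i).real 18 ≤ a.2 := by
              rcases (hgQ i).best with ⟨h1, -, h2⟩ | ⟨-, -, h2⟩
              · rw [h2]; exact h1.le.trans h'
              · rwa [h2]
            simp only [V, searchValue, if_pos (hkeep i hi h), if_pos h1, le_refl]
          · refine le_trans (le_of_eq ?_) (average a (r - (k + 1)) g (fun i hi => ?_)
              fun i hi hi' => ?_)
            · simp only [V, searchValue, if_pos h, if_neg h', he]
            · obtain ⟨hiS, hiτ⟩ := Finset.mem_filter.1 hi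
              refine ⟨hkeep i hiS h, ?_⟩
              rcases (hgQ i).best with ⟨h1, -, h2⟩ | ⟨h1, -, h2⟩
              · rwa [h2, hx]
              · rw [hx] at h1
                exact absurd (h1.trans hiτ) h'
            · refine ⟨hkeep i hi h, ?_⟩
              have hiτ : a.2 < inner ℝ (vec d m 30) (P i) := by
                by_contra hc
                exact hi' (Finset.mem_filter.2 ⟨hi, not_lt.1 hc⟩)
              rcases (hgQ i).best with ⟨h1, -, h2⟩ | ⟨h1, -, h2⟩
              · rwa [h2, hx]
              · rw [h2]
                exact not_le.1 h'
        · have : V a (r - k) m₂ = 0 := by simp only [V, searchValue, if_neg h]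
          rw [this, zero_mul]
          exact Finset.sum_nonneg fun i _ => hV0 _ _ _
    · rintro m₂ ⟨n₂, r₂, h16, p₀, h7, h18⟩
      refine ⟨?_, fun a => ?_⟩
      · simp only [Test.holds_realLt, Loc.addr_dir, h16, r₂ 5 (by simp), hm.real5]
        linarith
      · simp only [V, searchValue, Nat.sub_self, pow_zero, sub_self]
        refine ⟨by split_ifs <;> simp, fun h => ?_⟩
        rw [ite_eq_right_iff.2]
        rintro ⟨p, hp, h7'⟩
        refine if_neg fun h' => h ⟨p, hp, h7', ?_⟩
        have : p = p₀ := Fin.ext (h7'.symm.trans h7)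
        rw [this, ← h18]
        exact h'
  have hstart : ∀ m' ∈ ((uniformBelow n).map f).support, I 0 m' := by
    intro m' hm'
    rw [PMF.support_map] at hm'
    obtain ⟨i, hi, rfl⟩ := hm'
    obtain ⟨h1, h2, h3, h4, h5⟩ := hfQ ⟨i, (mem_support_uniformBelow hn).1 hi⟩
    exact ⟨h1, h2, by simpa using h3, _, h4, h5⟩
  obtain ⟨ν, hν, hνQ⟩ := Runs.seq_exists hf fun m' hm' => hloop m' (hstart m' hm')
  refine ⟨_, hν.mono (by ring_nf; omega), fun m' hm' => ?_, fun S τ => ?_⟩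
  · obtain ⟨m'', h, h'⟩ := (PMF.mem_support_bind_iff _ _ _).1 hm'
    obtain ⟨h1, h2, -, h3⟩ := (hνQ m'' h).1 m' h'
    exact ⟨h1, h2, h3⟩
  · rw [PMF.bind_map, prob_uniformBelow_bind hn, le_div_iff₀ (by positivity)]
    refine (average (S, τ) r f (fun i hi => ?_) fun i hi hi' => ?_).trans
      (Finset.sum_le_sum fun i _ => (hνQ (f i) ?_).2 (S, τ))
    · obtain ⟨hiS, hiτ⟩ := Finset.mem_filter.1 hi
      obtain ⟨-, -, -, h4, h5⟩ := hfQ i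
      exact ⟨⟨i, hiS, h4⟩, h5 ▸ hiτ⟩
    · obtain ⟨-, -, -, h4, h5⟩ := hfQ i
      refine ⟨⟨i, hi, h4⟩, ?_⟩
      by_contra hc
      exact hi' (Finset.mem_filter.2 ⟨hi, h5 ▸ not_lt.1 hc⟩)
    · rw [PMF.support_map]
      exact ⟨i, (mem_support_uniformBelow hn).2 i.2, rfl⟩

end Search

/-! ### The test phase -/

section Testing

variable {n d : ℕ} {P : Fin n → EuclideanSpace ℝ (Fin d)}

theorem sum_eq_of_two_values {g : Fin n → ℝ} {H : Finset (Fin n)} {u w : ℝ}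
    (hu : ∀ i ∈ H, g i = u) (hw : ∀ i, i ∉ H → g i = w) :
    ∑ i, g i = H.card * u + (n - H.card) * w := by
  rw [← Finset.sum_add_sum_compl H, Finset.sum_congr rfl hu,
    Finset.sum_congr rfl fun i hi => hw i (Finset.mem_compl.1 hi), Finset.sum_const,
    Finset.sum_const, nsmul_eq_mul, nsmul_eq_mul, Finset.card_compl,
    Nat.cast_sub (Finset.card_le_univ H), Fintype.card_fin]

/-- The expected factor by which the inverse of the weight changes in a round of the test, if more
than `(1 + 19 δ) γ n` points are outside of the halfspace. -/
theorem inverse_weight_factor {γ δ h n : ℝ} (hγ : 0 < γ) (hδ : δ ∈ Set.Ioo (0 : ℝ) 1)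
    (hn : 0 < n) (hh : (1 + 19 * δ) * γ * n ≤ h) :
    (1 + (1 + 8 * δ) * γ * δ) * (h / (1 + δ) + (n - h)) ≤ (1 - γ * δ ^ 2) * n := by
  obtain ⟨h0, h1⟩ := hδ
  have e1 : h / (1 + δ) + (n - h) = (n * (1 + δ) - h * δ) / (1 + δ) := by
    field_simp
    ring
  rw [e1, ← mul_div_assoc, div_le_iff₀ (by linarith)]
  have h2 : n * (1 + δ) - h * δ ≤ n * (1 + δ) - (1 + 19 * δ) * γ * n * δ := by
    nlinarith
  refine (mul_le_mul_of_nonneg_left h2 (by positivity)).trans ?_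
  have h3 : (1 + (1 + 8 * δ) * γ * δ) * (n * (1 + δ) - (1 + 19 * δ) * γ * n * δ)
      - (1 - γ * δ ^ 2) * n * (1 + δ)
      = - (γ * n * δ ^ 2) * ((9 - 9 * δ) + (1 + 8 * δ) * (1 + 19 * δ) * γ) := by ring
  have h4 : 0 ≤ (γ * n * δ ^ 2) * ((9 - 9 * δ) + (1 + 8 * δ) * (1 + 19 * δ) * γ) := by
    have : 0 ≤ 9 - 9 * δ := by linarith
    positivity
  linarith

/-- The test makes `M` rounds.  It is passed with high probability by a halfspace which misses at
most `(1 + 8 δ) γ n` points, and failed with high probability by one which misses more than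
`(1 + 19 δ) γ n` points.  The weight and its inverse, respectively, are supermartingales in
these cases, and Markov's inequality is applied to their final values. -/
theorem runs_test {z : ℕ} {γ δ η : ℝ} {m : Mem} (hm : Constants n d z γ δ η m) (hn : 0 < n)
    (hγ : 0 < γ) (hδ : δ ∈ Set.Ioo (0 : ℝ) 1) (hη : 0 < η) {M : ℕ}
    (hM : (1 - γ * δ ^ 2) ^ M ≤ η ^ 2) (hM' : ∀ k < M, η ^ 2 < (1 - γ * δ ^ 2) ^ k) :
    ∃ μ, Runs P test m (M * (20 * d + 27) + 7) μ ∧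
      (∀ m' ∈ μ.support, (∀ a, a < 4 ∨ 6 < a → m'.nat a = m.nat a) ∧
        ∀ a, a < 11 ∨ 17 < a → m'.real a = m.real a) ∧
      (((Finset.univ.filter fun i => inner ℝ (vec d m 30) (P i) < m.real 18).card : ℝ) ≤
        (1 + 8 * δ) * γ * n → 1 - η ≤ prob μ {m' | m'.real 17 < 1 / η}) ∧
      ((1 + 19 * δ) * γ * n <
        (Finset.univ.filter fun i => inner ℝ (vec d m 30) (P i) < m.real 18).card →
        1 - η ≤ prob μ {m' | ¬ m'.real 17 < 1 / η}) := by
  classical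
  obtain ⟨hδ0, hδ1⟩ := hδ
  have hn' : (0 : ℝ) < n := by exact_mod_cast hn
  set H := Finset.univ.filter fun i => inner ℝ (vec d m 30) (P i) < m.real 18 with hH
  set κ := 1 - γ * δ ^ 2 with hκ
  set ν := 1 + (1 + 8 * δ) * γ * δ with hν
  have hν0 : 0 < ν := by positivity
  obtain ⟨m₁, hr₁, n₁, r₁, h16, h17⟩ := Runs.exists_block (P := P) (t := 5) (m := m)
    (cs := [.realOp .mul (.dir 16) (.dir 5) (.dir 5), .realOp .mul (.dir 17) (.dir 5) (.dir 5)])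
    (Q := fun m₁ => m₁.nat = m.nat ∧ (∀ a, a ≠ 16 → a ≠ 17 → m₁.real a = m.real a) ∧
      m₁.real 16 = 1 ∧ m₁.real 17 = 1) rfl (by simp) (by
        simp +contextual [hm.real5])
  let I : ℕ → Mem → Prop := fun k m' => (∀ a, a < 4 ∨ 6 < a → m'.nat a = m.nat a) ∧
    (∀ a, a < 11 ∨ 17 < a → m'.real a = m.real a) ∧ m'.real 16 = κ ^ k ∧ 0 < m'.real 17
  let v : Bool → ℕ → Mem → ℝ := fun a k m' =>
    if a then (if (H.card : ℝ) ≤ (1 + 8 * δ) * γ * n then 1 - η * m'.real 17 else 0)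
    else if (1 + 19 * δ) * γ * n < H.card then 1 - κ ^ (M - k) / (η * m'.real 17) else 0
  obtain ⟨μ, hμ, hI, hv⟩ := Runs.uniform_loop (P := P) (b := .realLt (.dir 9) (.dir 16))
    (p := testRound) (k := M) (t := 20 * d + 26) (m := m₁) hn I v
    (fun a => if a then {m' | m'.real 17 < 1 / η} else {m' | ¬ m'.real 17 < 1 / η}) (by
    rintro k hk m₂ ⟨n₂, r₂, e16, e17⟩
    have hm₂ : Constants n d z γ δ η m₂ :=
        hm.congr (fun a ha => n₂ a (by omega)) fun a ha => r₂ a (by omega)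
    have hx : vec d m₂ 30 = vec d m 30 := vec_congr fun k _ => r₂ _ (by omega)
    have e18 : m₂.real 18 = m.real 18 := r₂ 18 (by simp)
    refine ⟨?_, ?_⟩
    · simp only [Test.holds_realLt, Loc.addr_dir, e16, hm₂.real9]
      exact hM' k hk
    obtain ⟨g, hg, hgQ⟩ := runs_testRound (P := P) hm₂ hn
    have hhit : ∀ i ∈ H, (g i).real 17 = m₂.real 17 * (1 + δ) / ν := by
      intro i hi
      refine (hgQ i).hit ?_
      rw [hx, e18]
      exact (Finset.mem_filter.1 hi).2
    have hmiss : ∀ i, i ∉ H → (g i).real 17 = m₂.real 17 / ν := by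
      intro i hi
      refine (hgQ i).miss ?_
      rw [hx, e18]
      by_contra hc
      exact hi (Finset.mem_filter.2 ⟨Finset.mem_univ _, not_le.1 hc⟩)
    refine ⟨g, hg, fun i => ⟨?_, ?_, ?_, ?_⟩, fun a => ?_⟩
    · exact fun a ha => ((hgQ i).nat a ha).trans (n₂ a ha)
    · exact fun a ha => ((hgQ i).real a ha).trans (r₂ a ha)
    · rw [(hgQ i).counter, e16]
      exact (pow_succ _ _).symm
    · by_cases hi : i ∈ H
      · rw [hhit i hi]; positivity
      · rw [hmiss i hi]; positivity
    · cases a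
      · by_cases hc : (1 + 19 * δ) * γ * n < H.card
        · have he : M - k = M - (k + 1) + 1 := by omega
          simp only [v, if_pos hc, he, Bool.false_eq_true, if_false]
          have hκ0 : 0 ≤ κ ^ (M - (k + 1)) := by
            rcases Nat.eq_zero_or_pos (M - (k + 1)) with h0 | h0
            · rw [h0, pow_zero]
              exact zero_le_one
            · have := (sq_nonneg η).trans (hM' 1 (by omega)).le
              rw [pow_one] at this
              exact pow_nonneg this _
          rw [sum_eq_of_two_values (H := H)
            (u := 1 - κ ^ (M - (k + 1)) / (η * (m₂.real 17 * (1 + δ) / ν)))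
            (w := 1 - κ ^ (M - (k + 1)) / (η * (m₂.real 17 / ν)))
            (fun i hi => by rw [hhit i hi]) (fun i hi => by rw [hmiss i hi])]
          have h1 := inverse_weight_factor hγ ⟨hδ0, hδ1⟩ hn' hc.le
          have h2 := mul_le_mul_of_nonneg_left h1
            (div_nonneg hκ0 (mul_pos hη e17).le)
          rw [← hν, ← hκ] at h2
          have h3 : (H.card : ℝ) * (1 - κ ^ (M - (k + 1)) / (η * (m₂.real 17 * (1 + δ) / ν))) +
              (n - H.card) * (1 - κ ^ (M - (k + 1)) / (η * (m₂.real 17 / ν))) =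
              n - κ ^ (M - (k + 1)) / (η * m₂.real 17) *
                (ν * (H.card / (1 + δ) + (n - H.card))) := by
            field_simp
            ring
          have h4 : (1 - κ ^ (M - (k + 1) + 1) / (η * m₂.real 17)) * n =
              n - κ ^ (M - (k + 1)) / (η * m₂.real 17) * (κ * n) := by
            rw [pow_succ]
            field_simp
          rw [h3, h4]
          linarith
        · simp [v, if_neg hc]
      · by_cases hc : (H.card : ℝ) ≤ (1 + 8 * δ) * γ * n
        · simp only [v, if_pos hc, if_true]
          rw [sum_eq_of_two_values (H := H) (u := 1 - η * (m₂.real 17 * (1 + δ) / ν))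
            (w := 1 - η * (m₂.real 17 / ν))
            (fun i hi => by rw [hhit i hi]) (fun i hi => by rw [hmiss i hi])]
          have h3 : (H.card : ℝ) * (1 - η * (m₂.real 17 * (1 + δ) / ν)) +
              (n - H.card) * (1 - η * (m₂.real 17 / ν)) =
              n - η * m₂.real 17 * ((n + H.card * δ) / ν) := by
            field_simp
            ring
          rw [h3]
          have h4 : (n + H.card * δ) / ν ≤ n := by
            rw [div_le_iff₀ hν0, hν]
            nlinarith
          nlinarith [mul_le_mul_of_nonneg_left h4 (mul_pos hη e17).le]
        · simp [v, if_neg hc]) (by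
    rintro m₂ ⟨n₂, r₂, e16, e17⟩
    refine ⟨?_, fun a => ?_⟩
    · simp only [Test.holds_realLt, Loc.addr_dir, e16, r₂ 9 (by simp), hm.real9, not_lt]
      exact hM
    · have hpos : 0 < η * m₂.real 17 := mul_pos hη e17
      cases a
      · simp only [v, Nat.sub_self, pow_zero, Bool.false_eq_true, if_false]
        split_ifs
        · refine ⟨by linarith [one_div_pos.2 hpos], fun h => ?_⟩
          simp only [Set.mem_ofPred_eq, not_not] at h
          rw [lt_div_iff₀ hη] at h
          have := one_le_one_div hpos (by linarith)
          linarith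
        · simp
      · simp only [v, if_true]
        split_ifs
        · refine ⟨by linarith, fun h => ?_⟩
          simp only [Set.mem_ofPred_eq, not_lt] at h
          rw [div_le_iff₀ hη] at h
          linarith
        · simp) ⟨fun a _ => by rw [n₁], fun a ha => r₁ a (by omega) (by omega), by simpa using h16,
          by simp [h17]⟩
  refine ⟨μ, (hr₁.seq_pure hμ).mono (by rw [show 20 * d + 26 + 1 = 20 * d + 27 from rfl]; omega), fun m' hm' => ⟨(hI m' hm').1, (hI m' hm').2.1⟩,
    fun hc => ?_, fun hc => ?_⟩
  · have := hv true
    simp only [v, if_true, if_pos hc, h17, mul_one] at this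
    exact this
  · have := hv false
    simp only [v, Bool.false_eq_true, if_false, if_pos hc, h17, mul_one, Nat.sub_zero] at this
    refine le_trans ?_ this
    have : κ ^ M / η ≤ η := by
      rw [div_le_iff₀ hη, ← sq]
      exact hM
    linarith

end Testing

/-! ### Numerical estimates -/

theorem exists_threshold {ι : Type*} (S : Finset ι) (f : ι → ℝ) {r : ℝ} (hr0 : 0 < r)
    (hr : r ≤ S.card) :
    ∃ τ, r ≤ (S.filter fun i => f i ≤ τ).card ∧ ((S.filter fun i => f i < τ).card : ℝ) ≤ r := by
  classical
  have hS : S.Nonempty := Finset.card_pos.1 (by exact_mod_cast hr0.trans_le hr)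
  obtain ⟨i₀, hi₀, hmax⟩ := S.exists_max_image f hS
  have hne : (S.filter fun i => r ≤ (S.filter fun k => f k ≤ f i).card).Nonempty := by
    refine ⟨i₀, Finset.mem_filter.2 ⟨hi₀, ?_⟩⟩
    rwa [Finset.filter_true_of_mem hmax]
  obtain ⟨j, hj, hmin⟩ := Finset.exists_min_image _ f hne
  obtain ⟨hjS, hjr⟩ := Finset.mem_filter.1 hj
  refine ⟨f j, hjr, ?_⟩
  by_contra! hc
  have hne' : (S.filter fun i => f i < f j).Nonempty :=
    Finset.card_pos.1 (by exact_mod_cast hr0.trans hc)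
  obtain ⟨k, hk, hkmax⟩ := Finset.exists_max_image _ f hne'
  obtain ⟨hkS, hkj⟩ := Finset.mem_filter.1 hk
  refine absurd (hmin k (Finset.mem_filter.2 ⟨hkS, hc.le.trans ?_⟩)) hkj.not_ge
  exact_mod_cast Finset.card_le_card fun i hi => Finset.mem_filter.2
    ⟨(Finset.mem_filter.1 hi).1, hkmax i hi⟩

theorem one_sub_pow_le {x : ℝ} (h0 : 0 ≤ x) (h1 : x ≤ 1) (k : ℕ) :
    (1 - x) ^ k ≤ 1 / (1 + k * x) := by
  have h2 : 1 + k * x ≤ (1 + x) ^ k := one_add_mul_le_pow (by linarith) k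
  have h3 : 0 ≤ k * x := by positivity
  rw [le_div_iff₀ (by linarith)]
  calc (1 - x) ^ k * (1 + k * x) ≤ (1 - x) ^ k * (1 + x) ^ k := by
        gcongr
    _ = (1 - x ^ 2) ^ k := by rw [← mul_pow]; ring
    _ ≤ 1 := pow_le_one₀ (by nlinarith) (by nlinarith)

/-- The search finds a good point with probability at least `δ / (3 (1 + δ))`. -/
theorem search_success_bound {γ δ σ β : ℝ} {r : ℕ} (hγ : 0 < γ) (hδ : δ ∈ Set.Ioo (0 : ℝ) 1)
    (hσ : 1 - γ ≤ σ) (hσ1 : σ ≤ 1) (hβ : 8 * δ * γ ≤ β) (hβσ : β ≤ σ)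
    (hr1 : 1 ≤ 2 * γ * (r + 2)) (hr2 : r = 0 ∨ 2 * γ * (r + 1) < 1) :
    δ / (3 * (1 + δ)) ≤ σ ^ (r + 1) - (σ - β) ^ (r + 1) := by
  obtain ⟨h0, h1⟩ := hδ
  have hβ0 : 0 < β := lt_of_lt_of_le (by positivity) hβ
  have hσ0 : 0 < σ := hβ0.trans_le hβσ
  rcases hr2 with rfl | hr2
  · have h2 : δ / (3 * (1 + δ)) ≤ δ := div_le_self h0.le (by linarith)
    have h3 : 1 / 4 ≤ γ := by norm_num at hr1; linarith
    simp only [zero_add, pow_one, sub_sub_cancel]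
    nlinarith
  · rcases Nat.eq_zero_or_pos r with rfl | hr
    · norm_num at hr1 hr2
      have h2 : δ / (3 * (1 + δ)) ≤ δ := div_le_self h0.le (by linarith)
      have h3 : 1 / 4 ≤ γ := by linarith
      simp only [zero_add, pow_one, sub_sub_cancel]
      nlinarith
    have hr' : (1 : ℝ) ≤ r := by exact_mod_cast hr
    -- `σ ^ (r + 1) ≥ 1 / 2` by Bernoulli's inequality.
    have hhalf : 1 / 2 ≤ σ ^ (r + 1) := by
      have hγ1 : γ < 1 := by nlinarith
      have h2 : 1 + ((r + 1 : ℕ) : ℝ) * (-γ) ≤ (1 + -γ) ^ (r + 1) :=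
        one_add_mul_le_pow (by linarith) _
      have h3 : (1 + -γ) ^ (r + 1) ≤ σ ^ (r + 1) :=
        pow_le_pow_left₀ (by linarith) (by linarith) _
      push_cast at h2
      linarith
    have hfac : (σ - β) ^ (r + 1) ≤ σ ^ (r + 1) * (1 - β) ^ (r + 1) := by
      rw [← mul_pow]
      exact pow_le_pow_left₀ (by linarith) (by nlinarith) _
    have h4 : (1 - β) ^ (r + 1) ≤ 1 / (1 + 2 * δ) := by
      refine (one_sub_pow_le hβ0.le (hβσ.trans hσ1) _).trans ?_
      refine one_div_le_one_div_of_le (by linarith) ?_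
      have h5 : 1 / 4 ≤ γ * (r + 1) := by nlinarith
      have h6 : 8 * δ * γ * (r + 1) ≤ β * (r + 1) := by gcongr
      push_cast
      nlinarith
    have h7 : 1 - 1 / (1 + 2 * δ) = 2 * δ / (1 + 2 * δ) := by
      field_simp
      ring
    have h8 : δ / (3 * (1 + δ)) ≤ 1 / 2 * (2 * δ / (1 + 2 * δ)) := by
      rw [show 1 / 2 * (2 * δ / (1 + 2 * δ)) = δ / (1 + 2 * δ) by ring]
      exact div_le_div_of_nonneg_left h0.le (by linarith) (by linarith)
    have h9 : 0 ≤ 2 * δ / (1 + 2 * δ) := by positivity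
    calc δ / (3 * (1 + δ)) ≤ 1 / 2 * (2 * δ / (1 + 2 * δ)) := h8
      _ ≤ σ ^ (r + 1) * (2 * δ / (1 + 2 * δ)) := by gcongr
      _ = σ ^ (r + 1) * (1 - 1 / (1 + 2 * δ)) := by rw [h7]
      _ ≤ σ ^ (r + 1) * (1 - (1 - β) ^ (r + 1)) := by gcongr
      _ ≤ _ := by linarith

theorem exists_search_length {γ : ℝ} (h0 : 0 < γ) :
    ∃ r : ℕ, 1 ≤ 2 * γ * (r + 2) ∧ (r = 0 ∨ 2 * γ * (r + 1) < 1) ∧ (r + 1) * γ ≤ 1 + γ := by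
  classical
  have hex : ∃ r : ℕ, 1 ≤ 2 * γ * (r + 2) := by
    obtain ⟨r, hr⟩ := exists_nat_ge (1 / (2 * γ))
    refine ⟨r, ?_⟩
    rw [div_le_iff₀ (by positivity)] at hr
    linarith
  refine ⟨Nat.find hex, Nat.find_spec hex, ?_⟩
  rcases Nat.eq_zero_or_pos (Nat.find hex) with h | h
  · rw [h]
    exact ⟨Or.inl rfl, by norm_num⟩
  · have h2 := Nat.find_min hex (m := Nat.find hex - 1) (by omega)
    rw [Nat.cast_sub h] at h2
    push_cast at h2
    rw [not_le] at h2
    constructor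
    · right
      linarith
    · linarith

theorem exists_test_length {y η : ℝ} (hy0 : 0 < y) (hy1 : y < 1) (hη0 : 0 < η) (hη1 : η < 1) :
    ∃ M : ℕ, (1 - y) ^ M ≤ η ^ 2 ∧ (∀ k < M, η ^ 2 < (1 - y) ^ k) ∧
      (M : ℝ) * y ≤ y + 2 * Real.log (1 / η) := by
  classical
  have hex : ∃ M : ℕ, (1 - y) ^ M ≤ η ^ 2 := by
    obtain ⟨M, hM⟩ := exists_pow_lt_of_lt_one (pow_pos hη0 2) (by linarith : 1 - y < 1)
    exact ⟨M, hM.le⟩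
  refine ⟨Nat.find hex, Nat.find_spec hex, fun k hk => not_le.1 (Nat.find_min hex hk), ?_⟩
  have hlog : 0 ≤ Real.log (1 / η) := Real.log_nonneg (by rw [le_div_iff₀ hη0]; linarith)
  rcases Nat.eq_zero_or_pos (Nat.find hex) with h | h
  · rw [h]
    simp only [CharP.cast_eq_zero, zero_mul]
    linarith
  · have h2 := not_le.1 (Nat.find_min hex (m := Nat.find hex - 1) (by omega))
    have h3 := Real.log_lt_log (by positivity) h2
    rw [Real.log_pow, Real.log_pow, Nat.cast_sub h] at h3
    have h4 : Real.log (1 - y) ≤ -y := by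
      have := Real.log_le_sub_one_of_pos (by linarith : 0 < 1 - y)
      linarith
    have h5 : ((Nat.find hex : ℕ) - (1 : ℕ) : ℝ) * Real.log (1 - y) ≤
        ((Nat.find hex : ℕ) - (1 : ℕ) : ℝ) * (-y) := by
      refine mul_le_mul_of_nonneg_left h4 ?_
      rw [sub_nonneg]
      exact_mod_cast h
    rw [one_div, Real.log_inv]
    push_cast at *
    linarith

/-! ### Convergence of the iteration -/

section Convergence

variable {d : ℕ} {x p : EuclideanSpace ℝ (Fin d)}

theorem normSq_segment (x p : EuclideanSpace ℝ (Fin d)) (t : ℝ) :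
    ‖x + t • (p - x)‖ ^ 2 =
      ‖x‖ ^ 2 - 2 * t * (‖x‖ ^ 2 - inner ℝ x p) + t ^ 2 * ‖x - p‖ ^ 2 := by
  rw [norm_add_sq_real, inner_smul_right, inner_sub_right, real_inner_self_eq_norm_sq, norm_smul,
    mul_pow, Real.norm_eq_abs, sq_abs, norm_sub_rev]
  ring

theorem stepSize_mem (h : inner ℝ x p ≤ ‖x‖ ^ 2) : stepSize x p ∈ Set.Icc (0 : ℝ) 1 := by
  unfold stepSize
  split_ifs with hc
  · have h1 : 0 < ‖x - p‖ ^ 2 := by linarith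
    exact ⟨div_nonneg (by linarith) h1.le, (div_le_one h1).2 hc.le⟩
  · exact ⟨zero_le_one, le_rfl⟩

theorem normSq_stepSize_le (h : inner ℝ x p ≤ ‖x‖ ^ 2) {t : ℝ} (ht : t ≤ 1) :
    ‖x + stepSize x p • (p - x)‖ ^ 2 ≤
      ‖x‖ ^ 2 - 2 * t * (‖x‖ ^ 2 - inner ℝ x p) + t ^ 2 * ‖x - p‖ ^ 2 := by
  rw [normSq_segment]
  unfold stepSize
  set g := ‖x‖ ^ 2 - inner ℝ x p
  set e := ‖x - p‖ ^ 2
  have he : 0 ≤ e := sq_nonneg _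
  split_ifs with hc
  · have h0 : 0 < e := by linarith
    have h1 : ‖x‖ ^ 2 - 2 * (g / e) * g + (g / e) ^ 2 * e = ‖x‖ ^ 2 - g ^ 2 / e := by
      field_simp
      ring
    have h2 : ‖x‖ ^ 2 - 2 * t * g + t ^ 2 * e = ‖x‖ ^ 2 - g ^ 2 / e + e * (t - g / e) ^ 2 := by
      field_simp
      ring
    rw [h1, h2]
    have := mul_nonneg h0.le (sq_nonneg (t - g / e))
    linarith
  · rw [not_lt] at hc
    -- The difference is `(1 - t) * (2 * g - (1 + t) * e)`.
    nlinarith [mul_nonneg (sub_nonneg.2 ht) (sub_nonneg.2 hc),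
      mul_nonneg (sq_nonneg (1 - t)) he]

theorem inner_lt_normSq_of_margin_lt {ε ρ : ℝ} (hε : ε ∈ Set.Ioo (0 : ℝ) 1) (hρ : 0 < ρ)
    (hx : ρ ≤ ‖x‖) (hp : inner ℝ x p < (1 - ε) * ρ * ‖x‖) : inner ℝ x p < ‖x‖ ^ 2 := by
  refine hp.trans_le ?_
  rw [sq]
  refine mul_le_mul_of_nonneg_right ?_ (norm_nonneg x)
  nlinarith [mul_pos hε.1 hρ]

/-- One step decreases the excess `u = ‖x‖ - (1 - ε) ρ` as long as the margin `⟪x, p⟫ / ‖x‖` is less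
than `(1 - ε) ρ`: after `i` steps it is at most `2 D ^ 2 / (i ρ)`, because a step either subtracts
at least `ρ u ^ 2 / (2 D ^ 2)` or (if it goes all the way to `p`) halves it. -/
theorem excess_step {ε ρ D : ℝ} {i : ℕ} (hε : ε ∈ Set.Ioo (0 : ℝ) 1) (hρ : 0 < ρ)
    (hx : ρ ≤ ‖x‖) (hD : ‖x - p‖ ≤ D) (hp : inner ℝ x p < (1 - ε) * ρ * ‖x‖)
    (hx' : ρ ≤ ‖x + stepSize x p • (p - x)‖)
    (hi : i * ρ * (‖x‖ - (1 - ε) * ρ) ≤ 2 * D ^ 2) :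
    (i + 1) * ρ * (‖x + stepSize x p • (p - x)‖ - (1 - ε) * ρ) ≤ 2 * D ^ 2 := by
  obtain ⟨h0, h1⟩ := hε
  have key : ∀ t : ℝ, 0 ≤ t → t ≤ 1 → ‖x + stepSize x p • (p - x)‖ ^ 2 ≤
      ‖x‖ ^ 2 - 2 * t * (‖x‖ * (‖x‖ - (1 - ε) * ρ)) + t ^ 2 * D ^ 2 := by
    intro t ht0 ht1
    refine (normSq_stepSize_le ?_ ht1).trans ?_
    · exact (inner_lt_normSq_of_margin_lt ⟨h0, h1⟩ hρ hx hp).le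
    have h2 : ‖x - p‖ ^ 2 ≤ D ^ 2 := pow_le_pow_left₀ (norm_nonneg _) hD 2
    have h3 := mul_le_mul_of_nonneg_left h2 (sq_nonneg t)
    have h4 : t * (‖x‖ * (‖x‖ - (1 - ε) * ρ)) ≤ t * (‖x‖ ^ 2 - inner ℝ x p) := by
      refine mul_le_mul_of_nonneg_left ?_ ht0
      nlinarith
    linarith
  set r := ‖x‖
  set r' := ‖x + stepSize x p • (p - x)‖
  set u := r - (1 - ε) * ρ with hu
  have hu0 : 0 < u := by
    have : 0 < ε * ρ := mul_pos h0 hρ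
    linarith
  have hu' : 0 < r' - (1 - ε) * ρ := by
    have : 0 < ε * ρ := mul_pos h0 hρ
    linarith
  have hur : u ≤ r := by
    have : 0 < (1 - ε) * ρ := mul_pos (by linarith) hρ
    linarith
  have hr0 : 0 < r := hρ.trans_le hx
  rcases le_or_gt (r * u) (D ^ 2) with hc | hc
  · have hD0 : 0 < D ^ 2 := (mul_pos hr0 hu0).trans_le hc
    have hk := key (r * u / D ^ 2) (by positivity) ((div_le_one hD0).2 hc)
    have e1 : r ^ 2 - 2 * (r * u / D ^ 2) * (r * u) + (r * u / D ^ 2) ^ 2 * D ^ 2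
        = r ^ 2 * (1 - u ^ 2 / D ^ 2) := by
      field_simp
      ring
    rw [e1] at hk
    set s := u ^ 2 / D ^ 2 with hs
    have hs1 : s ≤ 1 := (div_le_one hD0).2 (by nlinarith)
    have h2 : r' ≤ r * (1 - s / 2) := by
      refine (pow_le_pow_iff_left₀ (by linarith) (mul_nonneg hr0.le (by linarith))
        two_ne_zero).1 (hk.trans ?_)
      rw [mul_pow]
      gcongr
      nlinarith [sq_nonneg s]
    -- In terms of `w = ρ u / (2 D ^ 2)` the step replaces `w` by at most `w - w ^ 2`.
    set w := ρ * u / (2 * D ^ 2) with hw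
    have hw0 : 0 < w := by positivity
    have h3 : ρ * (r' - (1 - ε) * ρ) ≤ 2 * D ^ 2 * (w - w ^ 2) := by
      have e2 : 2 * D ^ 2 * (w - w ^ 2) = ρ * (u - ρ * (s / 2)) := by
        rw [hw, hs]
        field_simp
        rw [sub_div, mul_div_cancel_right₀ _ hD0.ne']
      rw [e2]
      refine mul_le_mul_of_nonneg_left ?_ hρ.le
      have : 0 ≤ s / 2 := by positivity
      nlinarith
    have h4 : i * w ≤ 1 := by
      rw [hw, ← mul_div_assoc, div_le_one (by positivity)]
      linarith
    have h5 : (i + 1) * (w - w ^ 2) ≤ 1 := by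
      have hi0 : (0 : ℝ) ≤ i := i.cast_nonneg
      rcases le_or_gt w 1 with hw1 | hw1
      · nlinarith [mul_le_mul_of_nonneg_right h4 (sub_nonneg.2 hw1)]
      · have : 0 ≤ (i + 1) * (w * (w - 1)) :=
          mul_nonneg (by linarith) (mul_nonneg hw0.le (by linarith))
        nlinarith
    calc (i + 1) * ρ * (r' - (1 - ε) * ρ) = (i + 1) * (ρ * (r' - (1 - ε) * ρ)) := by ring
      _ ≤ (i + 1) * (2 * D ^ 2 * (w - w ^ 2)) := by gcongr
      _ = 2 * D ^ 2 * ((i + 1) * (w - w ^ 2)) := by ring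
      _ ≤ 2 * D ^ 2 * 1 := by gcongr
      _ = 2 * D ^ 2 := mul_one _
  · have hk := key 1 zero_le_one le_rfl
    rcases Nat.eq_zero_or_pos i with rfl | hi0
    · have h2 : 0 < (1 - ε) * ρ := mul_pos (by linarith) hρ
      have h3 : (r' - (1 - ε) * ρ) * (r' + (1 - ε) * ρ) ≤ D ^ 2 := by
        have : r = u + (1 - ε) * ρ := by rw [hu]; ring
        rw [this] at hk
        nlinarith [sq_nonneg u]
      have h4 : (r' - (1 - ε) * ρ) * ρ ≤ (r' - (1 - ε) * ρ) * (r' + (1 - ε) * ρ) := by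
        gcongr
        linarith
      push_cast
      nlinarith [sq_nonneg D]
    · have h2 : r' ≤ r - u / 2 := by
        refine (pow_le_pow_iff_left₀ (by linarith) (by linarith) two_ne_zero).1 ?_
        nlinarith [sq_nonneg u]
      have h3 : (1 : ℝ) ≤ i := by exact_mod_cast hi0
      have h4 : r' - (1 - ε) * ρ ≤ u / 2 := by linarith
      calc (i + 1) * ρ * (r' - (1 - ε) * ρ) ≤ (i + 1) * ρ * (u / 2) := by gcongr
        _ ≤ i * ρ * u := by nlinarith [mul_nonneg (sub_nonneg.2 h3) (mul_pos hρ hu0).le]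
        _ ≤ _ := hi

end Convergence

/-! ### Feasible and optimal halfspaces -/

section Optimal

variable {n d : ℕ} {P : Fin n → EuclideanSpace ℝ (Fin d)} {γ : ℝ} {S : Finset (Fin n)}
  {H : Halfspace d}

theorem IsFeasible.dim_pos (h : IsFeasible P γ S H) : 0 < d := by
  rcases Nat.eq_zero_or_pos d with rfl | hd
  · exact absurd (Subsingleton.elim _ _) h.2.1.1
  · exact hd

theorem IsFeasible.margin_pos (h : IsFeasible P γ S H) : 0 < H.margin :=
  div_pos h.2.1.2 (norm_pos_iff.2 h.2.1.1)

/-- Without points there is no optimal solution, as the margins are unbounded. -/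
theorem IsOptimal.card_pos (h : IsOptimal P γ S H) : 0 < n := by
  rcases Nat.eq_zero_or_pos n with rfl | hn
  · have h1 := h.2 ∅ ⟨H.normal, 2 * H.offset⟩
      ⟨by simp, ⟨h.1.2.1.1, mul_pos two_pos h.1.2.1.2⟩, by simp⟩
    have h2 := h.1.margin_pos
    unfold Halfspace.margin at h1 h2
    rw [mul_div_assoc] at h1
    linarith
  · exact hn

theorem IsFeasible.margin_le_norm (h : IsFeasible P γ S H) {y : EuclideanSpace ℝ (Fin d)}
    (hy : y ∈ convexHull ℝ (P '' S)) : H.margin ≤ ‖y‖ := by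
  have h1 : convexHull ℝ (P '' S) ⊆ {y | H.offset ≤ inner ℝ H.normal y} := by
    refine convexHull_min ?_ (convex_halfSpace_ge (innerₛₗ ℝ H.normal).isLinear _)
    rintro _ ⟨i, hi, rfl⟩
    exact h.2.2 i hi
  have h2 : H.offset ≤ inner ℝ H.normal y := h1 hy
  rw [Halfspace.margin, div_le_iff₀ (norm_pos_iff.2 h.2.1.1), mul_comm]
  exact h2.trans (real_inner_le_norm _ _)

theorem IsFeasible.margin_le_polytopeDist (h : IsFeasible P γ S H) (hS : S.Nonempty) :
    H.margin ≤ polytopeDist P S := by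
  have hne : (convexHull ℝ (P '' S)).Nonempty := by
    rw [convexHull_nonempty_iff]
    exact Set.Nonempty.image P (by exact_mod_cast hS)
  refine (Metric.le_infDist hne).2 fun y hy => ?_
  rw [dist_zero_left]
  exact h.margin_le_norm hy

theorem polytopeDist_le_norm {y : EuclideanSpace ℝ (Fin d)} (hy : y ∈ convexHull ℝ (P '' S)) :
    polytopeDist P S ≤ ‖y‖ := by
  have := Metric.infDist_le_dist_of_mem (x := (0 : EuclideanSpace ℝ (Fin d))) hy
  rwa [dist_zero_left] at this

theorem norm_sub_le_diameter {x y : EuclideanSpace ℝ (Fin d)}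
    (hx : x ∈ convexHull ℝ (P '' S)) (hy : y ∈ convexHull ℝ (P '' S)) :
    ‖x - y‖ ≤ diameter P S := by
  have hb : Bornology.IsBounded (convexHull ℝ (P '' S)) :=
    isBounded_convexHull.2 ((S.finite_toSet.image P).isBounded)
  rw [diameter, ← convexHull_diam, ← dist_eq_norm]
  exact Metric.dist_le_diam_of_mem hb hx hy

end Optimal

/-! ### One iteration -/

section Iteration

variable {n d : ℕ} {P : Fin n → EuclideanSpace ℝ (Fin d)}

variable (P) in
/-- The number of points `p` with `⟪x, p⟫ < b`. -/
noncomputable def missed (x : EuclideanSpace ℝ (Fin d)) (b : ℝ) : ℕ :=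
  (Finset.univ.filter fun i => inner ℝ x (P i) < b).card

variable (P) in
/-- The effect of an iteration in which the search has found the point number `p`. -/
structure IterationPost (z : ℕ) (γ δ η : ℝ) (p : Fin n) (m m' : Mem) : Prop where
  constants : Constants n d z γ δ η m'
  counter : m'.nat 8 = m.nat 8 + 1
  candidate : m'.nat 7 = p
  x : vec d m' 30 = vec d m 30 + stepSize (vec d m 30) (P p) • (P p - vec d m 30)
  record : m'.real 17 < 1 / η → m.real 22 < inner ℝ (vec d m 30) (P p) / ‖vec d m 30‖ →
    vec d m' (30 + d) = vec d m 30 ∧ m'.real 21 = inner ℝ (vec d m 30) (P p) ∧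
      m'.real 22 = inner ℝ (vec d m 30) (P p) / ‖vec d m 30‖
  keep : ¬ (m'.real 17 < 1 / η ∧ m.real 22 < inner ℝ (vec d m 30) (P p) / ‖vec d m 30‖) →
    vec d m' (30 + d) = vec d m (30 + d) ∧ m'.real 21 = m.real 21 ∧ m'.real 22 = m.real 22

/-- Some threshold for the inner product with `x` is met by many points of `S`, and every point of
`S` that meets it has only few points below it. -/
theorem exists_good_threshold {γ δ : ℝ} (hγ : γ ∈ Set.Ioo (0 : ℝ) 1) (hδ : δ ∈ Set.Ioo (0 : ℝ) 1)
    (hn : 0 < n) (hq : (1 + 19 * δ) * γ < 1) {S : Finset (Fin n)} (hS : (1 - γ) * n ≤ S.card)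
    (x : EuclideanSpace ℝ (Fin d)) :
    ∃ τ, 8 * δ * γ ≤ ((S.filter fun i => inner ℝ x (P i) ≤ τ).card : ℝ) / n ∧
      ∀ p ∈ S, inner ℝ x (P p) ≤ τ → (missed P x (inner ℝ x (P p)) : ℝ) ≤ (1 + 8 * δ) * γ * n := by
  classical
  obtain ⟨hγ0, hγ1⟩ := hγ
  obtain ⟨hδ0, hδ1⟩ := hδ
  have hn' : (0 : ℝ) < n := by exact_mod_cast hn
  obtain ⟨τ, h1, h2⟩ := exists_threshold S (fun i => inner ℝ x (P i)) (r := 8 * δ * γ * n)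
    (by positivity) (by nlinarith [mul_pos hδ0 hγ0])
  refine ⟨τ, by rwa [le_div_iff₀ hn'], fun p _ hp => ?_⟩
  have h3 : missed P x (inner ℝ x (P p)) ≤
      Sᶜ.card + (S.filter fun i => inner ℝ x (P i) < τ).card := by
    refine le_trans (Finset.card_le_card ?_) (Finset.card_union_le _ _)
    intro i hi
    rw [Finset.mem_union, Finset.mem_compl]
    by_cases hiS : i ∈ S
    · exact Or.inr (Finset.mem_filter.2 ⟨hiS, (Finset.mem_filter.1 hi).2.trans_le hp⟩)
    · exact Or.inl hiS
  have h4 : (missed P x (inner ℝ x (P p)) : ℝ) ≤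
      Sᶜ.card + (S.filter fun i => inner ℝ x (P i) < τ).card := by exact_mod_cast h3
  rw [Finset.card_compl, Nat.cast_sub (Finset.card_le_univ S), Fintype.card_fin] at h4
  nlinarith

theorem runs_iteration {z : ℕ} {γ δ η : ℝ} {m : Mem} (hm : Constants n d z γ δ η m) (hn : 0 < n)
    (hγ : γ ∈ Set.Ioo (0 : ℝ) 1) (hδ : δ ∈ Set.Ioo (0 : ℝ) 1) (hη : η ∈ Set.Ioo (0 : ℝ) 1)
    (hq : (1 + 19 * δ) * γ < 1) {r M : ℕ}
    (hr1 : 1 ≤ 2 * γ * (r + 2)) (hr2 : r = 0 ∨ 2 * γ * (r + 1) < 1)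
    (hM : (1 - γ * δ ^ 2) ^ M ≤ η ^ 2) (hM' : ∀ k < M, η ^ 2 < (1 - γ * δ ^ 2) ^ k) :
    ∃ μ, Runs P iteration m ((r + 1 + M) * (20 * d + 27) + 42 * d + 72) μ ∧
      (∀ m' ∈ μ.support, ∃ p, IterationPost P z γ δ η p m m') ∧
      (∀ S : Finset (Fin n), (1 - γ) * n ≤ S.card →
        (1 - η) * (δ / (3 * (1 + δ))) ≤ prob μ {m' | ∃ p ∈ S, m'.nat 7 = (p : Fin n) ∧
          (missed P (vec d m 30) (inner ℝ (vec d m 30) (P p)) : ℝ) ≤ (1 + 8 * δ) * γ * n ∧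
          m'.real 17 < 1 / η}) ∧
      1 - η ≤ prob μ {m' | ∀ p : Fin n, m'.nat 7 = p → m'.real 17 < 1 / η →
        (missed P (vec d m 30) (inner ℝ (vec d m 30) (P p)) : ℝ) ≤ (1 + 19 * δ) * γ * n} := by
  have hn' : (0 : ℝ) < n := by exact_mod_cast hn
  obtain ⟨μ, hμ, hpost, hμS⟩ := runs_search (P := P) hm hn hr1 hr2
  set x := vec d m 30 with hx
  -- The test and the final part, after a search with the result `m₁`.
  have hrest : ∀ m₁ ∈ μ.support, ∃ ν, Runs P (.seq test advance) m₁
      (M * (20 * d + 27) + 42 * d + 70) ν ∧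
      ((∀ m' ∈ ν.support, ∃ p, IterationPost P z γ δ η p m m' ∧ m'.nat 7 = m₁.nat 7) ∧
      (∀ p : Fin n, m₁.nat 7 = p → (missed P x (inner ℝ x (P p)) : ℝ) ≤ (1 + 8 * δ) * γ * n →
        1 - η ≤ prob ν {m' | m'.real 17 < 1 / η}) ∧
      (∀ p : Fin n, m₁.nat 7 = p → (1 + 19 * δ) * γ * n < missed P x (inner ℝ x (P p)) →
        1 - η ≤ prob ν {m' | ¬ m'.real 17 < 1 / η})) := by
    intro m₁ hm₁
    obtain ⟨n₁, r₁, p, h7, h18⟩ := hpost m₁ hm₁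
    have hc₁ : Constants n d z γ δ η m₁ :=
        hm.congr (fun a ha => n₁ a (by omega)) fun a ha => r₁ a (by omega)
    have hx₁ : vec d m₁ 30 = x := vec_congr fun k _ => r₁ _ (by omega)
    have hy₁ : vec d m₁ (30 + d) = vec d m (30 + d) := vec_congr fun k _ => r₁ _ (by omega)
    obtain ⟨ν, hν, hframe, hpass, hfail⟩ := runs_test (P := P) hc₁ hn hγ.1 hδ hη.1 hM hM'
    have hadv : ∀ m₂ ∈ ν.support, ∃ ξ, Runs P advance m₂ (42 * d + 62) ξ ∧
        ∃ m', ξ = PMF.pure m' ∧ m'.real 17 = m₂.real 17 ∧ m'.nat 7 = p ∧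
          IterationPost P z γ δ η p m m' := by
      intro m₂ hm₂
      obtain ⟨n₂, r₂⟩ := hframe m₂ hm₂
      have hc₂ : Constants n d z γ δ η m₂ :=
        hc₁.congr (fun a ha => n₂ a (by omega)) fun a ha => r₂ a (by omega)
      have h7₂ : m₂.nat 7 = p := (n₂ 7 (by simp)).trans h7
      have hx₂ : vec d m₂ 30 = x := (vec_congr fun k _ => r₂ _ (by omega)).trans hx₁
      have hy₂ : vec d m₂ (30 + d) = vec d m (30 + d) :=
        (vec_congr fun k _ => r₂ _ (by omega)).trans hy₁
      have e21 : m₂.real 21 = m.real 21 := (r₂ 21 (by simp)).trans (r₁ 21 (by simp))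
      have e22 : m₂.real 22 = m.real 22 := (r₂ 22 (by simp)).trans (r₁ 22 (by simp))
      obtain ⟨m', hr, hA⟩ := runs_advance (P := P) hc₂ p h7₂
      have e17 : m'.real 17 = m₂.real 17 := hA.real 17 (by simp)
      have h7' : m'.nat 7 = p := (hA.nat 7 (by simp)).trans h7₂
      refine ⟨_, hr, m', rfl, e17, h7', ?_, ?_, h7', ?_, ?_, ?_⟩
      · exact hc₂.congr (fun a ha => hA.nat a (by omega)) fun a ha => hA.real a (by omega)
      · rw [hA.counter, n₂ 8 (by simp), n₁ 8 (by simp)]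
      · rw [hA.x, hx₂]
      · have := hA.record
        rwa [hx₂, e22, ← e17] at this
      · have := hA.keep
        rwa [hx₂, e22, e21, hy₂, ← e17] at this
    obtain ⟨ξ, hξ, hξQ⟩ := Runs.seq_exists hν hadv
    have hmissed : ∀ p' : Fin n, m₁.nat 7 = p' →
        (missed P x (inner ℝ x (P p')) : ℝ) = (Finset.univ.filter fun i =>
          inner ℝ (vec d m₁ 30) (P i) < m₁.real 18).card := by
      intro p' hp'
      have : p' = p := Fin.ext (hp'.symm.trans h7)
      rw [this, missed, hx₁, h18]
    refine ⟨_, hξ.mono (by omega), ?_, fun p' hp' hle => ?_, fun p' hp' hlt => ?_⟩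
    · intro m' hm'
      obtain ⟨m₂, hm₂, hm''⟩ := (PMF.mem_support_bind_iff _ _ _).1 hm'
      obtain ⟨m₃, e, -, h7', hpost'⟩ := hξQ m₂ hm₂
      rw [e, PMF.support_pure, Set.mem_singleton_iff] at hm''
      rw [hm'']
      exact ⟨p, hpost', h7'.trans h7.symm⟩
    · rw [hmissed p' hp'] at hle
      have := le_prob_bind (A := {m' : Mem | m'.real 17 < 1 / η}) (ν := ξ) zero_le_one (hpass hle)
        fun m₂ hm₂ h2 => by
          obtain ⟨m₃, e, e17, -⟩ := hξQ m₂ hm₂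
          rw [e, prob_pure]
          exact e17.trans_lt h2
      rwa [mul_one] at this
    · rw [hmissed p' hp'] at hlt
      have := le_prob_bind (A := {m' : Mem | ¬ m'.real 17 < 1 / η}) (ν := ξ) zero_le_one
        (hfail hlt) fun m₂ hm₂ h2 => by
          obtain ⟨m₃, e, e17, -⟩ := hξQ m₂ hm₂
          rw [e, prob_pure]
          exact fun h => h2 (e17 ▸ h)
      rwa [mul_one] at this
  obtain ⟨ν, hν, hνQ⟩ := Runs.seq_exists hμ hrest
  refine ⟨_, hν.mono (by ring_nf; omega), ?_, fun S hS => ?_, ?_⟩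
  · intro m' hm'
    obtain ⟨m₁, hm₁, h⟩ := (PMF.mem_support_bind_iff _ _ _).1 hm'
    obtain ⟨p, hp, -⟩ := (hνQ m₁ hm₁).1 m' h
    exact ⟨p, hp⟩
  · obtain ⟨τ, hτ1, hτ2⟩ := exists_good_threshold (P := P) hγ hδ hn hq hS x
    have hsucc := search_success_bound (σ := (S.card : ℝ) / n) hγ.1 hδ
      (by rwa [le_div_iff₀ hn']) (by
        rw [div_le_one hn']
        exact_mod_cast (Finset.card_le_univ S).trans_eq (Fintype.card_fin n)) hτ1 (by
        gcongr
        exact Finset.filter_subset _ _) hr1 hr2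
    rw [mul_comm]
    refine le_prob_bind (by linarith [hη.2]) (hsucc.trans (hμS S τ)) fun m₁ hm₁ h1 => ?_
    obtain ⟨p, hpS, h7, hpτ⟩ := h1
    obtain ⟨hsup, hpass, -⟩ := hνQ m₁ hm₁
    refine (hpass p h7 (hτ2 p hpS hpτ)).trans (prob_mono_on_support fun m' hm' h17 => ?_)
    obtain ⟨-, -, h7'⟩ := hsup m' hm'
    exact ⟨p, hpS, h7'.trans h7, hτ2 p hpS hpτ, h17⟩
  · have := le_prob_bind (μ := μ) (ν := ν) (E := Set.univ) (a := 1) (b := 1 - η)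
      (A := {m' | ∀ p : Fin n, m'.nat 7 = p → m'.real 17 < 1 / η →
        (missed P x (inner ℝ x (P p)) : ℝ) ≤ (1 + 19 * δ) * γ * n}) (by linarith [hη.2])
      (prob_eq_one fun _ _ => trivial).ge fun m₁ hm₁ _ => by
        obtain ⟨hsup, -, hfail⟩ := hνQ m₁ hm₁
        obtain ⟨-, -, p, h7, -⟩ := hpost m₁ hm₁
        by_cases hc : (missed P x (inner ℝ x (P p)) : ℝ) ≤ (1 + 19 * δ) * γ * n
        · rw [prob_eq_one]
          · linarith [hη.1]
          · intro m' hm' p' hp' _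
            obtain ⟨-, -, h7'⟩ := hsup m' hm'
            have : p' = p := Fin.ext (hp'.symm.trans (h7'.trans h7))
            rwa [this]
        · exact (hfail p h7 (not_le.1 hc)).trans (prob_mono fun m' h17 p' _ h => absurd h h17)
    rwa [one_mul] at this

end Iteration

/-! ### The main loop -/

section MainLoop

variable {n d : ℕ} {P : Fin n → EuclideanSpace ℝ (Fin d)}

/-- The stored data fit together: the margin of the halfspace given by the vector `y` and the offset
in real cell `21` is in real cell `22`. -/
structure Recorded (d : ℕ) (m : Mem) : Prop where
  nonneg : 0 ≤ m.real 22
  offset : m.real 21 = m.real 22 * ‖vec d m (30 + d)‖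
  ne_zero : 0 < m.real 22 → vec d m (30 + d) ≠ 0

variable (P) in
/-- The stored halfspace, if any, covers at least `(1 - (1 + 19 δ) γ) n` points. -/
def Covering (γ δ : ℝ) (m : Mem) : Prop :=
  0 < m.real 22 → (missed P (vec d m (30 + d)) (m.real 21) : ℝ) ≤ (1 + 19 * δ) * γ * n

variable (P) in
/-- The state of a successful run after `k` iterations: a halfspace of sufficient margin has been
found, or `x` is a vector in the polytope with a norm near its least possible value. -/
def Progress (S : Finset (Fin n)) (ε ρ D : ℝ) (k : ℕ) (m : Mem) : Prop :=
  (1 - ε) * ρ ≤ m.real 22 ∨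
    (vec d m 30 ∈ convexHull ℝ (P '' S) ∧ k * ρ * (‖vec d m 30‖ - (1 - ε) * ρ) ≤ 2 * D ^ 2)

variable {z : ℕ} {γ δ η : ℝ} {p : Fin n} {m m' : Mem}

theorem IterationPost.recorded (h : IterationPost P z γ δ η p m m') (hm : Recorded d m) :
    Recorded d m' := by
  by_cases hc : m'.real 17 < 1 / η ∧ m.real 22 < inner ℝ (vec d m 30) (P p) / ‖vec d m 30‖
  · obtain ⟨hy, h21, h22⟩ := h.record hc.1 hc.2
    have h0 : 0 < inner ℝ (vec d m 30) (P p) / ‖vec d m 30‖ := hm.nonneg.trans_lt hc.2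
    have hx : ‖vec d m 30‖ ≠ 0 := fun hx => by
      rw [hx, div_zero] at h0
      exact lt_irrefl _ h0
    refine ⟨h22 ▸ h0.le, ?_, fun _ => hy ▸ norm_ne_zero_iff.1 hx⟩
    rw [h21, h22, hy, div_mul_cancel₀ _ hx]
  · obtain ⟨hy, h21, h22⟩ := h.keep hc
    exact ⟨h22 ▸ hm.nonneg, by rw [h21, h22, hy, hm.offset], by rw [h22, hy]; exact hm.ne_zero⟩

theorem IterationPost.covering (h : IterationPost P z γ δ η p m m') (hm : Covering P γ δ m)
    (hp : m'.real 17 < 1 / η →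
      (missed P (vec d m 30) (inner ℝ (vec d m 30) (P p)) : ℝ) ≤ (1 + 19 * δ) * γ * n) :
    Covering P γ δ m' := by
  by_cases hc : m'.real 17 < 1 / η ∧ m.real 22 < inner ℝ (vec d m 30) (P p) / ‖vec d m 30‖
  · obtain ⟨hy, h21, h22⟩ := h.record hc.1 hc.2
    intro _
    rw [hy, h21]
    exact hp hc.1
  · obtain ⟨hy, h21, h22⟩ := h.keep hc
    unfold Covering
    rw [hy, h21, h22]
    exact hm

theorem IterationPost.margin_ge (h : IterationPost P z γ δ η p m m') :
    m.real 22 ≤ m'.real 22 := by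
  by_cases hc : m'.real 17 < 1 / η ∧ m.real 22 < inner ℝ (vec d m 30) (P p) / ‖vec d m 30‖
  · exact (h.record hc.1 hc.2).2.2 ▸ hc.2.le
  · exact (h.keep hc).2.2.ge

theorem IterationPost.progress {S : Finset (Fin n)} {ε : ℝ} {k : ℕ}
    (h : IterationPost P z γ δ η p m m') (hε : ε ∈ Set.Ioo (0 : ℝ) 1)
    (hρ : 0 < polytopeDist P S) (hp : p ∈ S) (h17 : m'.real 17 < 1 / η)
    (hm : Progress P S ε (polytopeDist P S) (diameter P S) k m) :
    Progress P S ε (polytopeDist P S) (diameter P S) (k + 1) m' := by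
  rcases hm with hm | ⟨hx, hk⟩
  · exact Or.inl (hm.trans h.margin_ge)
  have hnorm := polytopeDist_le_norm hx
  have hpos : 0 < ‖vec d m 30‖ := hρ.trans_le hnorm
  rcases le_or_gt ((1 - ε) * polytopeDist P S) (inner ℝ (vec d m 30) (P p) / ‖vec d m 30‖)
    with hc | hc
  · left
    by_cases hc' : m.real 22 < inner ℝ (vec d m 30) (P p) / ‖vec d m 30‖
    · rw [(h.record h17 hc').2.2]
      exact hc
    · rw [(h.keep fun h' => hc' h'.2).2.2]
      exact hc.trans (not_lt.1 hc')
  · rw [div_lt_iff₀ hpos] at hc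
    have hpS : P p ∈ convexHull ℝ (P '' S) := subset_convexHull ℝ _ ⟨p, hp, rfl⟩
    have ht := stepSize_mem (inner_lt_normSq_of_margin_lt hε hρ hnorm hc).le
    have hx' : vec d m' 30 ∈ convexHull ℝ (P '' S) := by
      rw [h.x]
      exact (convex_convexHull ℝ _).add_smul_sub_mem hx hpS ht
    refine Or.inr ⟨hx', ?_⟩
    have hnorm' := polytopeDist_le_norm hx'
    rw [h.x] at hnorm' ⊢
    push_cast
    exact excess_step hε hρ hnorm (norm_sub_le_diameter hx hpS) hc hnorm' hk

/-- After sufficiently many successful iterations a halfspace of sufficient margin has been found. -/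
theorem Progress.margin_ge {S : Finset (Fin n)} {ε D : ℝ} (hz : 1 ≤ z)
    (hε : ε ∈ Set.Ioo (0 : ℝ) 1) (hρ : 0 < polytopeDist P S)
    (hzD : 3 * (D ^ 2 / (ε * polytopeDist P S ^ 2)) ≤ z)
    (h : Progress P S ε (polytopeDist P S) D z m) : (1 - ε) * polytopeDist P S ≤ m.real 22 := by
  rcases h with h | ⟨hx, hk⟩
  · exact h
  exfalso
  have hnorm := polytopeDist_le_norm hx
  set ρ := polytopeDist P S
  have hερ : 0 < ε * ρ ^ 2 := mul_pos hε.1 (pow_pos hρ 2)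
  rw [← mul_div_assoc, div_le_iff₀ hερ] at hzD
  have hz' : (0 : ℝ) < z := by exact_mod_cast hz
  have h1 : z * ρ * (ε * ρ) ≤ z * ρ * (‖vec d m 30‖ - (1 - ε) * ρ) := by
    gcongr
    linarith
  have h2 : 0 < z * (ε * ρ ^ 2) := mul_pos hz' hερ
  nlinarith

/-- The main loop, from a vector `x` in the polytope. -/
theorem runs_mainLoop {ε : ℝ} (hm : Constants n d z γ δ η m) (hm8 : m.nat 8 = 0)
    (hrec : Recorded d m) (hcov : Covering P γ δ m) (hn : 0 < n)
    (hγ : γ ∈ Set.Ioo (0 : ℝ) 1) (hδ : δ ∈ Set.Ioo (0 : ℝ) 1) (hη : η ∈ Set.Ioo (0 : ℝ) 1)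
    (hε : ε ∈ Set.Ioo (0 : ℝ) 1) (hq : (1 + 19 * δ) * γ < 1) {r M : ℕ}
    (hr1 : 1 ≤ 2 * γ * (r + 2)) (hr2 : r = 0 ∨ 2 * γ * (r + 1) < 1)
    (hM : (1 - γ * δ ^ 2) ^ M ≤ η ^ 2) (hM' : ∀ k < M, η ^ 2 < (1 - γ * δ ^ 2) ^ k)
    {S : Finset (Fin n)} (hS : (1 - γ) * n ≤ S.card) (hρ : 0 < polytopeDist P S) (hz : 1 ≤ z)
    (hzD : 3 * (diameter P S ^ 2 / (ε * polytopeDist P S ^ 2)) ≤ z) :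
    ∃ μ, Runs P (.loop (.natLt (.dir 8) (.dir 2)) iteration) m
        (z * ((r + 1 + M) * (20 * d + 27) + 42 * d + 73) + 1) μ ∧
      (∀ m' ∈ μ.support, Constants n d z γ δ η m' ∧ Recorded d m') ∧
      (vec d m 30 ∈ convexHull ℝ (P '' S) → ((1 - η) * (δ / (3 * (1 + δ)))) ^ z ≤
        prob μ {m' | Covering P γ δ m' ∧ (1 - ε) * polytopeDist P S ≤ m'.real 22}) ∧
      (1 - η) ^ z ≤ prob μ {m' | Covering P γ δ m'} := by
  obtain ⟨μ, hμ, hI, hJ⟩ := Runs.counted_loop (P := P) (k := z)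
    (b := .natLt (.dir 8) (.dir 2)) (p := iteration)
    (t := (r + 1 + M) * (20 * d + 27) + 42 * d + 72)
    (fun k m' => Constants n d z γ δ η m' ∧ m'.nat 8 = k ∧ Recorded d m')
    (fun a k m' => Covering P γ δ m' ∧
      (a = true → Progress P S ε (polytopeDist P S) (diameter P S) k m'))
    (fun a : Bool => if a then (1 - η) * (δ / (3 * (1 + δ))) else 1 - η)
    (fun a => by
      have h1 : 0 < 1 - η := by linarith [hη.2]
      have h2 := hδ.1
      split_ifs <;> positivity)
    (by
      rintro k hk m₁ ⟨hc, h8, hrec₁⟩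
      refine ⟨by simpa [h8, hc.nat2] using hk, ?_⟩
      obtain ⟨μ, hμ, hpost, hsucc, hvalid⟩ :=
        runs_iteration (P := P) hc hn hγ hδ hη hq hr1 hr2 hM hM'
      refine ⟨μ, hμ, fun m' hm' => ?_, fun a => ?_⟩
      · obtain ⟨p, hp⟩ := hpost m' hm'
        exact ⟨hp.constants, by rw [hp.counter, h8], hp.recorded hrec₁⟩
      · rintro ⟨hcov₁, hprog⟩
        cases a
        · refine hvalid.trans (prob_mono_on_support fun m' hm' h => ?_)
          obtain ⟨p, hp⟩ := hpost m' hm'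
          exact ⟨hp.covering hcov₁ (h p hp.candidate), by simp⟩
        · refine (hsucc S hS).trans (prob_mono_on_support fun m' hm' h => ?_)
          obtain ⟨p, hp⟩ := hpost m' hm'
          obtain ⟨p', hpS, h7, hmiss, h17⟩ := h
          obtain rfl : p' = p := Fin.ext (h7.symm.trans hp.candidate)
          refine ⟨hp.covering hcov₁ fun _ => hmiss.trans ?_,
            fun _ => hp.progress hε hρ hpS h17 (hprog rfl)⟩
          have := hγ.1
          have := hδ.1
          gcongr
          norm_num)
    (by
      rintro m₁ ⟨hc, h8, -⟩
      simp [h8, hc.nat2])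
    ⟨hm, hm8, hrec⟩
  refine ⟨μ, hμ, fun m' hm' => ⟨(hI m' hm').1, (hI m' hm').2.2⟩, fun hx => ?_, ?_⟩
  · refine (hJ true ⟨hcov, fun _ => Or.inr ⟨hx, ?_⟩⟩).trans
      (prob_mono fun m' h => ⟨h.1, (h.2 rfl).margin_ge hz hε hρ hzD⟩)
    simp only [CharP.cast_eq_zero, zero_mul]
    positivity
  · exact (hJ false ⟨hcov, by simp⟩).trans (prob_mono fun m' h => h.1)

end MainLoop

/-! ### The whole program -/

section Program

variable {n d : ℕ} {P : Fin n → EuclideanSpace ℝ (Fin d)} {z : ℕ} {γ δ ε : ℝ} {m : Mem}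

/-- The halfspace that is stored during the run of the program. -/
noncomputable def stored (d : ℕ) (m : Mem) : Halfspace d := ⟨vec d m (30 + d), m.real 21⟩

theorem Recorded.margin_stored (h : Recorded d m) : (stored d m).margin = m.real 22 := by
  rw [stored, Halfspace.margin, h.offset]
  rcases h.nonneg.eq_or_lt with h0 | h0
  · rw [← h0, zero_mul, zero_div]
  · exact mul_div_cancel_right₀ _ (norm_ne_zero_iff.2 (h.ne_zero h0))

theorem Recorded.exists_feasible (h : Recorded d m) (hc : Covering P γ δ m)
    (h0 : 0 < (stored d m).margin) :
    ∃ S, IsFeasible P ((1 + 19 * δ) * γ) S (stored d m) := by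
  classical
  rw [h.margin_stored] at h0
  have hy := h.ne_zero h0
  refine ⟨(Finset.univ.filter fun i => inner ℝ (vec d m (30 + d)) (P i) < m.real 21)ᶜ, ?_,
    ⟨hy, ?_⟩, fun i hi => ?_⟩
  · have h1 := hc h0
    rw [missed] at h1
    rw [Finset.card_compl, Nat.cast_sub (Finset.card_le_univ _), Fintype.card_fin]
    linarith
  · change 0 < m.real 21
    rw [h.offset]
    exact mul_pos h0 (norm_pos_iff.2 hy)
  · rw [Finset.mem_compl, Finset.mem_filter, not_and] at hi
    exact not_lt.1 (hi (Finset.mem_univ i))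

/-- The properties of the output distribution of the program: it is often an approximation of the
optimum, and it rarely has a positive margin without covering enough points. -/
theorem runs_program {η₁ η : ℝ} (hn : 0 < n)
    (hγ : γ ∈ Set.Ioo (0 : ℝ) 1) (hδ : δ ∈ Set.Ioo (0 : ℝ) 1) (hη : η ∈ Set.Ioo (0 : ℝ) 1)
    (hε : ε ∈ Set.Ioo (0 : ℝ) 1) {r M : ℕ}
    (hr1 : 1 ≤ 2 * γ * (r + 2)) (hr2 : r = 0 ∨ 2 * γ * (r + 1) < 1)
    (hM : (1 - γ * δ ^ 2) ^ M ≤ η ^ 2) (hM' : ∀ k < M, η ^ 2 < (1 - γ * δ ^ 2) ^ k)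
    {S : Finset (Fin n)} {Hopt : Halfspace d} (hopt : IsOptimal P γ S Hopt) (hz : 1 ≤ z)
    (hzD : 3 * (diameter P S ^ 2 / (ε * polytopeDist P S ^ 2)) ≤ z) :
    ∃ μ, Runs P program (start program n d z γ ε δ η₁ η).mem
        (z * ((r + 1 + M) * (20 * d + 27) + 42 * d + 73) + 76 * d + 115) μ ∧
      (1 - γ) * ((1 - η) * (δ / (3 * (1 + δ)))) ^ z ≤
        prob μ {m' | IsApprox P γ ε (19 * δ) (output d ⟨[], m'⟩)} ∧
      (1 - η) ^ z ≤ prob μ {m' | 0 < (output d ⟨[], m'⟩).margin →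
        ∃ S', IsFeasible P ((1 + 19 * δ) * γ) S' (output d ⟨[], m'⟩)} := by
  have hn' : (0 : ℝ) < n := by exact_mod_cast hn
  have hη0 : 0 < 1 - η := by linarith [hη.2]
  have hS := hopt.1.1
  have hSne : S.Nonempty := Finset.card_pos.1 (by
    have : (0 : ℝ) < (1 - γ) * n := mul_pos (by linarith [hγ.2]) hn'
    exact_mod_cast this.trans_le hS)
  have hle := hopt.1.margin_le_polytopeDist hSne
  have hρ : 0 < polytopeDist P S := hopt.1.margin_pos.trans_le hle
  have hs0 : 0 ≤ (1 - η) * (δ / (3 * (1 + δ))) := by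
    have := hδ.1
    positivity
  have hs1 : (1 - η) * (δ / (3 * (1 + δ))) ≤ 1 := by
    have h1 : δ / (3 * (1 + δ)) ≤ 1 := by
      rw [div_le_one (by linarith [hδ.1])]
      linarith [hδ.1]
    have h2 : 0 ≤ δ / (3 * (1 + δ)) := by
      have := hδ.1
      positivity
    nlinarith [hη.1]
  obtain ⟨m₁, hr₁, hm₁⟩ := runs_setConstants (d := d) program n z γ ε δ η₁ η
  obtain ⟨f, hf, hfQ⟩ := runs_chooseStart (P := P) hm₁ hn
  have hmain : ∀ m₂ ∈ ((uniformBelow n).map f).support, ∃ ν,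
      Runs P (.cond (.realLt (.dir 18) (.dir 5)) (.loop (.natLt (.dir 8) (.dir 2)) iteration)
        touchStart) m₂
        (z * ((r + 1 + M) * (20 * d + 27) + 42 * d + 73) + 42 * d + 36) ν ∧
      ((∀ m' ∈ ν.support, Constants n d z γ δ η m' ∧ Recorded d m') ∧
      (vec d m₂ 30 ∈ convexHull ℝ (P '' S) → ((1 - η) * (δ / (3 * (1 + δ)))) ^ z ≤
        prob ν {m' | Covering P γ δ m' ∧ (1 - ε) * polytopeDist P S ≤ m'.real 22}) ∧
      (1 - η) ^ z ≤ prob ν {m' | Covering P γ δ m'}) := by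
    intro m₂ hm₂
    rw [PMF.support_map] at hm₂
    obtain ⟨i, hi, rfl⟩ := hm₂
    have hpost := hfQ ⟨i, (mem_support_uniformBelow hn).1 hi⟩
    have hc : Constants n d z γ δ η (f i) := hm₁.toConstants.congr
      (fun a ha => hpost.nat a (by omega)) fun a ha => hpost.real a (by omega) (by omega) (by omega)
    have e18 : (f i).real 18 = (1 + 19 * δ) * γ :=
      (hpost.real 18 (by simp) (by simp) (by simp)).trans hm₁.real18
    have e21 : (f i).real 21 = 0 :=
      (hpost.real 21 (by simp) (by simp) (by simp)).trans hm₁.real21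
    have e22 : (f i).real 22 = 0 :=
      (hpost.real 22 (by simp) (by simp) (by simp)).trans hm₁.real22
    by_cases hq : (1 + 19 * δ) * γ < 1
    · obtain ⟨ν, hν, hνQ⟩ := runs_mainLoop (P := P) hc ((hpost.nat 8 (by simp)).trans hm₁.nat8)
        ⟨e22.ge, by rw [e21, e22, zero_mul], fun h => absurd h (by rw [e22]; exact lt_irrefl _)⟩
        (fun h => absurd h (by rw [e22]; exact lt_irrefl _)) hn hγ hδ hη hε hq hr1 hr2 hM hM' hS
        hρ hz hzD
      refine ⟨ν, (Runs.cond_true ?_ hν).mono (by omega), hνQ⟩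
      simpa [e18, hc.real5] using hq
    · obtain ⟨m', hr', hpost'⟩ := runs_touchStart (P := P) hc ⟨i, _⟩ hpost.nat7
      have hsupp : ∀ m'' ∈ (PMF.pure m').support, m'' = m' := fun m'' h => by
        rwa [PMF.support_pure, Set.mem_singleton_iff] at h
      have hcov : Covering P γ δ m' := fun _ => by
        have h1 : missed P (vec d m' (30 + d)) (m'.real 21) ≤ n :=
          (Finset.card_le_univ _).trans_eq (Fintype.card_fin n)
        have h2 : (missed P (vec d m' (30 + d)) (m'.real 21) : ℝ) ≤ n := by exact_mod_cast h1
        nlinarith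
      refine ⟨PMF.pure m', (Runs.cond_false ?_ hr').mono (by omega), fun m'' hm'' => ?_,
        fun hx => ?_, ?_⟩
      · simpa [e18, hc.real5] using hq
      · rw [hsupp m'' hm'']
        refine ⟨hc.congr hpost'.nat hpost'.real, by rw [hpost'.margin]; positivity, ?_, ?_⟩
        · rw [hpost'.offset, hpost'.margin, hpost'.y, sq]
        · rw [hpost'.margin, hpost'.y]
          exact fun h => norm_pos_iff.1 h
      · rw [prob_pure]
        · exact pow_le_one₀ hs0 hs1
        · refine ⟨hcov, ?_⟩
          rw [hpost'.margin]
          have := polytopeDist_le_norm hx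
          nlinarith [mul_pos hε.1 hρ]
      · rw [prob_pure (by exact hcov)]
        exact pow_le_one₀ hη0.le (by linarith [hη.1])
  have hout : ∀ m₃ : Mem, Constants n d z γ δ η m₃ ∧ Recorded d m₃ →
      ∃ ξ, Runs P writeOutput m₃ (12 * d + 13) ξ ∧
        ∃ m', ξ = PMF.pure m' ∧ output d ⟨[], m'⟩ = stored d m₃ := by
    rintro m₃ ⟨hc, -⟩
    obtain ⟨m', hr, h⟩ := runs_writeOutput (P := P) hc.nat1 hc.nat3 hc.real5
    exact ⟨_, hr, m', rfl, h⟩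
  have hrest : ∀ m₂ ∈ ((uniformBelow n).map f).support, ∃ ν,
      Runs P (.seq (.cond (.realLt (.dir 18) (.dir 5))
        (.loop (.natLt (.dir 8) (.dir 2)) iteration) touchStart) writeOutput) m₂
        (z * ((r + 1 + M) * (20 * d + 27) + 42 * d + 73) + 54 * d + 50) ν ∧
      ((vec d m₂ 30 ∈ convexHull ℝ (P '' S) → ((1 - η) * (δ / (3 * (1 + δ)))) ^ z ≤
        prob ν {m' | IsApprox P γ ε (19 * δ) (output d ⟨[], m'⟩)}) ∧
      (1 - η) ^ z ≤ prob ν {m' | 0 < (output d ⟨[], m'⟩).margin →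
        ∃ S', IsFeasible P ((1 + 19 * δ) * γ) S' (output d ⟨[], m'⟩)}) := by
    intro m₂ hm₂
    obtain ⟨ν, hν, hsupp, hsucc, hvalid⟩ := hmain m₂ hm₂
    obtain ⟨ξ, hξ, hξQ⟩ := Runs.seq_exists hν fun m₃ hm₃ => hout m₃ (hsupp m₃ hm₃)
    refine ⟨_, hξ.mono (by omega), fun hx => ?_, ?_⟩
    · have := le_prob_bind (ν := ξ) (b := 1) zero_le_one (hsucc hx)
        (A := {m' | IsApprox P γ ε (19 * δ) (output d ⟨[], m'⟩)}) fun m₃ hm₃ h => by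
          obtain ⟨m', e, he⟩ := hξQ m₃ hm₃
          rw [e, prob_pure]
          obtain ⟨-, hrec⟩ := hsupp m₃ hm₃
          have hpos : 0 < (1 - ε) * polytopeDist P S := mul_pos (by linarith [hε.2]) hρ
          rw [Set.mem_ofPred_eq, he]
          refine ⟨hrec.exists_feasible h.1 ?_, fun S' H' hH' => ?_⟩
          · rw [hrec.margin_stored]
            exact hpos.trans_le h.2
          · rw [hrec.margin_stored]
            refine le_trans ?_ h.2
            have := (hopt.2 S' H' hH').trans hle
            exact mul_le_mul_of_nonneg_left this (by linarith [hε.2])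
      rwa [mul_one] at this
    · have := le_prob_bind (ν := ξ) (b := 1) zero_le_one hvalid
        (A := {m' | 0 < (output d ⟨[], m'⟩).margin →
          ∃ S', IsFeasible P ((1 + 19 * δ) * γ) S' (output d ⟨[], m'⟩)}) fun m₃ hm₃ h => by
          obtain ⟨m', e, he⟩ := hξQ m₃ hm₃
          rw [e, prob_pure]
          rw [Set.mem_ofPred_eq, he]
          exact (hsupp m₃ hm₃).2.exists_feasible h
      rwa [mul_one] at this
  obtain ⟨ξ, hξ, hξQ⟩ := Runs.seq_exists hf hrest
  refine ⟨_, (hr₁.seq_pure hξ).mono (by omega), ?_, ?_⟩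
  · refine le_prob_bind (E := {m₂ | vec d m₂ 30 ∈ convexHull ℝ (P '' S)}) (by positivity) ?_
      fun m₂ hm₂ hx => (hξQ m₂ hm₂).1 hx
    rw [prob_map]
    refine le_trans ?_ (le_prob_uniformBelow hn _ S fun i hi => ?_)
    · rwa [le_div_iff₀ hn']
    · rw [Set.mem_preimage, Set.mem_ofPred_eq, (hfQ i).x]
      exact subset_convexHull ℝ _ ⟨i, hi, rfl⟩
  · have := le_prob_bind (ν := ξ) (E := Set.univ) (a := 1) (b := (1 - η) ^ z)
      (by positivity) (prob_eq_one fun _ _ => trivial).ge fun m₂ hm₂ _ => (hξQ m₂ hm₂).2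
    rwa [one_mul] at this

/-- The number of steps of the program. -/
theorem steps_le {η L : ℝ} (hγ : γ ∈ Set.Ioo (0 : ℝ) 1) (hδ : δ ∈ Set.Ioo (0 : ℝ) 1)
    (hε : ε ∈ Set.Ioo (0 : ℝ) 1) (hη : η ∈ Set.Ioo (0 : ℝ) 1) {r M : ℕ}
    (hr : (r + 1) * γ ≤ 1 + γ) (hM : M * (γ * δ ^ 2) ≤ γ * δ ^ 2 + 2 * Real.log (1 / η))
    (hL : 1 + Real.log (1 / η) ≤ L) (hz : 1 ≤ z) (hd : 1 ≤ d) :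
    ((z * ((r + 1 + M) * (20 * d + 27) + 42 * d + 73) + 76 * d + 115 : ℕ) : ℝ) ≤
      500 * (z * (d / (δ ^ 2 * γ * ε))) * L := by
  obtain ⟨hγ0, hγ1⟩ := hγ
  obtain ⟨hδ0, hδ1⟩ := hδ
  obtain ⟨hε0, hε1⟩ := hε
  have hz' : (1 : ℝ) ≤ z := by exact_mod_cast hz
  have hd' : (1 : ℝ) ≤ d := by exact_mod_cast hd
  have hlog : 0 ≤ Real.log (1 / η) :=
    Real.log_nonneg (by rw [le_div_iff₀ hη.1]; linarith [hη.2])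
  have hL1 : 1 ≤ L := by linarith
  have hδ2 : δ ^ 2 ≤ 1 := pow_le_one₀ hδ0.le hδ1.le
  set y := γ * δ ^ 2 with hy
  have hy0 : 0 < y := by positivity
  have hyγ : y ≤ γ := by nlinarith
  have h1 : (r + 1 + M : ℝ) * y ≤ 4 * L := by
    have : (r + 1 : ℝ) * y ≤ (r + 1) * γ := by gcongr
    nlinarith
  have h2 : (z * ((r + 1 + M) * (20 * d + 27) + 42 * d + 73) + 76 * d + 115 : ℝ) ≤
      z * d * (47 * (r + 1 + M) + 306) := by
    have hzd : (1 : ℝ) ≤ z * d := by nlinarith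
    have h3 : (z : ℝ) ≤ z * d := by nlinarith
    have h4 : (d : ℝ) ≤ z * d := by nlinarith
    have h5 : (z : ℝ) * (r + 1 + M) ≤ z * d * (r + 1 + M) := by gcongr
    nlinarith
  have h3 : (47 * (r + 1 + M) + 306 : ℝ) * y ≤ 500 * L := by nlinarith
  have h4 : (47 * (r + 1 + M) + 306 : ℝ) ≤ 500 * L / (δ ^ 2 * γ * ε) := by
    rw [le_div_iff₀ (by positivity)]
    refine le_trans ?_ h3
    have : δ ^ 2 * γ * ε ≤ y := by
      rw [hy]
      nlinarith
    gcongr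
  push_cast
  refine h2.trans ((mul_le_mul_of_nonneg_left h4 (by positivity)).trans_eq ?_)
  ring

end Program

/-! ### Independent runs -/

section Independent

theorem prob_bind_le {α β : Type*} {μ : PMF α} {ν : α → PMF β} {A : Set β} {E : Set α} {b : ℝ}
    (hb : 0 ≤ b) (h : ∀ x ∈ E, prob (ν x) A ≤ b) (h0 : ∀ x ∉ E, prob (ν x) A = 0) :
    prob (μ.bind ν) A ≤ prob μ E * b := by
  rw [prob, prob, ← ENNReal.toReal_ofReal hb, ← ENNReal.toReal_mul]
  refine ENNReal.toReal_mono
    (ENNReal.mul_ne_top (toOuterMeasure_ne_top _ _) ENNReal.ofReal_ne_top) ?_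
  rw [PMF.toOuterMeasure_bind_apply, PMF.toOuterMeasure_apply, ← ENNReal.tsum_mul_right]
  refine ENNReal.tsum_le_tsum fun x => ?_
  rw [← ofReal_prob]
  by_cases hx : x ∈ E
  · rw [Set.indicator_of_mem hx]
    gcongr
    exact h x hx
  · simp [h0 x hx]

variable {α : Type*} {p : PMF α}

theorem prob_iid_forall_ge (A : Set α) (N : ℕ) :
    prob p A ^ N ≤ prob (iid p N) {l | ∀ a ∈ l, a ∈ A} := by
  induction N with
  | zero => rw [iid, prob_pure (by simp), pow_zero]
  | succ N ih =>
    rw [pow_succ', iid]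
    refine le_prob_bind (pow_nonneg (prob_nonneg _ _) _) le_rfl fun a _ ha => ?_
    rw [prob_map]
    exact ih.trans (prob_mono fun l hl b hb => by
      rcases List.mem_cons.1 hb with rfl | hb
      · exact ha
      · exact hl b hb)

theorem prob_iid_forall_le (A : Set α) (N : ℕ) :
    prob (iid p N) {l | ∀ a ∈ l, a ∈ A} ≤ prob p A ^ N := by
  induction N with
  | zero => rw [pow_zero]; exact prob_le_one _ _
  | succ N ih =>
    rw [pow_succ', iid]
    refine prob_bind_le (pow_nonneg (prob_nonneg _ _) _) (fun a _ => ?_) fun a ha => ?_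
    · rw [prob_map]
      exact (prob_mono fun l (hl : ∀ b ∈ a :: l, b ∈ A) b hb =>
        hl b (List.mem_cons_of_mem _ hb)).trans ih
    · rw [prob_map]
      refine le_antisymm ((prob_mono (B := ∅) fun l (hl : ∀ b ∈ a :: l, b ∈ A) =>
        ha (hl a List.mem_cons_self)).trans ?_)
        (prob_nonneg _ _)
      simp [prob]

/-- Among `N` independent draws, with high probability all are in `B` and one is in `A`. -/
theorem prob_iid_ge (A B : Set α) (N : ℕ) :
    prob p B ^ N - 1 / (1 + N * prob p A) ≤
      prob (iid p N) {l | (∀ a ∈ l, a ∈ B) ∧ ∃ a ∈ l, a ∈ A} := by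
  have h1 := prob_iid_forall_ge (p := p) B N
  have h2 := prob_iid_forall_le (p := p) Aᶜ N
  rw [prob_compl] at h2
  have h3 := one_sub_pow_le (prob_nonneg p A) (prob_le_one p A) N
  have h4 := prob_inter_ge (iid p N) {l | ∀ a ∈ l, a ∈ B} {l | ∀ a ∈ l, a ∈ Aᶜ}ᶜ
  rw [prob_compl] at h4
  refine le_trans ?_ (h4.trans (prob_mono ?_))
  · linarith
  · rintro l ⟨hB, hA⟩
    refine ⟨hB, ?_⟩
    by_contra hc
    exact hA fun a ha haA => hc ⟨a, ha, haA⟩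

end Independent

/-- The number of runs suffices: `a` is the probability that a run succeeds, `b` the probability
that its output is not misleading. -/
theorem amplification_bound {γ δ η₁ η₂ a b : ℝ} {z N : ℕ} (hγ : γ ∈ Set.Ioo (0 : ℝ) 1)
    (hδ : δ ∈ Set.Ioo (0 : ℝ) 1) (hη₁ : η₁ ∈ Set.Ioo (0 : ℝ) 1) (hη₂ : η₂ ∈ Set.Ioo (0 : ℝ) 1)
    (hz : 1 ≤ z) (hN : 10 * (1 / (1 - γ) * (1 / (1 - η₁) * (3 + 3 / δ)) ^ z) ≤ N)
    (hηN : η₂ ≤ 1 / 10 / (z * N))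
    (ha : (1 - γ) * ((1 - η₁) * (1 - η₂) * (δ / (3 * (1 + δ)))) ^ z ≤ a)
    (hb : (1 - η₂) ^ z ≤ b) :
    2 / 3 ≤ b ^ N - 1 / (1 + N * a) := by
  obtain ⟨hγ0, hγ1⟩ := hγ
  obtain ⟨hδ0, hδ1⟩ := hδ
  obtain ⟨h10, h11⟩ := hη₁
  obtain ⟨h20, h21⟩ := hη₂
  have hγ' : 0 < 1 - γ := by linarith
  have h1' : 0 < 1 - η₁ := by linarith
  have h2' : 0 < 1 - η₂ := by linarith
  have hN0 : (0 : ℝ) < N := lt_of_lt_of_le (by positivity) hN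
  have hN1 : (1 : ℝ) ≤ N := by exact_mod_cast (by exact_mod_cast hN0 : 0 < N)
  have hz0 : (0 : ℝ) < z := by exact_mod_cast hz
  have hzN : η₂ * (z * N) ≤ 1 / 10 := (le_div_iff₀ (by positivity)).1 hηN
  have hbern : ∀ k : ℕ, 1 - k * η₂ ≤ (1 - η₂) ^ k := fun k => by
    have := one_add_mul_le_pow (by linarith : -2 ≤ -η₂) k
    calc 1 - k * η₂ = 1 + k * (-η₂) := by ring
      _ ≤ (1 + -η₂) ^ k := this
      _ = (1 - η₂) ^ k := by ring
  have hb' : 9 / 10 ≤ b ^ N := by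
    have h1 := hbern (z * N)
    push_cast at h1
    rw [pow_mul] at h1
    have h2 : ((1 - η₂) ^ z) ^ N ≤ b ^ N := pow_le_pow_left₀ (by positivity) hb N
    linarith
  have ha' : 9 ≤ N * a := by
    have h1 : 9 / 10 ≤ (1 - η₂) ^ z := by
      have := hbern z
      have h2 : z * η₂ ≤ η₂ * (z * N) := by nlinarith [mul_pos hz0 h20]
      linarith
    have h3 : (3 + 3 / δ) * (δ / (3 * (1 + δ))) = 1 := by
      field_simp
      ring
    have h4 : (1 / (1 - γ) * (1 / (1 - η₁) * (3 + 3 / δ)) ^ z) *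
        ((1 - γ) * ((1 - η₁) * (1 - η₂) * (δ / (3 * (1 + δ)))) ^ z) = (1 - η₂) ^ z := by
      have h5 : (1 / (1 - η₁) * (3 + 3 / δ)) * ((1 - η₁) * (1 - η₂) * (δ / (3 * (1 + δ)))) =
          1 - η₂ := by
        calc _ = (1 / (1 - η₁) * (1 - η₁)) * (1 - η₂) * ((3 + 3 / δ) * (δ / (3 * (1 + δ)))) := by
              ring
          _ = 1 - η₂ := by rw [h3, one_div_mul_cancel h1'.ne', one_mul, mul_one]
      rw [mul_mul_mul_comm, ← mul_pow, h5, one_div_mul_cancel hγ'.ne', one_mul]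
    have h5 : 0 ≤ (1 - γ) * ((1 - η₁) * (1 - η₂) * (δ / (3 * (1 + δ)))) ^ z := by positivity
    calc (9 : ℝ) ≤ 10 * (1 - η₂) ^ z := by linarith
      _ = 10 * (1 / (1 - γ) * (1 / (1 - η₁) * (3 + 3 / δ)) ^ z) *
          ((1 - γ) * ((1 - η₁) * (1 - η₂) * (δ / (3 * (1 + δ)))) ^ z) := by rw [← h4]; ring
      _ ≤ N * ((1 - γ) * ((1 - η₁) * (1 - η₂) * (δ / (3 * (1 + δ)))) ^ z) := by gcongr
      _ ≤ N * a := by gcongr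
  have h6 : 1 / (1 + N * a) ≤ 1 / 10 := one_div_le_one_div_of_le (by norm_num) (by linarith)
  linarith

end OneClassSVM

theorem theorem8 :
    ∃ (prog : RealRAM.Cmd) (C₀ C₁ C₂ C₃ c : ℝ) (k : ℕ),
      0 < C₀ ∧ 0 < C₁ ∧ 0 < C₂ ∧ 0 < C₃ ∧ 0 < c ∧
      ∀ (n d : ℕ) (P : Fin n → EuclideanSpace ℝ (Fin d)) (γ ε δ η₁ η₂ : ℝ),
        γ ∈ Set.Ioo (0 : ℝ) 1 → ε ∈ Set.Ioo (0 : ℝ) 1 → δ ∈ Set.Ioo (0 : ℝ) 1 →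
        η₁ ∈ Set.Ioo (0 : ℝ) 1 → η₂ ∈ Set.Ioo (0 : ℝ) 1 →
        ∀ (S : Finset (Fin n)) (Hopt : OneClassSVM.Halfspace d),
          OneClassSVM.IsOptimal P γ S Hopt →
        ∀ (D ρ : ℝ), D = OneClassSVM.diameter P S → ρ = OneClassSVM.polytopeDist P S →
        ∀ z : ℕ, 1 ≤ z → C₀ * (D ^ 2 / (ε * ρ ^ 2)) ≤ z →
        ∃ T : ℕ,
          -- the running time
          (T : ℝ) ≤ C₂ * (z * (d / (δ ^ 2 * γ * ε)))
            * (1 + Real.log (1 / (η₁ * η₂ * δ * (1 - γ)))) ^ k ∧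
          ((z : ℝ) ≤ C₀ * (D ^ 2 / (ε * ρ ^ 2)) + 1 →
            (T : ℝ) ≤ C₂ * ((D ^ 2 / (ε * ρ ^ 2) + 1) * (d / (δ ^ 2 * γ * ε)))
              * (1 + Real.log (1 / (η₁ * η₂ * δ * (1 - γ)))) ^ k) ∧
          RealRAM.HaltsWithin P T (OneClassSVM.start prog n d z γ ε δ η₁ η₂) ∧
          -- the success probability of one run
          ENNReal.ofReal
              ((1 - γ) * ((1 - η₁) * (1 - η₂) * (δ / (3 * (1 + δ)))) ^ z) ≤
            (OneClassSVM.outputDist P T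
              (OneClassSVM.start prog n d z γ ε δ η₁ η₂)).toOuterMeasure
                {H | OneClassSVM.IsApprox P γ ε (C₁ * δ) H} ∧
          -- the success probability of `N` independent runs
          ∀ N : ℕ, C₃ * (1 / (1 - γ) * (1 / (1 - η₁) * (3 + 3 / δ)) ^ z) ≤ N →
            η₂ ≤ c / (z * N) →
            ENNReal.ofReal (2 / 3) ≤
              (RealRAM.iid (OneClassSVM.outputDist P T
                (OneClassSVM.start prog n d z γ ε δ η₁ η₂)) N).toOuterMeasure
                  {l | OneClassSVM.BestIsApprox P γ ε (C₁ * δ) l} := by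
  refine ⟨OneClassSVM.program, 3, 19, 1500, 10, 1 / 10, 1, by norm_num, by norm_num, by norm_num,
    by norm_num, by norm_num, ?_⟩
  rintro n d P γ ε δ η₁ η₂ hγ hε hδ hη₁ hη₂ S Hopt hopt D ρ rfl rfl z hz hzD
  obtain ⟨r, hr1, hr2, hr3⟩ := OneClassSVM.exists_search_length hγ.1
  have hy0 : 0 < γ * δ ^ 2 := mul_pos hγ.1 (pow_pos hδ.1 2)
  have hy1 : γ * δ ^ 2 < 1 := by
    have := pow_le_one₀ hδ.1.le hδ.2.le (n := 2)
    nlinarith [hγ.1, hγ.2]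
  obtain ⟨M, hM, hM', hM3⟩ := OneClassSVM.exists_test_length hy0 hy1 hη₂.1 hη₂.2
  obtain ⟨μ, hμ, hsucc, hvalid⟩ := OneClassSVM.runs_program (P := P) (η₁ := η₁) hopt.card_pos
    hγ hδ hη₂ hε hr1 hr2 hM hM' hopt hz hzD
  have hη₂' : 0 < 1 - η₂ := by linarith [hη₂.2]
  have hγ' : 0 < 1 - γ := by linarith [hγ.2]
  have hη₁' : 0 < 1 - η₁ := by linarith [hη₁.2]
  have hδ' : 0 < 1 + δ := by linarith [hδ.1]
  have hδ0 := hδ.1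
  have hL : 1 + Real.log (1 / η₂) ≤ 1 + Real.log (1 / (η₁ * η₂ * δ * (1 - γ))) := by
    have h1 : η₁ * η₂ * δ * (1 - γ) ≤ η₂ := by
      have h2 : η₁ * δ ≤ 1 := mul_le_one₀ hη₁.2.le hδ.1.le hδ.2.le
      have h3 : η₁ * δ * (1 - γ) ≤ 1 := mul_le_one₀ h2 hγ'.le (by linarith [hγ.1])
      nlinarith [hη₂.1]
    have h2 : 0 < η₁ * η₂ * δ * (1 - γ) :=
      mul_pos (mul_pos (mul_pos hη₁.1 hη₂.1) hδ.1) hγ'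
    have := hη₂.1
    gcongr
  have hT := OneClassSVM.steps_le hγ hδ hε hη₂ hr3 hM3 hL hz hopt.1.dim_pos
  have hL0 : 0 ≤ 1 + Real.log (1 / (η₁ * η₂ * δ * (1 - γ))) := by
    refine le_trans ?_ hL
    have := Real.log_nonneg (x := 1 / η₂) (by rw [le_div_iff₀ hη₂.1]; linarith [hη₂.2])
    linarith
  set L := 1 + Real.log (1 / (η₁ * η₂ * δ * (1 - γ)))
  have hQ : 0 ≤ (d : ℝ) / (δ ^ 2 * γ * ε) := by
    have := hγ.1
    have := hε.1
    positivity
  have hfin : RealRAM.run P (z * ((r + 1 + M) * (20 * d + 27) + 42 * d + 73) + 76 * d + 115)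
      (OneClassSVM.start OneClassSVM.program n d z γ ε δ η₁ η₂) = μ.map (RealRAM.Config.mk []) :=
    hμ.finishesAs
  have hdist : OneClassSVM.outputDist P
      (z * ((r + 1 + M) * (20 * d + 27) + 42 * d + 73) + 76 * d + 115)
      (OneClassSVM.start OneClassSVM.program n d z γ ε δ η₁ η₂) =
      μ.map fun m' => OneClassSVM.output d ⟨[], m'⟩ := by
    rw [OneClassSVM.outputDist, hfin, PMF.map_comp]
    rfl
  have hweak : (1 - γ) * ((1 - η₁) * (1 - η₂) * (δ / (3 * (1 + δ)))) ^ z ≤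
      (1 - γ) * ((1 - η₂) * (δ / (3 * (1 + δ)))) ^ z := by
    have h1 : (1 - η₁) * (1 - η₂) ≤ 1 - η₂ := by nlinarith [hη₁.1]
    gcongr
  refine ⟨_, hT.trans ?_, fun hz' => hT.trans ?_, ?_, ?_, ?_⟩
  · rw [pow_one]
    have : 0 ≤ (z : ℝ) * (d / (δ ^ 2 * γ * ε)) := by positivity
    gcongr
    norm_num
  · rw [pow_one]
    set X := OneClassSVM.diameter P S ^ 2 / (ε * OneClassSVM.polytopeDist P S ^ 2)
    have h1 : 500 * ((z : ℝ) * (d / (δ ^ 2 * γ * ε))) ≤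
        1500 * ((X + 1) * (d / (δ ^ 2 * γ * ε))) := by
      have h2 : (z : ℝ) * (d / (δ ^ 2 * γ * ε)) ≤ (3 * X + 1) * (d / (δ ^ 2 * γ * ε)) := by
        gcongr
      nlinarith
    gcongr
  · intro c' hc'
    rw [hfin, PMF.support_map] at hc'
    obtain ⟨m', -, rfl⟩ := hc'
    rfl
  · rw [hdist, ← RealRAM.ofReal_prob, RealRAM.prob_map]
    refine ENNReal.ofReal_le_ofReal (hweak.trans hsucc)
  · intro N hN hηN
    rw [hdist, ← RealRAM.ofReal_prob]
    refine ENNReal.ofReal_le_ofReal ?_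
    refine (OneClassSVM.amplification_bound hγ hδ hη₁ hη₂ hz hN hηN (hweak.trans hsucc)
      hvalid).trans ?_
    have := OneClassSVM.prob_iid_ge (p := μ.map fun m' => OneClassSVM.output d ⟨[], m'⟩)
      {H | OneClassSVM.IsApprox P γ ε (19 * δ) H}
      {H | 0 < H.margin → ∃ S', OneClassSVM.IsFeasible P ((1 + 19 * δ) * γ) S' H} N
    rw [RealRAM.prob_map, RealRAM.prob_map] at this
    refine this.trans (RealRAM.prob_mono ?_)
    -- The best output has a margin at least that of some approximation; hence it is positive, and
    -- therefore the best output covers enough points.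
    rintro l ⟨hl, H₀, hH₀, ⟨S₀, hS₀⟩, happ⟩ H hH hbest
    have hle := hbest H₀ hH₀
    exact ⟨hl H hH (hS₀.margin_pos.trans_le hle), fun S' H' hH' => (happ S' H' hH').trans hle⟩
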